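/- Let $S=(S_t)_{t\ge 0}$ be a driftless subordinator with $S_0=0$ on a probability space, such that each $S_t$, $t>0$, has a bounded density $\bar p(t,\cdot)$ (taken jointly measurable in both variables), and whose Lévy measure $\nu$, given by $\mathbb E[e^{-\lambda S_t}]=\exp\big(-t\int_0^\infty(1-e^{-\lambda x})\,\nu(dx)\big)$ and $\int_0^\infty\min\{1,x\}\,\nu(dx)<\infty$, is infinite. Put $w(x)=\nu(x,\infty)$ for $x>0$ and $E_t=\inf\{s>0: S_s>t\}$. Let $E$ be a locally compact separable metric space, $\mu$ a $\sigma$-finite Radon measure on $E$ with full support, $(\mathcal L,D(\mathcal L))$ the generator of a symmetric Dirichlet form on the real space $L^2(E;\mu)$, and $(P^0_t)_{t\ge0}$ the associated strongly continuous contraction semigroup on $L^2(E;\mu)$. Let $T_0\in(0,\infty)$, $g\in L^2(E;\mu)$, and let $f:(0,T_0]\to L^2(E;\mu)$ be strongly measurable with $\|f(t)\|_{L^2}\le K<\infty$ for a.e. $t\in(0,T_0]$. Then for every $t\in(0,T_0]$ all integrals in $$u(t)=\mathbb E\big[P^0_{E_t}g\big]+\mathbb E\Big[\int_0^\infty \mathbf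 1_{\{S_r<t\}}P^0_rf(t-S_r)\,dr\Big]=\mathbb E\big[P^0_{E_t}g\big]+\int_0^t\int_0^\infty \bar p(r,t-s)\,P^0_rf(s)\,dr\,ds$$ converge absolutely in $L^2(E;\mu)$, the two expressions agree, and $u$ is the unique weak solution of $\partial^w_tu=\mathcal Lu+f$ on $(0,T_0]\times E$ with $u(0)=g$; that is, $u$ has the following two properties, and every $v:(0,T_0]\to L^2(E;\mu)$ with these properties satisfies $v(t)=u(t)$ for all $t\in(0,T_0]$. (i) $t\mapsto u(t)$ is continuous from $(0,T_0]$ to $L^2(E;\mu)$, $\sup_{t\in(0,T_0]}\|u(t)\|_{L^2}<\infty$, and $u(t)\to g$ in $L^2(E;\mu)$ as $t\to0$. (ii) For every $T\in(0,T_0]$ the integral $\int_0^Tw(T-s)(u(s)-g)\,ds$ converges absolutely in $L^2(E;\mu)$, and for every $\varphi\in D(\mathcal L)$ $$\Big\langle\int_0^Tw(T-s)(u(s)-g)\,ds,\varphi\Big\rangle=\int_0^T\langle f(s),\varphi\rangle\,ds+\int_0^T\langle u(s),\mathcal L\varphi\rangle\,ds.$$ If in addition there is a constant $K'<\infty$ such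 that, for a.e. $t\in(0,T_0]$, $f(t)\in D(\mathcal L)$ and $\|\mathcal Lf(t)\|_{L^2}\le K'$, then $u(t)\in D(\mathcal L)$ for every $t\in(0,T_0]$, and $t\mapsto\mathcal Lu(t)$ is continuous from $(0,T_0]$ to $L^2(E;\mu)$. -/

import Mathlib

open MeasureTheory ProbabilityTheory Filter Topology Set
open scoped NNReal ENNReal

namespace TimeFractional

noncomputable section

/-! ### Subordinators -/

section Subordinator

variable {Ω : Type*} [MeasurableSpace Ω]

/-- `S = (S_t)_{t ≥ 0}` is a subordinator started at `0` under `Prob`: a process with independent and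
stationary increments whose paths almost surely start at `0`, are nondecreasing and are
right-continuous. The time index is a real number; only times `t ≥ 0` matter. -/
structure IsSubordinator (S : ℝ → Ω → ℝ) (Prob : Measure Ω) : Prop where
  measurable : ∀ t, 0 ≤ t → Measurable (S t)
  start_zero : ∀ᵐ ω ∂Prob, S 0 ω = 0
  monotone_paths : ∀ᵐ ω ∂Prob, MonotoneOn (fun t => S t ω) (Ici 0)
  rightCont_paths : ∀ᵐ ω ∂Prob, ∀ t, 0 ≤ t → ContinuousWithinAt (fun s => S s ω) (Ici t) t
  indep_increments : HasIndepIncrements (fun (t : ℝ≥0) ω => S (t : ℝ) ω) Prob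
  stationary_increments : ∀ s t, 0 ≤ s → 0 ≤ t →
    IdentDistrib (fun ω => S (s + t) ω - S s ω) (S t) Prob Prob

/-- `ν` is the Lévy measure of the driftless subordinator `S`: it is carried by `(0, ∞)`,
integrates `min 1 x`, and `𝔼 exp (-λ S_t) = exp (-t φ(λ))` with
`φ(λ) = ∫ (1 - exp (-λ x)) ν(dx)` (no linear term). -/
structure IsDriftlessLevyMeasure (S : ℝ → Ω → ℝ) (Prob : Measure Ω) (ν : Measure ℝ) : Prop where
  carried : ν (Iic 0) = 0
  integrable_min : ∫⁻ x, ENNReal.ofReal (min 1 x) ∂ν < ∞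
  laplace : ∀ l t, 0 < l → 0 ≤ t →
    ∫ ω, Real.exp (-(l * S t ω)) ∂Prob
      = Real.exp (-(t * ∫ x, (1 - Real.exp (-(l * x))) ∂ν))

/-- The law of the real random variable `X` has a bounded density with respect to Lebesgue
measure. -/
def HasBoundedDensity (X : Ω → ℝ) (Prob : Measure Ω) : Prop :=
  ∃ p : ℝ → ℝ, Measurable p ∧ (∃ C, ∀ x, 0 ≤ p x ∧ p x ≤ C) ∧
    Prob.map X = volume.withDensity (fun x => ENNReal.ofReal (p x))

/-- `p r x` is a jointly measurable version of the transition densities of `S`: for each `r > 0`,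
`p r` is a density of the law of `S_r`. -/
structure IsTransitionDensity (p : ℝ → ℝ → ℝ) (S : ℝ → Ω → ℝ) (Prob : Measure Ω) : Prop where
  measurable : Measurable (Function.uncurry p)
  nonneg : ∀ r x, 0 ≤ p r x
  map_eq : ∀ r, 0 < r → Prob.map (S r) = volume.withDensity (fun x => ENNReal.ofReal (p r x))

/-- The inverse subordinator `E_t = inf {s > 0 : S_s > t}`. -/
def inverseSubordinator (S : ℝ → Ω → ℝ) (t : ℝ) (ω : Ω) : ℝ :=
  sInf {s : ℝ | 0 < s ∧ t < S s ω}

end Subordinator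

/-- The weight `w(x) = ν (x, ∞)`, a finite number for `x > 0`. -/
def weight (ν : Measure ℝ) (x : ℝ) : ℝ := (ν (Ioi x)).toReal

/-! ### Dirichlet forms, their generators and semigroups -/

section Dirichlet

variable {E : Type*} [MeasurableSpace E]

/-- A (symmetric) Dirichlet form on the real Hilbert space `L²(E; μ)`: a densely defined,
symmetric, nonnegative definite, closed bilinear form on which the unit contraction operates. -/
structure DirichletForm (μ : Measure E) where
  /-- the domain of the form -/
  domain : Submodule ℝ (Lp ℝ 2 μ)
  /-- the form itself -/
  form : domain →ₗ[ℝ] domain →ₗ[ℝ] ℝ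
  dense : Dense (domain : Set (Lp ℝ 2 μ))
  symm : ∀ u v, form u v = form v u
  nonneg : ∀ u, 0 ≤ form u u
  /-- The domain is complete for the norm `(form u u + ‖u‖²)^(1/2)`. -/
  closed : ∀ x : ℕ → domain,
    (∀ ε : ℝ, 0 < ε → ∃ N, ∀ m n, N ≤ m → N ≤ n →
      form (x m - x n) (x m - x n) + ‖x m - x n‖ ^ 2 < ε) →
    ∃ y : domain,
      Tendsto (fun n => form (x n - y) (x n - y) + ‖x n - y‖ ^ 2) atTop (𝓝 0)
  /-- If `u` is in the domain, so is `v = (0 ∨ u) ∧ 1`, and `form v v ≤ form u u`. -/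
  markov : ∀ (u : domain) (v : Lp ℝ 2 μ),
    (v =ᵐ[μ] fun x => min (max ((u : Lp ℝ 2 μ) x) 0) 1) →
    ∃ hv : v ∈ domain, form ⟨v, hv⟩ ⟨v, hv⟩ ≤ form u u

variable {μ : Measure E}

/-- The graph of the generator: the pairs `(u, h)` with `u` in the domain of the form and
`form u v = -⟨h, v⟩` for every `v` in that domain. -/
def DirichletForm.generatorGraph (D : DirichletForm μ) :
    Submodule ℝ (Lp ℝ 2 μ × Lp ℝ 2 μ) where
  carrier := {p | ∃ hu : p.1 ∈ D.domain, ∀ v : D.domain,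
    D.form ⟨p.1, hu⟩ v = -inner ℝ p.2 (v : Lp ℝ 2 μ)}
  zero_mem' := ⟨D.domain.zero_mem, fun v => by
    have h : (⟨(0 : Lp ℝ 2 μ × Lp ℝ 2 μ).1, D.domain.zero_mem⟩ : D.domain) = 0 := rfl
    rw [h]; simp⟩
  add_mem' := by
    rintro ⟨a, b⟩ ⟨a', b'⟩ ⟨ha, hb⟩ ⟨ha', hb'⟩
    refine ⟨D.domain.add_mem ha ha', fun v => ?_⟩
    have h : (⟨a + a', D.domain.add_mem ha ha'⟩ : D.domain) = ⟨a, ha⟩ + ⟨a', ha'⟩ := rfl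
    have h1 := hb v
    have h2 := hb' v
    simp only [Prod.mk_add_mk] at h1 h2 ⊢
    rw [h, map_add, LinearMap.add_apply, h1, h2, inner_add_left]
    ring
  smul_mem' := by
    rintro c ⟨a, b⟩ ⟨ha, hb⟩
    refine ⟨D.domain.smul_mem c ha, fun v => ?_⟩
    have h : (⟨c • a, D.domain.smul_mem c ha⟩ : D.domain) = c • ⟨a, ha⟩ := rfl
    have h1 := hb v
    simp only [Prod.smul_mk] at h1 ⊢
    rw [h, map_smul, LinearMap.smul_apply, h1, real_inner_smul_left, smul_eq_mul]
    ring

/-- The generator `(𝓛, D(𝓛))` of the Dirichlet form, as an unbounded operator on `L²(E; μ)`. -/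
def DirichletForm.generator (D : DirichletForm μ) : Lp ℝ 2 μ →ₗ.[ℝ] Lp ℝ 2 μ :=
  D.generatorGraph.toLinearPMap

/-- The defining relation of the generator is single-valued, so it is its graph. -/
theorem DirichletForm.generator_graph (D : DirichletForm μ) :
    D.generator.graph = D.generatorGraph := by
  refine Submodule.toLinearPMap_graph_eq _ ?_
  rintro ⟨a, b⟩ ⟨ha, hb⟩ hx
  simp only at hx
  subst hx
  refine D.dense.eq_zero_of_inner_left ℝ (x := b) fun v hv => ?_
  have h : (⟨0, ha⟩ : D.domain) = 0 := rfl
  have h1 := hb ⟨v, hv⟩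
  simp only [h, map_zero, LinearMap.zero_apply] at h1
  linarith

end Dirichlet

/-- `(P_t)_{t ≥ 0}` is a strongly continuous contraction semigroup on the Banach space `B`. The
time index is a real number; only times `t ≥ 0` matter. -/
structure IsContractionSemigroup {B : Type*} [NormedAddCommGroup B] [NormedSpace ℝ B]
    (P : ℝ → B →L[ℝ] B) : Prop where
  zero : P 0 = ContinuousLinearMap.id ℝ B
  add : ∀ s t, 0 ≤ s → 0 ≤ t → P (s + t) = (P s).comp (P t)
  contraction : ∀ t, 0 ≤ t → ‖P t‖ ≤ 1
  strong_cont : ∀ u, Tendsto (fun t => P t u) (𝓝[>] 0) (𝓝 u)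

/-- `A` is the infinitesimal generator of `P`: `u ∈ D(A)` and `A u = h` if and only if
`(P_t u - u) / t → h` as `t ↓ 0`. -/
def IsInfinitesimalGenerator {B : Type*} [NormedAddCommGroup B] [NormedSpace ℝ B]
    (A : B →ₗ.[ℝ] B) (P : ℝ → B →L[ℝ] B) : Prop :=
  ∀ u h : B, (u, h) ∈ A.graph ↔ Tendsto (fun t : ℝ => t⁻¹ • (P t u - u)) (𝓝[>] 0) (𝓝 h)

/-! ### The representation formula and weak solutions -/

section Equation

variable {E : Type*} [MeasurableSpace E] {μ : Measure E}

/-- `u` is a weak solution of `∂ₜʷ u = 𝓛 u + f` on `(0, T₀] × E` with `u(0, ·) = g`. -/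
structure IsWeakSolution (w : ℝ → ℝ) (L : Lp ℝ 2 μ →ₗ.[ℝ] Lp ℝ 2 μ) (T₀ : ℝ)
    (g : Lp ℝ 2 μ) (f u : ℝ → Lp ℝ 2 μ) : Prop where
  continuousOn : ContinuousOn u (Ioc 0 T₀)
  bounded : ∃ C, ∀ t ∈ Ioc 0 T₀, ‖u t‖ ≤ C
  initial : Tendsto u (𝓝[>] 0) (𝓝 g)
  integrable : ∀ T ∈ Ioc 0 T₀,
    IntervalIntegrable (fun s => w (T - s) • (u s - g)) volume 0 T
  equation : ∀ T ∈ Ioc 0 T₀, ∀ φ : L.domain,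
    inner ℝ (∫ s in (0 : ℝ)..T, w (T - s) • (u s - g)) (φ : Lp ℝ 2 μ)
      = (∫ s in (0 : ℝ)..T, inner ℝ (f s) (φ : Lp ℝ 2 μ))
        + ∫ s in (0 : ℝ)..T, inner ℝ (u s) (L φ)

variable {Ω : Type*} [MeasurableSpace Ω]

/-- The integrand `1_{S_r(ω) < t} P_r f(t - S_r(ω))`. -/
def sourceIntegrand (P : ℝ → Lp ℝ 2 μ →L[ℝ] Lp ℝ 2 μ) (S : ℝ → Ω → ℝ)
    (f : ℝ → Lp ℝ 2 μ) (t : ℝ) (ω : Ω) (r : ℝ) : Lp ℝ 2 μ :=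
  {r' : ℝ | S r' ω < t}.indicator (fun r' => P r' (f (t - S r' ω))) r

/-- `u(t) = 𝔼[P_{E_t} g] + 𝔼[∫_0^∞ 1_{S_r < t} P_r f(t - S_r) dr]`. -/
def representation (P : ℝ → Lp ℝ 2 μ →L[ℝ] Lp ℝ 2 μ) (S : ℝ → Ω → ℝ) (Prob : Measure Ω)
    (g : Lp ℝ 2 μ) (f : ℝ → Lp ℝ 2 μ) (t : ℝ) : Lp ℝ 2 μ :=
  (∫ ω, P (inverseSubordinator S t ω) g ∂Prob)
    + ∫ ω, (∫ r in Ioi (0 : ℝ), sourceIntegrand P S f t ω r) ∂Prob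

end Equation

end

end TimeFractional

/-!
The proof rests on one identity of laws. If `y` has the "law" `w(y) dy` and is independent of the
subordinator, then `(y + S_q, q)` under `w(y) dy ⊗ Prob ⊗ dq` has the same law as `(x, E_x)` under
`dx ⊗ Prob` (`map_add_eq_map_inverseSubordinator`). Restricted to `q ≤ r`, both sides have the
Laplace transform `(1 - exp (-r φ(l))) / l`, where `φ` is the Laplace exponent: on the left because
the Laplace transform of `w` is `φ(l) / l`, on the right because
`P(S_r > x) ≤ P(E_x ≤ r) ≤ P(S_t > x)` for all `t > r`. Only the one-dimensional laws of `S` and the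
monotonicity of its paths enter, so `S` may be replaced by a version whose paths are all regular
(`exists_regular`).

*The weak equation.* Write `J d (t) = 𝔼 ∫_0^∞ P_r d(t - S_r) dr` for the potential of a source `d`
that vanishes off `(0, T₀]`. Convolving `⟨J d, φ⟩` with `w` and using the identity turns `P_r` into
`P_{E_x}`, and Dynkin's formula `𝔼 P_{E_x} φ = φ + 𝔼 ∫_0^∞ 1_{S_r < x} P_r 𝓛φ dr` together with
Fubini's theorem gives the weak equation (`potential_weak_equation`). The same argument treats
`𝔼 P_{E_t} g` (`stoppedMean_weak_equation`).

*Uniqueness.* The difference `d` of two weak solutions solves the homogeneous equation. Testing it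
at the time `T - S_r` with `P_r φ` and integrating over `Prob ⊗ dr` shows that the convolution of
`⟨J d, φ⟩` with `w` is the integral of `⟨J d, 𝓛φ⟩`. Comparison with the weak equation of `J d`
leaves `∫_0^T ⟨d, φ⟩ = 0` for all `T` (`integral_eq_zero_of_homogeneous`).

*Continuity.* The inverse subordinator is almost surely continuous at each level, as `S_r` has no
atoms, and `J d` is continuous because `t ↦ 𝔼 d(t - S_r)` is, the density of `S_r` being bounded
(`continuous_integral_sub`).

*Regularity.* For `g` in the domain, `‖𝓛 𝔼 P_{E_t} g‖ ≤ C_t ‖g‖`: pairing with `φ` and writing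
`P_{E_t} 𝓛g` as an integral of the derivative of the orbit, the bound `P(E_t < s) ≤ C_t s` supplies
the weight `s` in the square function estimate `∫ 4 s ‖𝓛 P_s g‖² ds ≤ ‖g‖²`
(`integral_mul_norm_sq_le`, `norm_stoppedMean_le_of_mem_graph`). By density `𝔼 P_{E_t} g` lies in the
domain for every `g`. The potential commutes with `𝓛` by self-adjointness, so `𝓛 J f = J (𝓛 f)`.
-/

/-! ### Symmetric contraction semigroups -/

namespace TimeFractional

section Semigroup

variable {H : Type*} [NormedAddCommGroup H] [InnerProductSpace ℝ H]
  {P : ℝ → H →L[ℝ] H} {A : H →ₗ.[ℝ] H}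

namespace IsContractionSemigroup

theorem norm_apply_le (hP : IsContractionSemigroup P) {t : ℝ} (ht : 0 ≤ t) (u : H) :
    ‖P t u‖ ≤ ‖u‖ := by
  simpa using (P t).le_of_opNorm_le (hP.contraction t ht) u

theorem zero_apply (hP : IsContractionSemigroup P) (u : H) : P 0 u = u := by simp [hP.zero]

theorem add_apply (hP : IsContractionSemigroup P) {s t : ℝ} (hs : 0 ≤ s) (ht : 0 ≤ t) (u : H) :
    P (s + t) u = P s (P t u) := by simp [hP.add s t hs ht]

/-- An orbit has no larger increment between two times than between `0` and their distance. -/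
theorem norm_sub_le (hP : IsContractionSemigroup P) {s t : ℝ} (hs : 0 ≤ s) (ht : 0 ≤ t) (u : H) :
    ‖P s u - P t u‖ ≤ ‖P |s - t| u - u‖ := by
  wlog h : t ≤ s generalizing s t
  · rw [norm_sub_rev, abs_sub_comm]; exact this ht hs (le_of_not_ge h)
  have h1 : P s u - P t u = P t (P |s - t| u - u) := by
    rw [map_sub, ← hP.add_apply ht (abs_nonneg _), abs_of_nonneg (sub_nonneg.2 h)]
    simp
  rw [h1]
  exact hP.norm_apply_le ht _

theorem tendsto_abs (hP : IsContractionSemigroup P) (u : H) :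
    Tendsto (fun t : ℝ => P |t| u) (𝓝 0) (𝓝 u) := by
  rw [Metric.tendsto_nhds]
  intro ε hε
  have h1 := (Metric.tendsto_nhds.1 (hP.strong_cont u) ε hε)
  rw [eventually_nhdsWithin_iff] at h1
  have h2 : Tendsto (fun t : ℝ => |t|) (𝓝 0) (𝓝 0) := by
    simpa using (continuous_abs (G := ℝ)).tendsto 0
  filter_upwards [h2.eventually h1] with t ht
  rcases eq_or_ne t 0 with rfl | h0
  · simpa [hP.zero_apply] using hε
  · exact ht (abs_pos.2 h0)

/-- Joint continuity in time and vector. Negative times are replaced by `0`. -/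
theorem continuous_uncurry (hP : IsContractionSemigroup P) :
    Continuous fun q : ℝ × H => P (max q.1 0) q.2 := by
  rw [continuous_iff_continuousAt]
  rintro ⟨s, u⟩
  rw [ContinuousAt, tendsto_iff_norm_sub_tendsto_zero]
  have h1 : Tendsto (fun q : ℝ × H => ‖q.2 - u‖ + ‖P |max q.1 0 - max s 0| u - u‖) (𝓝 (s, u))
      (𝓝 0) := by
    have h2 : Tendsto (fun q : ℝ × H => max q.1 0 - max s 0) (𝓝 (s, u)) (𝓝 0) := by
      have : Continuous fun q : ℝ × H => max q.1 0 - max s 0 := by fun_prop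
      simpa using this.tendsto (s, u)
    have h3 := ((hP.tendsto_abs u).comp h2)
    rw [tendsto_iff_norm_sub_tendsto_zero] at h3
    have h4 : Tendsto (fun q : ℝ × H => ‖q.2 - u‖) (𝓝 (s, u)) (𝓝 0) := by
      have : Continuous fun q : ℝ × H => ‖q.2 - u‖ := by fun_prop
      simpa using this.tendsto (s, u)
    simpa using h4.add h3
  refine squeeze_zero (fun _ => norm_nonneg _) (fun q => ?_) h1
  have h5 : P (max q.1 0) q.2 - P (max s 0) u
      = P (max q.1 0) (q.2 - u) + (P (max q.1 0) u - P (max s 0) u) := by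
    rw [map_sub]; abel
  rw [h5]
  refine (norm_add_le _ _).trans (add_le_add ?_ ?_)
  · exact hP.norm_apply_le (le_max_right _ _) _
  · exact hP.norm_sub_le (le_max_right _ _) (le_max_right _ _) u

theorem continuous_orbit (hP : IsContractionSemigroup P) (u : H) :
    Continuous fun t : ℝ => P (max t 0) u :=
  hP.continuous_uncurry.comp (Continuous.prodMk continuous_id continuous_const)

theorem continuousOn_orbit (hP : IsContractionSemigroup P) (u : H) :
    ContinuousOn (fun t : ℝ => P t u) (Ici 0) :=
  (hP.continuous_orbit u).continuousOn.congr fun t ht => by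
    simp [max_eq_left (mem_Ici.1 ht)]

theorem continuousAt_orbit (hP : IsContractionSemigroup P) (u : H) {t : ℝ} (ht : 0 < t) :
    ContinuousAt (fun t : ℝ => P t u) t :=
  (hP.continuousOn_orbit u).continuousAt (Ici_mem_nhds ht)

theorem intervalIntegrable_orbit (hP : IsContractionSemigroup P) (u : H) {a b : ℝ} (ha : 0 ≤ a)
    (hb : 0 ≤ b) : IntervalIntegrable (fun t => P t u) volume a b :=
  ((hP.continuousOn_orbit u).mono (by
    intro x hx
    rcases mem_uIcc.1 hx with h | h
    · exact ha.trans h.1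
    · exact hb.trans h.1)).intervalIntegrable

end IsContractionSemigroup

theorem apply_mem_graph (hP : IsContractionSemigroup P) (hA : IsInfinitesimalGenerator A P)
    {u h : H} (huh : (u, h) ∈ A.graph) {t : ℝ} (ht : 0 ≤ t) : (P t u, P t h) ∈ A.graph := by
  rw [hA] at huh ⊢
  refine (((P t).continuous.tendsto h).comp huh).congr' ?_
  filter_upwards [self_mem_nhdsWithin] with s hs
  have hs' : (0 : ℝ) ≤ s := le_of_lt hs
  simp only [Function.comp, map_smul, map_sub]
  rw [← hP.add_apply ht hs', ← hP.add_apply hs' ht, add_comm]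

theorem hasDerivWithinAt_orbit (hP : IsContractionSemigroup P)
    (hA : IsInfinitesimalGenerator A P) {u h : H} (huh : (u, h) ∈ A.graph) {t : ℝ} (ht : 0 ≤ t) :
    HasDerivWithinAt (fun s => P s u) (P t h) (Ioi t) t := by
  rw [hasDerivWithinAt_iff_tendsto_slope' (by simp)]
  have h1 := (hA _ _).1 (apply_mem_graph hP hA huh ht)
  have h2 : Tendsto (fun s => s - t) (𝓝[>] t) (𝓝[>] 0) := by
    refine tendsto_nhdsWithin_iff.2 ⟨?_, ?_⟩
    · have : Tendsto (fun s => s - t) (𝓝 t) (𝓝 (t - t)) :=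
        (continuous_id.sub continuous_const).tendsto t
      rw [sub_self] at this
      exact this.mono_left nhdsWithin_le_nhds
    · filter_upwards [self_mem_nhdsWithin] with s hs
      exact sub_pos.2 (mem_Ioi.1 hs)
  refine (h1.comp h2).congr' ?_
  filter_upwards [self_mem_nhdsWithin] with s hs
  have hs' : (0 : ℝ) ≤ s - t := sub_nonneg.2 (le_of_lt hs)
  simp only [Function.comp, slope, vsub_eq_sub]
  rw [← hP.add_apply hs' ht, sub_add_cancel]

/-- The generator of a contraction semigroup is dissipative. -/
theorem inner_nonpos_of_mem_graph (hP : IsContractionSemigroup P)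
    (hA : IsInfinitesimalGenerator A P) {u h : H} (huh : (u, h) ∈ A.graph) : inner ℝ h u ≤ 0 := by
  have h1 := ((hA _ _).1 huh).inner (tendsto_const_nhds (x := u)) (𝕜 := ℝ)
  refine le_of_tendsto h1 ?_
  filter_upwards [self_mem_nhdsWithin] with t ht
  have ht' : (0 : ℝ) < t := ht
  rw [real_inner_smul_left, inner_sub_left, real_inner_self_eq_norm_sq]
  have h2 : inner ℝ (P t u) u ≤ ‖u‖ ^ 2 := by
    refine (real_inner_le_norm _ _).trans ?_
    rw [sq]
    exact mul_le_mul_of_nonneg_right (hP.norm_apply_le ht'.le u) (norm_nonneg _)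
  exact mul_nonpos_of_nonneg_of_nonpos (by positivity) (by linarith)

variable [CompleteSpace H]

/-- The time averages of an orbit converge to its starting point. -/
theorem IsContractionSemigroup.tendsto_average (hP : IsContractionSemigroup P) (u : H) :
    Tendsto (fun t : ℝ => t⁻¹ • ∫ s in (0 : ℝ)..t, P s u) (𝓝[>] 0) (𝓝 u) := by
  have h1 : HasDerivAt (fun t : ℝ => ∫ s in (0 : ℝ)..t, P (max s 0) u) (P (max 0 0) u) 0 :=
    intervalIntegral.integral_hasDerivAt_right (by simp)
      ((hP.continuous_orbit u).stronglyMeasurableAtFilter _ _)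
      (hP.continuous_orbit u).continuousAt
  have h2 := h1.tendsto_slope_zero_right
  simp only [max_self, hP.zero_apply, zero_add, intervalIntegral.integral_same, sub_zero] at h2
  refine h2.congr' ?_
  filter_upwards [self_mem_nhdsWithin] with t ht
  congr 1
  refine intervalIntegral.integral_congr fun s hs => ?_
  rw [uIcc_of_le (le_of_lt ht)] at hs
  simp [max_eq_left hs.1]

/-- A vector whose orbit is an integrated orbit of `h` lies in the graph of the generator. -/
theorem mem_graph_of_forall_integral (hP : IsContractionSemigroup P)
    (hA : IsInfinitesimalGenerator A P) {u h : H}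
    (huh : ∀ t, 0 < t → P t u - u = ∫ s in (0 : ℝ)..t, P s h) : (u, h) ∈ A.graph := by
  rw [hA]
  refine (hP.tendsto_average h).congr' ?_
  filter_upwards [self_mem_nhdsWithin] with t ht
  rw [huh t ht]

theorem integral_mem_graph (hP : IsContractionSemigroup P) (hA : IsInfinitesimalGenerator A P)
    (u : H) {t : ℝ} (ht : 0 ≤ t) :
    (∫ s in (0 : ℝ)..t, P s u, P t u - u) ∈ A.graph := by
  refine mem_graph_of_forall_integral hP hA fun r hr => ?_
  have e1 : P r (∫ s in (0 : ℝ)..t, P s u) = ∫ s in r..(t + r), P s u := by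
    rw [← ContinuousLinearMap.intervalIntegral_comp_comm _
      (hP.intervalIntegrable_orbit u le_rfl ht)]
    have : ∫ s in (0 : ℝ)..t, P r (P s u) = ∫ s in (0 : ℝ)..t, P (s + r) u := by
      refine intervalIntegral.integral_congr fun s hs => ?_
      rw [uIcc_of_le ht] at hs
      rw [add_comm, hP.add_apply hr.le hs.1]
    rw [this, intervalIntegral.integral_comp_add_right (fun s => P s u)]
    simp
  have e2 : ∫ s in (0 : ℝ)..r, P s (P t u - u)
      = (∫ s in t..(t + r), P s u) - ∫ s in (0 : ℝ)..r, P s u := by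
    simp only [map_sub]
    rw [intervalIntegral.integral_sub (hP.intervalIntegrable_orbit _ le_rfl hr.le)
      (hP.intervalIntegrable_orbit _ le_rfl hr.le)]
    congr 1
    have : ∫ s in (0 : ℝ)..r, P s (P t u) = ∫ s in (0 : ℝ)..r, P (s + t) u := by
      refine intervalIntegral.integral_congr fun s hs => ?_
      rw [uIcc_of_le hr.le] at hs
      rw [hP.add_apply hs.1 ht]
    rw [this, intervalIntegral.integral_comp_add_right (fun s => P s u), zero_add, add_comm]
  rw [e1, e2]
  have h0 := hP.intervalIntegrable_orbit u (le_refl (0:ℝ)) hr.le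
  have h1 := hP.intervalIntegrable_orbit u hr.le (add_nonneg ht hr.le)
  have h2 := hP.intervalIntegrable_orbit u (le_refl (0:ℝ)) ht
  have h3 := hP.intervalIntegrable_orbit u ht (add_nonneg ht hr.le)
  have h4 := intervalIntegral.integral_add_adjacent_intervals h0 h1
  have h5 := intervalIntegral.integral_add_adjacent_intervals h2 h3
  rw [sub_eq_sub_iff_add_eq_add, add_comm, h4, ← h5, add_comm]

theorem dense_domain (hP : IsContractionSemigroup P) (hA : IsInfinitesimalGenerator A P) :
    Dense (A.domain : Set H) := by
  intro u
  refine mem_closure_of_tendsto (hP.tendsto_average u) ?_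
  filter_upwards [self_mem_nhdsWithin] with t ht
  exact A.domain.smul_mem _
    (LinearPMap.mem_domain_of_mem_graph (integral_mem_graph hP hA u (le_of_lt ht)))

theorem apply_sub_eq_integral (hP : IsContractionSemigroup P)
    (hA : IsInfinitesimalGenerator A P) {u h : H} (huh : (u, h) ∈ A.graph) {a b : ℝ} (ha : 0 ≤ a)
    (hb : 0 ≤ b) : ∫ s in a..b, P s h = P b u - P a u := by
  have hsub : ∀ x ∈ uIcc a b, 0 ≤ x := by
    intro x hx
    rcases mem_uIcc.1 hx with h | h
    · exact ha.trans h.1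
    · exact hb.trans h.1
  refine intervalIntegral.integral_eq_sub_of_hasDeriv_right
    ((hP.continuousOn_orbit u).mono hsub) (fun x hx => ?_) (hP.intervalIntegrable_orbit h ha hb)
  exact hasDerivWithinAt_orbit hP hA huh (hsub x ⟨hx.1.le, hx.2.le⟩)

theorem hasDerivAt_orbit (hP : IsContractionSemigroup P)
    (hA : IsInfinitesimalGenerator A P) {u h : H} (huh : (u, h) ∈ A.graph) {t : ℝ} (ht : 0 < t) :
    HasDerivAt (fun s => P s u) (P t h) t := by
  have h1 : HasDerivAt (fun b => ∫ s in (0:ℝ)..b, P s h) (P t h) t :=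
    intervalIntegral.integral_hasDerivAt_right (hP.intervalIntegrable_orbit h le_rfl ht.le)
      (ContinuousOn.stronglyMeasurableAtFilter isOpen_Ioi
        ((hP.continuousOn_orbit h).mono Ioi_subset_Ici_self) t ht)
      (hP.continuousAt_orbit h ht)
  refine (h1.add_const u).congr_of_eventuallyEq ?_
  filter_upwards [Ioi_mem_nhds ht] with b hb
  rw [apply_sub_eq_integral hP hA huh le_rfl (le_of_lt hb), hP.zero_apply, sub_add_cancel]

/-- The generator is symmetric, in terms of its graph. -/
def IsSymmetricGenerator (A : H →ₗ.[ℝ] H) : Prop :=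
  ∀ ⦃u h v k : H⦄, (u, h) ∈ A.graph → (v, k) ∈ A.graph → inner ℝ h v = inner ℝ u k

/-- A contraction semigroup with a symmetric generator consists of symmetric operators, because
`s ↦ ⟨P_s u, P_{t-s} v⟩` is constant on `[0, t]` for `u, v` in the domain of the generator. -/
theorem inner_apply_comm (hP : IsContractionSemigroup P) (hA : IsInfinitesimalGenerator A P)
    (hs : IsSymmetricGenerator A) {t : ℝ} (ht : 0 ≤ t) (u v : H) :
    inner ℝ (P t u) v = inner ℝ u (P t v) := by
  have key : ∀ u ∈ A.domain, ∀ v ∈ A.domain, inner ℝ (P t u) v = inner ℝ u (P t v) := by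
    intro u hu v hv
    obtain ⟨h, huh⟩ := LinearPMap.mem_domain_iff.1 hu
    obtain ⟨k, hvk⟩ := LinearPMap.mem_domain_iff.1 hv
    have hc : ContinuousOn (fun s => inner ℝ (P s u) (P (t - s) v)) (Icc 0 t) := by
      refine ContinuousOn.inner ?_ ?_
      · exact (hP.continuousOn_orbit u).mono fun x hx => hx.1
      · refine (hP.continuousOn_orbit v).comp (by fun_prop) fun x hx => ?_
        exact sub_nonneg.2 hx.2
    have hd : ∀ s ∈ Ioo (0:ℝ) t,
        HasDerivAt (fun s => inner ℝ (P s u) (P (t - s) v)) 0 s := by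
      intro s hs'
      have h1 := hasDerivAt_orbit hP hA huh hs'.1
      have h2 := (hasDerivAt_orbit hP hA hvk (sub_pos.2 hs'.2)).scomp s
        ((hasDerivAt_id s).const_sub t)
      have h3 := h1.inner ℝ h2
      have h4 := hs (apply_mem_graph hP hA huh hs'.1.le)
        (apply_mem_graph hP hA hvk (sub_nonneg.2 hs'.2.le))
      refine h3.congr_deriv ?_
      simp [h4]
    have := intervalIntegral.integral_eq_sub_of_hasDerivAt_of_le ht hc hd (by simp)
    simp only [intervalIntegral.integral_zero, sub_self, sub_zero, hP.zero_apply] at this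
    linarith
  have hd := dense_domain hP hA
  have step : ∀ u ∈ A.domain, ∀ v, inner ℝ (P t u) v = inner ℝ u (P t v) := by
    intro u hu v
    have hcl : IsClosed {v | inner ℝ (P t u) v = inner ℝ u (P t v)} :=
      isClosed_eq (by fun_prop) (by fun_prop)
    exact (hcl.closure_subset_iff.2 fun v hv => key u hu v hv) (hd v)
  have hcl : IsClosed {u | inner ℝ (P t u) v = inner ℝ u (P t v)} :=
    isClosed_eq (by fun_prop) (by fun_prop)
  exact (hcl.closure_subset_iff.2 fun u hu => step u hu v) (hd u)

/-- The generator is self-adjoint: its adjoint is contained in it. -/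
theorem mem_graph_of_forall_inner (hP : IsContractionSemigroup P)
    (hA : IsInfinitesimalGenerator A P) (hs : IsSymmetricGenerator A) {y h : H}
    (hyh : ∀ φ ψ, (φ, ψ) ∈ A.graph → inner ℝ y ψ = inner ℝ h φ) : (y, h) ∈ A.graph := by
  refine mem_graph_of_forall_integral hP hA fun t ht => ?_
  refine (dense_domain hP hA).eq_of_inner_left ℝ fun φ hφ => ?_
  obtain ⟨ψ, hφψ⟩ := LinearPMap.mem_domain_iff.1 hφ
  have h1 := integral_mem_graph hP hA φ ht.le
  have h2 := hyh _ _ h1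
  rw [inner_sub_left, inner_apply_comm hP hA hs ht.le, ← inner_sub_right, h2]
  have h3 : inner ℝ h (∫ s in (0:ℝ)..t, P s φ) = ∫ s in (0:ℝ)..t, inner ℝ h (P s φ) :=
    ((innerSL ℝ h).intervalIntegral_comp_comm (hP.intervalIntegrable_orbit φ le_rfl ht.le)).symm
  have h4 : inner ℝ (∫ s in (0:ℝ)..t, P s h) φ = ∫ s in (0:ℝ)..t, inner ℝ (P s h) φ := by
    rw [real_inner_comm]
    have := (innerSL ℝ φ).intervalIntegral_comp_comm (hP.intervalIntegrable_orbit h le_rfl ht.le)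
    rw [← innerSL_apply_apply ℝ, ← this]
    exact intervalIntegral.integral_congr fun s _ => real_inner_comm _ _
  rw [h3, h4]
  refine intervalIntegral.integral_congr fun s hs' => ?_
  rw [uIcc_of_le ht.le] at hs'
  exact (inner_apply_comm hP hA hs hs'.1 _ _).symm

/-- The square function estimate of a symmetric contraction semigroup. The integrand is the
derivative of `s ↦ 2 s ⟨P_s A u, P_s u⟩ - ‖P_s u‖²`, whose first summand is nonpositive. -/
theorem integral_mul_norm_sq_le (hP : IsContractionSemigroup P)
    (hA : IsInfinitesimalGenerator A P) (hs : IsSymmetricGenerator A) {u h : H}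
    (huh : (u, h) ∈ A.graph) {r : ℝ} (hr : 0 ≤ r) :
    ∫ s in (0 : ℝ)..r, 4 * s * ‖P s h‖ ^ 2 ≤ ‖u‖ ^ 2 := by
  set Ψ : ℝ → ℝ := fun s => 2 * s * inner ℝ (P (2 * s) u) h - ‖P s u‖ ^ 2 with hΨ
  have hsym : ∀ v w, ∀ s, 0 ≤ s → inner ℝ (P (2 * s) v) w = inner ℝ (P s v) (P s w) := by
    intro v w s hs0
    rw [two_mul, hP.add_apply hs0 hs0, inner_apply_comm hP hA hs hs0]
  have hc : ContinuousOn Ψ (Icc 0 r) := by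
    have h1 : ContinuousOn (fun s : ℝ => P s u) (Icc 0 r) :=
      (hP.continuousOn_orbit u).mono fun x hx => hx.1
    have h2 : ContinuousOn (fun s : ℝ => P (2 * s) u) (Icc 0 r) :=
      (hP.continuousOn_orbit u).comp (by fun_prop) fun x hx => by
        have := hx.1
        simp only [mem_Ici]; linarith
    exact ((continuousOn_const.mul continuousOn_id).mul (h2.inner continuousOn_const)).sub
      (h1.norm.pow 2)
  have hd : ∀ s ∈ Ioo (0:ℝ) r, HasDerivAt Ψ (4 * s * ‖P s h‖ ^ 2) s := by
    intro s hs'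
    have h1 := hasDerivAt_orbit hP hA huh hs'.1
    have h2 := (hasDerivAt_orbit hP hA huh (show 0 < 2 * s by linarith [hs'.1])).scomp s
      ((hasDerivAt_id s).const_mul 2)
    have h3 := (((hasDerivAt_id s).const_mul 2).mul
      (h2.inner ℝ (hasDerivAt_const s h))).sub h1.norm_sq
    refine h3.congr_deriv ?_
    simp only [id, Function.comp, mul_one, inner_zero_right, zero_add, real_inner_smul_left]
    rw [hsym _ _ _ hs'.1.le, hsym _ _ _ hs'.1.le, real_inner_self_eq_norm_sq]
    ring
  have hi : IntervalIntegrable (fun s => 4 * s * ‖P s h‖ ^ 2) volume 0 r := by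
    refine ContinuousOn.intervalIntegrable ?_
    have h1 : ContinuousOn (fun s : ℝ => P s h) (uIcc 0 r) :=
      (hP.continuousOn_orbit h).mono fun x hx => by
        rw [uIcc_of_le hr] at hx; exact hx.1
    fun_prop
  rw [intervalIntegral.integral_eq_sub_of_hasDerivAt_of_le hr hc hd hi]
  have h4 : inner ℝ (P (2 * r) u) h ≤ 0 := by
    rw [hsym _ _ _ hr, real_inner_comm]
    exact inner_nonpos_of_mem_graph hP hA (apply_mem_graph hP hA huh hr)
  have h5 : 2 * r * inner ℝ (P (2 * r) u) h ≤ 0 :=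
    mul_nonpos_of_nonneg_of_nonpos (by linarith) h4
  simp only [hΨ, hP.zero_apply, mul_zero, zero_mul]
  nlinarith [sq_nonneg ‖P r u‖]

/-- The regularizing estimate `r ‖A P_r u‖ ≤ ‖u‖`. -/
theorem mul_norm_apply_le (hP : IsContractionSemigroup P)
    (hA : IsInfinitesimalGenerator A P) (hs : IsSymmetricGenerator A) {u h : H}
    (huh : (u, h) ∈ A.graph) {r : ℝ} (hr : 0 ≤ r) : r * ‖P r h‖ ≤ ‖u‖ := by
  have h1 := integral_mul_norm_sq_le hP hA hs huh hr
  have h2 : ∫ s in (0 : ℝ)..r, 4 * s * ‖P r h‖ ^ 2 ≤ ∫ s in (0 : ℝ)..r, 4 * s * ‖P s h‖ ^ 2 := by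
    refine intervalIntegral.integral_mono_on hr
      (Continuous.intervalIntegrable (by fun_prop) _ _) ?_ fun s hs' => ?_
    · refine ContinuousOn.intervalIntegrable ?_
      have h1 : ContinuousOn (fun s : ℝ => P s h) (uIcc 0 r) :=
        (hP.continuousOn_orbit h).mono fun x hx => by
          rw [uIcc_of_le hr] at hx; exact hx.1
      fun_prop
    · have h3 : ‖P r h‖ ≤ ‖P s h‖ := by
        have : P r h = P (r - s) (P s h) := by
          rw [← hP.add_apply (sub_nonneg.2 hs'.2) hs'.1, sub_add_cancel]
        rw [this]
        exact hP.norm_apply_le (sub_nonneg.2 hs'.2) _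
      have := hs'.1
      gcongr
  have h3 : ∫ s in (0 : ℝ)..r, 4 * s * ‖P r h‖ ^ 2 = 2 * (r * ‖P r h‖) ^ 2 := by
    have : (fun s : ℝ => 4 * s * ‖P r h‖ ^ 2) = fun s => (4 * ‖P r h‖ ^ 2) * s := by
      ext s; ring
    rw [this, intervalIntegral.integral_const_mul, integral_id]
    ring
  refine le_of_sq_le_sq ?_ (norm_nonneg u)
  nlinarith [sq_nonneg (r * ‖P r h‖)]

end Semigroup

end TimeFractional

/-! ### The Laplace exponent and the tail of the Lévy measure -/

namespace TimeFractional

section LaplaceExponent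

variable {Ω : Type*} [MeasurableSpace Ω] {Prob : Measure Ω} {S : ℝ → Ω → ℝ} {ν : Measure ℝ}

/-- The Laplace exponent `φ(l) = ∫ (1 - exp (-l x)) ν(dx)`. -/
noncomputable def laplaceExponent (ν : Measure ℝ) (l : ℝ) : ℝ :=
  ∫ x, (1 - Real.exp (-(l * x))) ∂ν

namespace IsDriftlessLevyMeasure

theorem ae_pos (hν : IsDriftlessLevyMeasure S Prob ν) : ∀ᵐ x ∂ν, 0 < x := by
  rw [ae_iff]
  simpa [Iic, not_lt] using hν.carried

theorem integrable_one_sub_exp (hν : IsDriftlessLevyMeasure S Prob ν) {l : ℝ} (hl : 0 < l) :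
    Integrable (fun x => 1 - Real.exp (-(l * x))) ν := by
  have h1 : Integrable (fun x : ℝ => min 1 x) ν := by
    refine ⟨by fun_prop, ?_⟩
    rw [hasFiniteIntegral_iff_ofReal]
    · exact hν.integrable_min
    · filter_upwards [hν.ae_pos] with x hx
      exact le_min zero_le_one hx.le
  refine (h1.const_mul (max 1 l)).mono' (by fun_prop) ?_
  filter_upwards [hν.ae_pos] with x hx
  have h2 : Real.exp (-(l * x)) ≤ 1 := Real.exp_le_one_iff.2 (by nlinarith)
  have h3 := Real.add_one_le_exp (-(l * x))
  have h4 := Real.exp_pos (-(l * x))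
  rw [Real.norm_of_nonneg (by linarith)]
  rcases le_total 1 x with h | h
  · rw [min_eq_left h]
    linarith [le_max_left 1 l]
  · rw [min_eq_right h]
    nlinarith [le_max_right 1 l]

theorem laplaceExponent_pos (hν : IsDriftlessLevyMeasure S Prob ν) (hν_inf : ν (Ioi 0) = ∞)
    {l : ℝ} (hl : 0 < l) : 0 < laplaceExponent ν l := by
  have hpos : ∀ᵐ x ∂ν, 0 < 1 - Real.exp (-(l * x)) := by
    filter_upwards [hν.ae_pos] with x hx
    have : Real.exp (-(l * x)) < 1 := Real.exp_lt_one_iff.2 (by nlinarith)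
    linarith
  rw [laplaceExponent, integral_pos_iff_support_of_nonneg_ae (hpos.mono fun x hx => hx.le)
    (hν.integrable_one_sub_exp hl)]
  have h1 : Ioi (0:ℝ) ⊆ Function.support fun x => 1 - Real.exp (-(l * x)) := by
    intro x hx
    have : Real.exp (-(l * x)) < 1 := Real.exp_lt_one_iff.2 (by have := mem_Ioi.1 hx; nlinarith)
    simp only [Function.mem_support]
    linarith
  exact lt_of_lt_of_le (by simp [hν_inf]) (measure_mono h1)

end IsDriftlessLevyMeasure

/-- The Laplace transform of a tail. -/
theorem lintegral_tail_mul_exp {α : Type*} [MeasurableSpace α] (μ : Measure α) {X : α → ℝ}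
    (hX : AEMeasurable X μ) (hX0 : 0 ≤ᵐ[μ] X) {l : ℝ} (hl : 0 < l) :
    ∫⁻ x in Ioi (0 : ℝ), μ {a | x < X a} * ENNReal.ofReal (Real.exp (-(l * x)))
      = ∫⁻ a, ENNReal.ofReal ((1 - Real.exp (-(l * X a))) / l) ∂μ := by
  have hc : Continuous fun x : ℝ => Real.exp (-(l * x)) := by fun_prop
  rw [← lintegral_comp_eq_lintegral_meas_lt_mul μ hX0 hX
    (fun t _ => hc.intervalIntegrable _ _) (ae_of_all _ fun t => (Real.exp_pos _).le)]
  refine lintegral_congr fun a => ?_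
  congr 1
  have hd : ∀ x : ℝ, HasDerivAt (fun x => -Real.exp (-(l * x)) / l) (Real.exp (-(l * x))) x := by
    intro x
    have h1 : HasDerivAt (fun x : ℝ => -(l * x)) (-l) x :=
      ((hasDerivAt_id x).const_mul l).neg.congr_deriv (by simp)
    refine ((h1.exp.neg).div_const l).congr_deriv ?_
    field_simp
  rw [intervalIntegral.integral_eq_sub_of_hasDerivAt (fun x _ => hd x)
    (hc.intervalIntegrable _ _)]
  simp only [mul_zero, neg_zero, Real.exp_zero]
  ring

theorem measurable_tail (μ : Measure ℝ) : Measurable fun x => μ (Ioi x) :=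
  (Antitone.measurable fun _ _ h => measure_mono (Ioi_subset_Ioi h))

namespace IsDriftlessLevyMeasure

/-- The Laplace transform of the tail of the Lévy measure is `φ(l) / l`. -/
theorem lintegral_tail (hν : IsDriftlessLevyMeasure S Prob ν) {l : ℝ} (hl : 0 < l) :
    ∫⁻ x in Ioi (0 : ℝ), ν (Ioi x) * ENNReal.ofReal (Real.exp (-(l * x)))
      = ENNReal.ofReal (laplaceExponent ν l / l) := by
  have h0 : 0 ≤ᵐ[ν] fun x => x := hν.ae_pos.mono fun x hx => hx.le
  have h := lintegral_tail_mul_exp ν (X := fun x => x) (by fun_prop) h0 hl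
  refine h.trans ?_
  rw [← ofReal_integral_eq_lintegral_ofReal, integral_div, laplaceExponent]
  · exact (hν.integrable_one_sub_exp hl).div_const l
  · filter_upwards [h0] with x hx
    have hx' : 0 ≤ x := hx
    have : Real.exp (-(l * x)) ≤ 1 := Real.exp_le_one_iff.2 (by nlinarith)
    exact div_nonneg (by linarith) hl.le

theorem tail_lt_top (hν : IsDriftlessLevyMeasure S Prob ν) {x : ℝ} (hx : 0 < x) :
    ν (Ioi x) < ∞ := by
  have h1 : ENNReal.ofReal (min 1 x) * ν (Ioi x) ≤ ∫⁻ y, ENNReal.ofReal (min 1 y) ∂ν := by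
    rw [← setLIntegral_const]
    refine (setLIntegral_mono (by fun_prop) fun y hy => ?_).trans (setLIntegral_le_lintegral _ _)
    exact ENNReal.ofReal_le_ofReal (min_le_min_left _ (le_of_lt hy))
  have h2 : ENNReal.ofReal (min 1 x) ≠ 0 := by
    simp only [ne_eq, ENNReal.ofReal_eq_zero, not_le]
    exact lt_min one_pos hx
  by_contra h3
  rw [not_lt, top_le_iff] at h3
  rw [h3, ENNReal.mul_top h2] at h1
  exact absurd hν.integrable_min (not_lt.2 h1)

theorem ofReal_weight (hν : IsDriftlessLevyMeasure S Prob ν) {x : ℝ} (hx : 0 < x) :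
    ENNReal.ofReal (weight ν x) = ν (Ioi x) :=
  ENNReal.ofReal_toReal (hν.tail_lt_top hx).ne

end IsDriftlessLevyMeasure

theorem weight_nonneg (ν : Measure ℝ) (x : ℝ) : 0 ≤ weight ν x := ENNReal.toReal_nonneg

theorem measurable_weight (ν : Measure ℝ) : Measurable (weight ν) :=
  (measurable_tail ν).ennreal_toReal

theorem IsDriftlessLevyMeasure.integrableOn_weight (hν : IsDriftlessLevyMeasure S Prob ν) (T : ℝ) :
    IntegrableOn (weight ν) (Ioo 0 T) := by
  refine ⟨(measurable_weight ν).aestronglyMeasurable, ?_⟩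
  rw [hasFiniteIntegral_iff_ofReal (ae_of_all _ fun x => weight_nonneg ν x)]
  have h1 := hν.lintegral_tail one_pos
  have h2 : ENNReal.ofReal (Real.exp (-T)) * ∫⁻ x in Ioo 0 T, ENNReal.ofReal (weight ν x)
      ≤ ∫⁻ x in Ioi (0 : ℝ), ν (Ioi x) * ENNReal.ofReal (Real.exp (-(1 * x))) := by
    rw [← lintegral_const_mul _ (measurable_weight ν).ennreal_ofReal]
    refine (setLIntegral_mono' measurableSet_Ioo fun x hx => ?_).trans
      (lintegral_mono_set Ioo_subset_Ioi_self)
    rw [hν.ofReal_weight hx.1, mul_comm]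
    gcongr
    linarith [hx.2]
  rw [h1] at h2
  by_contra h3
  rw [not_lt, top_le_iff] at h3
  rw [h3, ENNReal.mul_top (by simp [Real.exp_pos]), top_le_iff] at h2
  exact ENNReal.ofReal_ne_top h2

end LaplaceExponent

/-! ### Subordinators with regular paths and their inverses -/

section Regular

theorem inverseSubordinator_nonneg {Ω : Type*} (S : ℝ → Ω → ℝ) (t : ℝ) (ω : Ω) :
    0 ≤ inverseSubordinator S t ω :=
  Real.sInf_nonneg fun _ hs => hs.1.le

theorem inverseSubordinator_le {Ω : Type*} {S : ℝ → Ω → ℝ} {r t : ℝ} {ω : Ω} (hr : 0 < r)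
    (h : t < S r ω) :
    inverseSubordinator S t ω ≤ r :=
  csInf_le ⟨0, fun _ hs => hs.1.le⟩ ⟨hr, h⟩

theorem le_of_lt_inverseSubordinator {Ω : Type*} {S : ℝ → Ω → ℝ} {r t : ℝ} {ω : Ω} (hr : 0 < r)
    (h : r < inverseSubordinator S t ω) : S r ω ≤ t :=
  not_lt.1 fun h' => absurd (inverseSubordinator_le hr h') (not_le.2 h)

variable {Ω : Type*} [MeasurableSpace Ω]

/-- The properties of a subordinator that the argument uses, with those of the paths holding on all
of `Ω`: the paths are nondecreasing, nonnegative and unbounded, the process is jointly measurable,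
and the law of `S_t`, `t > 0`, has a bounded density. -/
structure IsRegularSubordinator (S : ℝ → Ω → ℝ) (Prob : Measure Ω) : Prop where
  measurable : Measurable fun q : ℝ × Ω => S q.1 q.2
  monotone : ∀ ω, Monotone fun t => S t ω
  nonneg : ∀ t ω, 0 ≤ S t ω
  unbounded : ∀ ω x, ∃ t, 0 < t ∧ x < S t ω
  map_le : ∀ t, 0 < t → ∃ C : ℝ≥0, Prob.map (S t) ≤ C • (volume : Measure ℝ)

variable {Prob : Measure Ω} {S : ℝ → Ω → ℝ} {ν : Measure ℝ}

namespace IsRegularSubordinator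

theorem measurable_apply (hS : IsRegularSubordinator S Prob) (t : ℝ) : Measurable (S t) :=
  hS.measurable.comp (measurable_const.prodMk measurable_id)

theorem exists_of_inverseSubordinator_lt (hS : IsRegularSubordinator S Prob) {r t : ℝ} {ω : Ω}
    (h : inverseSubordinator S t ω < r) : ∃ s, 0 < s ∧ s < r ∧ t < S s ω := by
  obtain ⟨s, hs, hsr⟩ := exists_lt_of_csInf_lt (hS.unbounded ω t) h
  exact ⟨s, hs.1, hsr, hs.2⟩

theorem lt_of_inverseSubordinator_lt (hS : IsRegularSubordinator S Prob) {r t : ℝ} {ω : Ω}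
    (h : inverseSubordinator S t ω < r) : t < S r ω := by
  obtain ⟨s, -, hsr, hts⟩ := hS.exists_of_inverseSubordinator_lt h
  exact hts.trans_le (hS.monotone ω hsr.le)

theorem measurable_inverseSubordinator (hS : IsRegularSubordinator S Prob) :
    Measurable fun q : ℝ × Ω => inverseSubordinator S q.1 q.2 := by
  refine measurable_of_Iio fun r => ?_
  have h : (fun q : ℝ × Ω => inverseSubordinator S q.1 q.2) ⁻¹' Iio r
      = ⋃ s : ℚ, ⋃ _ : (0 : ℝ) < s ∧ (s : ℝ) < r, {q : ℝ × Ω | q.1 < S s q.2} := by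
    ext q
    simp only [mem_preimage, mem_Iio, mem_iUnion, mem_ofPred_eq, exists_prop]
    constructor
    · intro hq
      obtain ⟨s, hs0, hsr, hs⟩ := hS.exists_of_inverseSubordinator_lt hq
      obtain ⟨s', h1, h2⟩ := exists_rat_btwn hsr
      exact ⟨s', ⟨hs0.trans h1, h2⟩, hs.trans_le (hS.monotone _ h1.le)⟩
    · rintro ⟨s, ⟨h0, h1⟩, h2⟩
      exact (inverseSubordinator_le h0 h2).trans_lt h1
  rw [h]
  refine MeasurableSet.iUnion fun s => MeasurableSet.iUnion fun _ => ?_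
  exact measurableSet_lt measurable_fst ((hS.measurable_apply s).comp measurable_snd)

theorem measurable_inverseSubordinator_apply (hS : IsRegularSubordinator S Prob) (t : ℝ) :
    Measurable (inverseSubordinator S t) :=
  hS.measurable_inverseSubordinator.comp (measurable_const.prodMk measurable_id)

theorem map_absolutelyContinuous (hS : IsRegularSubordinator S Prob) {t : ℝ} (ht : 0 < t) :
    Prob.map (S t) ≪ volume := by
  obtain ⟨C, hC⟩ := hS.map_le t ht
  refine Measure.AbsolutelyContinuous.trans (Measure.absolutelyContinuous_of_le hC) ?_
  exact Measure.smul_absolutelyContinuous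

theorem ae_ne (hS : IsRegularSubordinator S Prob) {t : ℝ} (ht : 0 < t) (x : ℝ) :
    ∀ᵐ ω ∂Prob, S t ω ≠ x := by
  have h1 : ∀ᵐ y ∂(volume : Measure ℝ), y ≠ x := by
    rw [ae_iff]; simp
  exact ae_of_ae_map (hS.measurable_apply t).aemeasurable
    ((hS.map_absolutelyContinuous ht).ae_le h1)

/-- Almost surely, the inverse subordinator is continuous at a given level, since no `S_r` with
rational `r` takes that value. -/
theorem ae_continuousAt_inverseSubordinator (hS : IsRegularSubordinator S Prob) (t : ℝ) :
    ∀ᵐ ω ∂Prob, ContinuousAt (fun s => inverseSubordinator S s ω) t := by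
  have h1 : ∀ᵐ ω ∂Prob, ∀ r : ℚ, (0 : ℝ) < r → S r ω ≠ t := by
    rw [ae_all_iff]
    intro r
    by_cases hr : (0 : ℝ) < r
    · filter_upwards [hS.ae_ne hr t] with ω hω _ using hω
    · exact ae_of_all _ fun ω h => absurd h hr
  filter_upwards [h1] with ω hω
  rw [ContinuousAt, tendsto_order]
  constructor
  · intro a ha
    rcases lt_or_ge a 0 with h0 | h0
    · exact Eventually.of_forall fun s => h0.trans_le (inverseSubordinator_nonneg S s ω)
    · obtain ⟨r, h2, h3⟩ := exists_rat_btwn ha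
      have hr : (0 : ℝ) < r := h0.trans_lt h2
      have h4 : S r ω < t := lt_of_le_of_ne (le_of_lt_inverseSubordinator hr h3) (hω r hr)
      filter_upwards [Ioi_mem_nhds h4] with s hs
      refine h2.trans_le (not_lt.1 fun h5 => ?_)
      exact absurd (hS.lt_of_inverseSubordinator_lt h5) (not_lt.2 (le_of_lt hs))
  · intro a ha
    obtain ⟨s, hs0, hsa, hts⟩ := hS.exists_of_inverseSubordinator_lt ha
    filter_upwards [Iio_mem_nhds hts] with s' hs'
    exact (inverseSubordinator_le hs0 hs').trans_lt hsa

theorem ae_inverseSubordinator_zero (hS : IsRegularSubordinator S Prob) :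
    ∀ᵐ ω ∂Prob, inverseSubordinator S 0 ω = 0 := by
  have h1 : ∀ᵐ ω ∂Prob, ∀ n : ℕ, S (1 / ((n : ℝ) + 1)) ω ≠ 0 := by
    rw [ae_all_iff]
    exact fun n => hS.ae_ne Nat.one_div_pos_of_nat 0
  filter_upwards [h1] with ω hω
  refine le_antisymm ?_ (inverseSubordinator_nonneg S 0 ω)
  refine ge_of_tendsto' tendsto_one_div_add_atTop_nhds_zero_nat fun n => ?_
  exact inverseSubordinator_le Nat.one_div_pos_of_nat
    (lt_of_le_of_ne (hS.nonneg _ _) (hω n).symm)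

section Laplace

variable [IsProbabilityMeasure Prob]

theorem lintegral_exp (hS : IsRegularSubordinator S Prob)
    (hν : IsDriftlessLevyMeasure S Prob ν) {l : ℝ} (hl : 0 < l) {t : ℝ} (ht : 0 ≤ t) :
    ∫⁻ ω, ENNReal.ofReal (Real.exp (-(l * S t ω))) ∂Prob
      = ENNReal.ofReal (Real.exp (-(t * laplaceExponent ν l))) := by
  rw [laplaceExponent, ← hν.laplace l t hl ht, ofReal_integral_eq_lintegral_ofReal]
  · refine Integrable.of_bound (C := 1) ?_ (ae_of_all _ fun ω => ?_)
    · exact (Real.measurable_exp.comp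
        ((hS.measurable_apply t).const_mul l).neg).aestronglyMeasurable
    · rw [Real.norm_of_nonneg (Real.exp_pos _).le]
      exact Real.exp_le_one_iff.2 (by have := hS.nonneg t ω; nlinarith)
  · exact ae_of_all _ fun ω => (Real.exp_pos _).le

theorem lintegral_one_sub_exp (hS : IsRegularSubordinator S Prob)
    (hν : IsDriftlessLevyMeasure S Prob ν) {l : ℝ} (hl : 0 < l) {t : ℝ} (ht : 0 ≤ t) :
    ∫⁻ ω, ENNReal.ofReal ((1 - Real.exp (-(l * S t ω))) / l) ∂Prob
      = ENNReal.ofReal ((1 - Real.exp (-(t * laplaceExponent ν l))) / l) := by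
  have hi : Integrable (fun ω => Real.exp (-(l * S t ω))) Prob := by
    refine Integrable.of_bound (C := 1) ?_ (ae_of_all _ fun ω => ?_)
    · exact (Real.measurable_exp.comp
        ((hS.measurable_apply t).const_mul l).neg).aestronglyMeasurable
    · rw [Real.norm_of_nonneg (Real.exp_pos _).le]
      exact Real.exp_le_one_iff.2 (by have := hS.nonneg t ω; nlinarith)
  rw [laplaceExponent, ← hν.laplace l t hl ht, ← ofReal_integral_eq_lintegral_ofReal,
    integral_div, integral_sub (integrable_const _) hi]
  · simp
  · exact ((integrable_const _).sub hi).div_const l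
  · refine ae_of_all _ fun ω => div_nonneg ?_ hl.le
    have : Real.exp (-(l * S t ω)) ≤ 1 :=
      Real.exp_le_one_iff.2 (by have := hS.nonneg t ω; nlinarith)
    linarith

/-- Exponential decay in `t` of the distribution function of `S_t`. -/
theorem measure_le_le (hS : IsRegularSubordinator S Prob)
    (hν : IsDriftlessLevyMeasure S Prob ν) {t : ℝ} (ht : 0 ≤ t) (x : ℝ) :
    Prob {ω | S t ω ≤ x} ≤ ENNReal.ofReal (Real.exp x) *
      ENNReal.ofReal (Real.exp (-(laplaceExponent ν 1 * t))) := by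
  have h1 := hS.lintegral_exp hν one_pos ht
  have h2 := mul_meas_ge_le_lintegral (μ := Prob)
    (f := fun ω => ENNReal.ofReal (Real.exp (-(1 * S t ω))))
    (((hS.measurable_apply t).const_mul 1).neg.exp.ennreal_ofReal)
    (ENNReal.ofReal (Real.exp (-x)))
  rw [h1] at h2
  have h3 : {ω | S t ω ≤ x} ⊆ {ω | ENNReal.ofReal (Real.exp (-x))
      ≤ ENNReal.ofReal (Real.exp (-(1 * S t ω)))} := by
    intro ω hω
    have : S t ω ≤ x := hω
    refine ENNReal.ofReal_le_ofReal (Real.exp_le_exp.2 ?_)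
    linarith
  have h4 : ENNReal.ofReal (Real.exp x) * ENNReal.ofReal (Real.exp (-x)) = 1 := by
    rw [← ENNReal.ofReal_mul (Real.exp_pos _).le, ← Real.exp_add]
    simp
  calc Prob {ω | S t ω ≤ x}
      ≤ Prob {ω | ENNReal.ofReal (Real.exp (-x)) ≤ ENNReal.ofReal (Real.exp (-(1 * S t ω)))} :=
        measure_mono h3
    _ = ENNReal.ofReal (Real.exp x) * (ENNReal.ofReal (Real.exp (-x)) * _) := by
        rw [← mul_assoc, h4, one_mul]
    _ ≤ _ := by
        rw [mul_comm (laplaceExponent ν 1)]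
        gcongr

/-- `P(S_t > x) ≤ C_x t`, with `C_x = φ(1) / (1 - exp (-x))`. -/
theorem measure_lt_le (hS : IsRegularSubordinator S Prob)
    (hν : IsDriftlessLevyMeasure S Prob ν) {t : ℝ} (ht : 0 ≤ t) {x : ℝ} (hx : 0 < x) :
    Prob {ω | x < S t ω} ≤
      ENNReal.ofReal (laplaceExponent ν 1 / (1 - Real.exp (-x)) * t) := by
  have hx1 : 0 < 1 - Real.exp (-x) := by
    have : Real.exp (-x) < 1 := Real.exp_lt_one_iff.2 (by linarith)
    linarith
  have h1 := hS.lintegral_one_sub_exp hν one_pos ht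
  simp only [div_one, one_mul] at h1
  have h2 := mul_meas_ge_le_lintegral (μ := Prob)
    (f := fun ω => ENNReal.ofReal (1 - Real.exp (-(S t ω))))
    ((measurable_const.sub (hS.measurable_apply t).neg.exp).ennreal_ofReal)
    (ENNReal.ofReal (1 - Real.exp (-x)))
  rw [h1] at h2
  have h3 : {ω | x < S t ω} ⊆ {ω | ENNReal.ofReal (1 - Real.exp (-x))
      ≤ ENNReal.ofReal (1 - Real.exp (-(S t ω)))} := by
    intro ω hω
    have : x < S t ω := hω
    refine ENNReal.ofReal_le_ofReal (sub_le_sub_left (Real.exp_le_exp.2 ?_) _)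
    linarith
  have h4 : ENNReal.ofReal (1 - Real.exp (-x)) ≠ 0 := by simpa using hx
  have h5 : 1 - Real.exp (-(t * laplaceExponent ν 1)) ≤ laplaceExponent ν 1 * t := by
    linarith [Real.add_one_le_exp (-(t * laplaceExponent ν 1))]
  rw [div_mul_eq_mul_div, ENNReal.ofReal_div_of_pos hx1,
    ENNReal.le_div_iff_mul_le (Or.inl h4) (Or.inl ENNReal.ofReal_ne_top), mul_comm]
  calc _ ≤ _ := mul_le_mul_right (measure_mono h3) _
    _ ≤ _ := h2
    _ ≤ _ := ENNReal.ofReal_le_ofReal h5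

end Laplace

end IsRegularSubordinator

end Regular

end TimeFractional

/-! ### Uniqueness of Laplace transforms -/

namespace TimeFractional

/-- Two measures on the line with the same Laplace transform, finite on `(0, ∞)`, coincide. After
multiplication by `exp (-2x)` their complex moment generating functions are analytic and equal on
the half-plane `re z < 2`, which contains the imaginary axis. -/
theorem measure_ext_of_lintegral_exp {α β : Measure ℝ}
    (h : ∀ l, 0 < l → ∫⁻ x, ENNReal.ofReal (Real.exp (-(l * x))) ∂α
      = ∫⁻ x, ENNReal.ofReal (Real.exp (-(l * x))) ∂β)
    (hfin : ∀ l, 0 < l → ∫⁻ x, ENNReal.ofReal (Real.exp (-(l * x))) ∂β ≠ ∞) : α = β := by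
  set e : ℝ → ℝ≥0∞ := fun x => ENNReal.ofReal (Real.exp (-(2 * x))) with he
  have hem : Measurable e := by fun_prop
  have htilt : ∀ (γ : Measure ℝ) (z : ℝ), ∫⁻ x, ENNReal.ofReal (Real.exp (z * x)) ∂γ.withDensity e
      = ∫⁻ x, ENNReal.ofReal (Real.exp (-((2 - z) * x))) ∂γ := by
    intro γ z
    rw [lintegral_withDensity_eq_lintegral_mul _ hem (by fun_prop)]
    refine lintegral_congr fun x => ?_
    simp only [he, Pi.mul_apply]
    rw [← ENNReal.ofReal_mul (Real.exp_pos _).le, ← Real.exp_add]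
    ring_nf
  have hfin' : ∀ l, 0 < l → ∫⁻ x, ENNReal.ofReal (Real.exp (-(l * x))) ∂α ≠ ∞ := by
    intro l hl
    rw [h l hl]
    exact hfin l hl
  have hfinite : ∀ γ : Measure ℝ,
      (∀ l, 0 < l → ∫⁻ x, ENNReal.ofReal (Real.exp (-(l * x))) ∂γ ≠ ∞) →
      IsFiniteMeasure (γ.withDensity e) ∧
        ∀ z < 2, Integrable (fun x => Real.exp (z * id x)) (γ.withDensity e) := by
    intro γ hγ
    constructor
    · exact isFiniteMeasure_withDensity (hγ 2 two_pos)
    · intro z hz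
      refine ⟨by fun_prop, ?_⟩
      rw [hasFiniteIntegral_iff_ofReal (ae_of_all _ fun x => (Real.exp_pos _).le)]
      simp only [id]
      rw [htilt]
      exact (hγ (2 - z) (by linarith)).lt_top
  obtain ⟨hα1, hα2⟩ := hfinite α hfin'
  obtain ⟨hβ1, hβ2⟩ := hfinite β hfin
  have hmgf : ∀ z < 2, mgf id (α.withDensity e) z = mgf id (β.withDensity e) z := by
    intro z hz
    simp only [mgf, id]
    rw [integral_eq_lintegral_of_nonneg_ae (ae_of_all _ fun x => (Real.exp_pos _).le)
      (by fun_prop), integral_eq_lintegral_of_nonneg_ae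
      (ae_of_all _ fun x => (Real.exp_pos _).le) (by fun_prop), htilt, htilt, h _ (by linarith)]
  have hint : ∀ γ : Measure ℝ, (∀ z < 2, Integrable (fun x => Real.exp (z * id x)) γ) →
      AnalyticOnNhd ℂ (complexMGF id γ) {z | z.re < 2} := by
    intro γ hγ
    refine analyticOnNhd_complexMGF.mono fun z hz => ?_
    exact interior_maximal (fun t ht => hγ t ht) isOpen_Iio hz
  have hpre : IsPreconnected {z : ℂ | z.re < 2} :=
    (convex_halfSpace_re_lt 2).isPreconnected
  have hfreq : ∃ᶠ z in 𝓝[≠] (0 : ℂ),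
      complexMGF id (α.withDensity e) z = complexMGF id (β.withDensity e) z := by
    have h1 : Tendsto (fun n : ℕ => ((1 / ((n : ℝ) + 1) : ℝ) : ℂ)) atTop (𝓝[≠] 0) := by
      refine tendsto_nhdsWithin_iff.2 ⟨?_, ?_⟩
      · have := (Complex.continuous_ofReal.tendsto 0).comp
          (tendsto_one_div_add_atTop_nhds_zero_nat (𝕜 := ℝ))
        simpa [Function.comp_def] using this
      · refine Eventually.of_forall fun n => ?_
        have : (0 : ℝ) < 1 / ((n : ℝ) + 1) := Nat.one_div_pos_of_nat
        simpa only [mem_compl_iff, mem_singleton_iff, Complex.ofReal_eq_zero] using this.ne'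
    refine h1.frequently (Frequently.of_forall fun n => ?_)
    rw [complexMGF_ofReal, complexMGF_ofReal, hmgf]
    have h2 : 1 / ((n : ℝ) + 1) ≤ 1 := by
      rw [div_le_one (by positivity)]
      linarith [(Nat.cast_nonneg n : (0 : ℝ) ≤ n)]
    linarith
  have heq := (hint _ hα2).eqOn_of_preconnected_of_frequently_eq (hint _ hβ2) hpre
    (z₀ := 0) (by simp) hfreq
  have hmain : α.withDensity e = β.withDensity e := by
    refine Measure.ext_of_charFun (funext fun t => ?_)
    rw [← complexMGF_id_mul_I, ← complexMGF_id_mul_I]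
    exact heq (by simp)
  have hinv : ∀ γ : Measure ℝ,
      (γ.withDensity e).withDensity (fun x => ENNReal.ofReal (Real.exp (2 * x))) = γ := by
    intro γ
    rw [← withDensity_mul _ hem (by fun_prop)]
    have : e * (fun x => ENNReal.ofReal (Real.exp (2 * x))) = 1 := by
      ext x
      simp only [he, Pi.mul_apply, Pi.one_apply]
      rw [← ENNReal.ofReal_mul (Real.exp_pos _).le, ← Real.exp_add]
      simp
    rw [this, withDensity_one]
  rw [← hinv α, hmain, hinv β]

/-! ### The law of the inverse subordinator -/

section FirstPassage

variable {Ω : Type*} [MeasurableSpace Ω]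

/-- The measure `Prob ⊗ dr` on `Ω × (0, ∞)`. -/
noncomputable def clockMeasure (Prob : Measure Ω) : Measure (Ω × ℝ) :=
  Prob.prod (volume.restrict (Ioi (0 : ℝ)))

instance (Prob : Measure Ω) [SFinite Prob] : SFinite (clockMeasure Prob) := by
  unfold clockMeasure; infer_instance

/-- The measure `ν(y, ∞) dy` on `(0, ∞)`. -/
noncomputable def tailMeasure (ν : Measure ℝ) : Measure ℝ :=
  (volume.restrict (Ioi (0 : ℝ))).withDensity fun y => ν (Ioi y)

instance (ν : Measure ℝ) : SFinite (tailMeasure ν) := by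
  unfold tailMeasure; infer_instance

variable {Prob : Measure Ω} {S : ℝ → Ω → ℝ} {ν : Measure ℝ}

theorem lintegral_tailMeasure_exp (hν : IsDriftlessLevyMeasure S Prob ν) {l : ℝ} (hl : 0 < l) :
    ∫⁻ y, ENNReal.ofReal (Real.exp (-(l * y))) ∂tailMeasure ν
      = ENNReal.ofReal (laplaceExponent ν l / l) := by
  rw [tailMeasure, lintegral_withDensity_eq_lintegral_mul _ (measurable_tail ν) (by fun_prop)]
  exact hν.lintegral_tail hl

namespace IsRegularSubordinator

theorem measurable_swap (hS : IsRegularSubordinator S Prob) :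
    Measurable fun q : Ω × ℝ => S q.2 q.1 :=
  hS.measurable.comp _root_.measurable_swap

theorem measurable_add (hS : IsRegularSubordinator S Prob) :
    Measurable fun q : ℝ × Ω × ℝ => q.1 + S q.2.2 q.2.1 :=
  measurable_fst.add (hS.measurable_swap.comp measurable_snd)

variable [IsProbabilityMeasure Prob]

theorem lintegral_exp_Ioc (hS : IsRegularSubordinator S Prob)
    (hν : IsDriftlessLevyMeasure S Prob ν) (hν_inf : ν (Ioi 0) = ∞) {l : ℝ} (hl : 0 < l) {r : ℝ}
    (hr : 0 ≤ r) :
    ∫⁻ q : Ω × ℝ, ENNReal.ofReal (Real.exp (-(l * S q.2 q.1)))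
        ∂Prob.prod (volume.restrict (Ioc 0 r))
      = ENNReal.ofReal ((1 - Real.exp (-(r * laplaceExponent ν l))) / laplaceExponent ν l) := by
  have hφ := hν.laplaceExponent_pos hν_inf hl
  rw [lintegral_prod_symm]
  · rw [setLIntegral_congr_fun measurableSet_Ioc
      (fun q hq => hS.lintegral_exp hν hl hq.1.le)]
    rw [← ofReal_integral_eq_lintegral_ofReal, ← intervalIntegral.integral_of_le hr]
    · congr 1
      set φ := laplaceExponent ν l
      have hd : ∀ x : ℝ,
          HasDerivAt (fun x => -Real.exp (-(x * φ)) / φ) (Real.exp (-(x * φ))) x := by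
        intro x
        have h1 : HasDerivAt (fun x : ℝ => -(x * φ)) (-φ) x :=
          ((hasDerivAt_id x).mul_const φ).neg.congr_deriv (by simp)
        refine ((h1.exp.neg).div_const φ).congr_deriv ?_
        field_simp
      rw [intervalIntegral.integral_eq_sub_of_hasDerivAt (fun x _ => hd x)
        (Continuous.intervalIntegrable (by fun_prop) _ _)]
      simp only [zero_mul, neg_zero, Real.exp_zero]
      ring
    · exact (Continuous.integrableOn_Icc (by fun_prop)).mono_set Ioc_subset_Icc_self
    · exact ae_of_all _ fun x => (Real.exp_pos _).le
  · exact ((hS.measurable_swap.const_mul l).neg.exp.ennreal_ofReal).aemeasurable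

/-- The law of `y + S_q` under `ν(y, ∞) dy ⊗ Prob ⊗ dq`, `q ≤ r`, is `P(E_x ≤ r) dx`: both have the
Laplace transform `(1 - exp (-r φ(l))) / l`. -/
theorem map_add_eq_withDensity (hS : IsRegularSubordinator S Prob)
    (hν : IsDriftlessLevyMeasure S Prob ν) (hν_inf : ν (Ioi 0) = ∞) {r : ℝ} (hr : 0 ≤ r) :
    Measure.map (fun q : ℝ × Ω × ℝ => q.1 + S q.2.2 q.2.1)
      ((tailMeasure ν).prod (Prob.prod (volume.restrict (Ioc 0 r))))
      = (volume.restrict (Ioi (0 : ℝ))).withDensity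
        fun x => Prob {ω | inverseSubordinator S x ω ≤ r} := by
  have hEm : Measurable fun x => Prob {ω | inverseSubordinator S x ω ≤ r} :=
    measurable_measure_prodMk_left
      (measurableSet_le hS.measurable_inverseSubordinator measurable_const)
  have hleft : ∀ l, 0 < l → ∫⁻ x, ENNReal.ofReal (Real.exp (-(l * x)))
      ∂Measure.map (fun q : ℝ × Ω × ℝ => q.1 + S q.2.2 q.2.1)
        ((tailMeasure ν).prod (Prob.prod (volume.restrict (Ioc 0 r))))
      = ENNReal.ofReal ((1 - Real.exp (-(r * laplaceExponent ν l))) / l) := by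
    intro l hl
    have hφ := hν.laplaceExponent_pos hν_inf hl
    rw [lintegral_map (by fun_prop) hS.measurable_add]
    have h1 : ∀ q : ℝ × Ω × ℝ, ENNReal.ofReal (Real.exp (-(l * (q.1 + S q.2.2 q.2.1))))
        = ENNReal.ofReal (Real.exp (-(l * q.1))) *
          ENNReal.ofReal (Real.exp (-(l * S q.2.2 q.2.1))) := by
      intro q
      rw [← ENNReal.ofReal_mul (Real.exp_pos _).le, ← Real.exp_add]
      ring_nf
    simp only [h1]
    rw [lintegral_prod_mul (f := fun y => ENNReal.ofReal (Real.exp (-(l * y))))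
      (g := fun q : Ω × ℝ => ENNReal.ofReal (Real.exp (-(l * S q.2 q.1)))) (by fun_prop)
      (((hS.measurable_swap.const_mul l).neg.exp.ennreal_ofReal).aemeasurable),
      lintegral_tailMeasure_exp hν hl, hS.lintegral_exp_Ioc hν hν_inf hl hr,
      ← ENNReal.ofReal_mul (by positivity)]
    congr 1
    field_simp
  have hlevel : ∀ l, 0 < l → ∀ t, 0 ≤ t →
      ∫⁻ x in Ioi (0 : ℝ), Prob {ω | x < S t ω} * ENNReal.ofReal (Real.exp (-(l * x)))
        = ENNReal.ofReal ((1 - Real.exp (-(t * laplaceExponent ν l))) / l) := by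
    intro l hl t ht
    rw [lintegral_tail_mul_exp Prob (hS.measurable_apply t).aemeasurable
      (ae_of_all _ (hS.nonneg t)) hl, hS.lintegral_one_sub_exp hν hl ht]
  have hright : ∀ l, 0 < l → ∫⁻ x, ENNReal.ofReal (Real.exp (-(l * x)))
      ∂(volume.restrict (Ioi (0 : ℝ))).withDensity
        (fun x => Prob {ω | inverseSubordinator S x ω ≤ r})
      = ENNReal.ofReal ((1 - Real.exp (-(r * laplaceExponent ν l))) / l) := by
    intro l hl
    rw [lintegral_withDensity_eq_lintegral_mul _ hEm (by fun_prop)]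
    simp only [Pi.mul_apply]
    refine le_antisymm ?_ ?_
    · -- `P(E_x ≤ r) ≤ P(S_t > x)` for every `t > r`; let `t` decrease to `r`.
      have h1 : Tendsto (fun t : ℝ =>
          ENNReal.ofReal ((1 - Real.exp (-(t * laplaceExponent ν l))) / l)) (𝓝[>] r)
          (𝓝 (ENNReal.ofReal ((1 - Real.exp (-(r * laplaceExponent ν l))) / l))) := by
        have : Continuous fun t : ℝ =>
            ENNReal.ofReal ((1 - Real.exp (-(t * laplaceExponent ν l))) / l) :=
          ENNReal.continuous_ofReal.comp (by fun_prop)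
        exact (this.tendsto r).mono_left nhdsWithin_le_nhds
      refine ge_of_tendsto h1 ?_
      filter_upwards [self_mem_nhdsWithin] with t ht
      rw [← hlevel l hl t (hr.trans (le_of_lt ht))]
      refine lintegral_mono fun x => ?_
      gcongr with ω
      exact fun hω => hS.lt_of_inverseSubordinator_lt (lt_of_le_of_lt hω ht)
    · rw [← hlevel l hl r hr]
      refine setLIntegral_mono' measurableSet_Ioi fun x hx => ?_
      rcases hr.eq_or_lt with rfl | hr'
      · have : Prob {ω | x < S 0 ω} = 0 := by simpa using hS.measure_lt_le hν le_rfl hx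
        rw [this, zero_mul]
        exact zero_le
      · gcongr with ω
        exact fun hω => inverseSubordinator_le hr' hω
  refine measure_ext_of_lintegral_exp (fun l hl => ?_) fun l hl => ?_
  · rw [hleft l hl, hright l hl]
  · rw [hright l hl]
    exact ENNReal.ofReal_ne_top

/-- The law of `(y + S_q, q)` under `ν(y, ∞) dy ⊗ Prob ⊗ dq` is that of `(x, E_x)` under
`dx ⊗ Prob`. In other words, `E_x` has the density `q ↦ 𝔼[w(x - S_q); S_q < x]`. -/
theorem map_add_eq_map_inverseSubordinator (hS : IsRegularSubordinator S Prob)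
    (hν : IsDriftlessLevyMeasure S Prob ν) (hν_inf : ν (Ioi 0) = ∞) :
    Measure.map (fun q : ℝ × Ω × ℝ => (q.1 + S q.2.2 q.2.1, q.2.2))
      ((tailMeasure ν).prod (clockMeasure Prob))
      = Measure.map (fun q : ℝ × Ω => (q.1, inverseSubordinator S q.1 q.2))
        ((volume.restrict (Ioi (0 : ℝ))).prod Prob) := by
  have hm1 : Measurable fun q : ℝ × Ω × ℝ => (q.1 + S q.2.2 q.2.1, q.2.2) :=
    hS.measurable_add.prodMk (measurable_snd.comp measurable_snd)
  have hm2 : Measurable fun q : ℝ × Ω => (q.1, inverseSubordinator S q.1 q.2) :=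
    measurable_fst.prodMk hS.measurable_inverseSubordinator
  symm
  refine Measure.ext_of_generateFrom_of_iUnion
    (image2 (· ×ˢ ·) {s : Set ℝ | MeasurableSet s} (range (Iic : ℝ → Set ℝ)))
    (fun n : ℕ => Iio (n : ℝ) ×ˢ Iic (n : ℝ)) ?_ ?_ ?_ ?_ ?_ ?_
  · refine (generateFrom_eq_prod MeasurableSpace.generateFrom_measurableSet ?_
      isCountablySpanning_measurableSet ?_).symm
    · rw [← borel_eq_generateFrom_Iic]
      exact (BorelSpace.measurable_eq).symm
    · refine ⟨fun n : ℕ => Iic (n : ℝ), fun n => ⟨_, rfl⟩, ?_⟩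
      exact iUnion_eq_univ_iff.2 fun x => exists_nat_ge x
  · exact MeasurableSpace.isPiSystem_measurableSet.prod isPiSystem_Iic
  · refine iUnion_eq_univ_iff.2 fun x => ?_
    obtain ⟨n, hn⟩ := exists_nat_gt (max x.1 x.2)
    exact ⟨n, (le_max_left _ _).trans_lt hn, ((le_max_right _ _).trans_lt hn).le⟩
  · exact fun n => ⟨_, mem_ofPred_eq ▸ measurableSet_Iio, _, ⟨_, rfl⟩, rfl⟩
  · intro n
    rw [Measure.map_apply hm2 (measurableSet_Iio.prod measurableSet_Iic)]
    refine ne_top_of_le_ne_top ?_ (measure_mono (t := Iio (n : ℝ) ×ˢ univ) fun q hq => ?_)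
    · rw [Measure.prod_prod, Measure.restrict_apply measurableSet_Iio, measure_univ, mul_one,
        inter_comm, Ioi_inter_Iio, Real.volume_Ioo]
      exact ENNReal.ofReal_ne_top
    · exact ⟨hq.1, mem_univ _⟩
  · rintro _ ⟨C, hC, _, ⟨r, rfl⟩, rfl⟩
    have hC' : MeasurableSet C := hC
    rw [Measure.map_apply hm2 (hC'.prod measurableSet_Iic),
      Measure.map_apply hm1 (hC'.prod measurableSet_Iic)]
    rcases lt_or_ge r 0 with hr | hr
    · have h1 : (fun q : ℝ × Ω => (q.1, inverseSubordinator S q.1 q.2)) ⁻¹' C ×ˢ Iic r = ∅ := by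
        refine eq_empty_of_forall_notMem fun q hq => ?_
        exact absurd hq.2 (not_le.2 (hr.trans_le (inverseSubordinator_nonneg S _ _)))
      rw [h1, measure_empty]
      symm
      refine measure_mono_null (t := univ ×ˢ (univ ×ˢ Iic r)) (fun q hq => ⟨mem_univ _,
        mem_univ _, hq.2⟩) ?_
      rw [Measure.prod_prod, clockMeasure, Measure.prod_prod,
        Measure.restrict_apply measurableSet_Iic, inter_comm, Ioi_inter_Iic, Ioc_eq_empty
        (not_lt.2 hr.le)]
      simp
    · have h2 := congrArg (fun γ : Measure ℝ => γ C) (hS.map_add_eq_withDensity hν hν_inf hr)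
      rw [Measure.map_apply hS.measurable_add hC', withDensity_apply _ hC'] at h2
      have h3 : (tailMeasure ν).prod (Prob.prod (volume.restrict (Ioc 0 r)))
          = ((tailMeasure ν).prod (clockMeasure Prob)).restrict (univ ×ˢ (univ ×ˢ Iic r)) := by
        rw [← Measure.prod_restrict, clockMeasure, ← Measure.prod_restrict,
          Measure.restrict_univ, Measure.restrict_univ, Measure.restrict_restrict measurableSet_Iic,
          inter_comm, Ioi_inter_Iic]
      rw [h3, Measure.restrict_apply (hS.measurable_add hC')] at h2
      have h4 : (fun q : ℝ × Ω × ℝ => q.1 + S q.2.2 q.2.1) ⁻¹' C ∩ univ ×ˢ (univ ×ˢ Iic r)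
          = (fun q : ℝ × Ω × ℝ => (q.1 + S q.2.2 q.2.1, q.2.2)) ⁻¹' C ×ˢ Iic r := by
        ext q; simp
      rw [h4] at h2
      rw [h2, Measure.prod_apply (hm2 (hC'.prod measurableSet_Iic)), ← lintegral_indicator hC']
      refine lintegral_congr fun x => ?_
      by_cases hx : x ∈ C
      · rw [indicator_of_mem hx]
        congr 1
        ext ω
        simp [hx]
      · rw [indicator_of_notMem hx]
        convert measure_empty (μ := Prob)
        ext ω
        simp [hx]

end IsRegularSubordinator

end FirstPassage

end TimeFractional

/-! ### Integration against the clock measure -/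

namespace TimeFractional

section Clock

variable {Ω : Type*} [MeasurableSpace Ω] {Prob : Measure Ω} {S : ℝ → Ω → ℝ} {ν : Measure ℝ}

theorem ae_clockMeasure_pos [SFinite Prob] : ∀ᵐ q ∂clockMeasure Prob, 0 < q.2 := by
  have h : ∀ᵐ r ∂volume.restrict (Ioi (0 : ℝ)), 0 < r := ae_restrict_mem measurableSet_Ioi
  exact Measure.quasiMeasurePreserving_snd.ae h

theorem tailMeasure_Iic (ν : Measure ℝ) : tailMeasure ν (Iic 0) = 0 := by
  rw [tailMeasure, withDensity_apply _ measurableSet_Iic,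
    Measure.restrict_restrict measurableSet_Iic, Iic_inter_Ioi, Ioc_self]
  simp

theorem tailMeasure_Iio_lt_top (hν : IsDriftlessLevyMeasure S Prob ν) (T : ℝ) :
    tailMeasure ν (Iio T) < ∞ := by
  rw [tailMeasure, withDensity_apply _ measurableSet_Iio,
    Measure.restrict_restrict measurableSet_Iio, inter_comm, Ioi_inter_Iio]
  have h := (hν.integrableOn_weight T).2
  rw [hasFiniteIntegral_iff_ofReal (ae_of_all _ fun x => weight_nonneg ν x)] at h
  rwa [setLIntegral_congr_fun measurableSet_Ioo fun x hx => hν.ofReal_weight hx.1] at h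

/-- Convolution with `w` as an integral against the tail measure. -/
theorem integral_tailMeasure {X : Type*} [NormedAddCommGroup X] [NormedSpace ℝ X]
    (hν : IsDriftlessLevyMeasure S Prob ν) {T : ℝ} (hT : 0 ≤ T) {F : ℝ → X}
    (hF : ∀ t ≤ 0, F t = 0) :
    ∫ y, F (T - y) ∂tailMeasure ν = ∫ s in (0 : ℝ)..T, weight ν (T - s) • F s := by
  have h1 : tailMeasure ν
      = (volume.restrict (Ioi (0 : ℝ))).withDensity fun y => ENNReal.ofReal (weight ν y) := by
    refine withDensity_congr_ae ?_
    filter_upwards [ae_restrict_mem measurableSet_Ioi] with y hy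
    exact (hν.ofReal_weight hy).symm
  rw [h1, integral_withDensity_eq_integral_toReal_smul (measurable_weight ν).ennreal_ofReal
    (ae_of_all _ fun _ => ENNReal.ofReal_lt_top)]
  simp only [ENNReal.toReal_ofReal (weight_nonneg ν _)]
  have h2 : ∫ s in (0 : ℝ)..T, weight ν (T - s) • F s
      = ∫ y in (0 : ℝ)..T, weight ν y • F (T - y) := by
    have := intervalIntegral.integral_comp_sub_left (a := 0) (b := T)
      (fun y => weight ν y • F (T - y)) T
    simpa using this
  rw [h2, intervalIntegral.integral_of_le hT, setIntegral_eq_of_subset_of_forall_sdiff_eq_zero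
    measurableSet_Ioi Ioc_subset_Ioi_self]
  intro y hy
  have : T - y ≤ 0 := by
    by_contra h
    exact hy.2 ⟨hy.1, by linarith⟩
  rw [hF _ this, smul_zero]

theorem integral_Ioi_sub {X : Type*} [NormedAddCommGroup X] [NormedSpace ℝ X] {T : ℝ}
    (hT : 0 ≤ T) {F : ℝ → X} (hF : ∀ t ≤ 0, F t = 0) :
    ∫ y in Ioi (0 : ℝ), F (T - y) = ∫ s in (0 : ℝ)..T, F s := by
  have h2 : ∫ s in (0 : ℝ)..T, F s = ∫ y in (0 : ℝ)..T, F (T - y) := by simp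
  rw [h2, intervalIntegral.integral_of_le hT, setIntegral_eq_of_subset_of_forall_sdiff_eq_zero
    measurableSet_Ioi Ioc_subset_Ioi_self]
  intro y hy
  refine hF _ ?_
  by_contra h
  exact hy.2 ⟨hy.1, by linarith⟩

namespace IsRegularSubordinator

variable [IsProbabilityMeasure Prob]

/-- The mean occupation time of `[0, x]` is finite. -/
theorem clockMeasure_le_lt_top (hS : IsRegularSubordinator S Prob)
    (hν : IsDriftlessLevyMeasure S Prob ν) (hν_inf : ν (Ioi 0) = ∞) (x : ℝ) :
    clockMeasure Prob {q | S q.2 q.1 ≤ x} < ∞ := by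
  have hφ := hν.laplaceExponent_pos hν_inf one_pos
  rw [clockMeasure, Measure.prod_apply_symm (measurableSet_le hS.measurable_swap measurable_const)]
  calc ∫⁻ r in Ioi (0 : ℝ), Prob ((fun ω => (ω, r)) ⁻¹' {q : Ω × ℝ | S q.2 q.1 ≤ x})
      ≤ ∫⁻ r in Ioi (0 : ℝ), ENNReal.ofReal (Real.exp x) *
          ENNReal.ofReal (Real.exp (-(laplaceExponent ν 1 * r))) := by
        refine setLIntegral_mono' measurableSet_Ioi fun r hr => ?_
        exact hS.measure_le_le hν (le_of_lt hr) x
    _ = ENNReal.ofReal (Real.exp x) *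
        ∫⁻ r in Ioi (0 : ℝ), ENNReal.ofReal (Real.exp (-(laplaceExponent ν 1 * r))) :=
        lintegral_const_mul _ (by fun_prop)
    _ < ∞ := by
        refine ENNReal.mul_lt_top ENNReal.ofReal_lt_top ?_
        have h := (exp_neg_integrableOn_Ioi 0 hφ).2
        rw [hasFiniteIntegral_iff_ofReal (ae_of_all _ fun x => (Real.exp_pos _).le)] at h
        simpa only [neg_mul] using h

theorem integrable_clockMeasure {X : Type*} [NormedAddCommGroup X]
    (hS : IsRegularSubordinator S Prob)
    (hν : IsDriftlessLevyMeasure S Prob ν) (hν_inf : ν (Ioi 0) = ∞) {F : Ω × ℝ → X} {C x : ℝ}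
    (hF : AEStronglyMeasurable F (clockMeasure Prob)) (hC : ∀ q, ‖F q‖ ≤ C)
    (h0 : ∀ q, x < S q.2 q.1 → F q = 0) : Integrable F (clockMeasure Prob) := by
  have hm : MeasurableSet {q : Ω × ℝ | S q.2 q.1 ≤ x} :=
    measurableSet_le hS.measurable_swap measurable_const
  refine Integrable.mono' (g := {q : Ω × ℝ | S q.2 q.1 ≤ x}.indicator fun _ => C) ?_ hF
    (ae_of_all _ fun q => ?_)
  · exact (integrable_indicator_iff hm).2
      (integrableOn_const (hS.clockMeasure_le_lt_top hν hν_inf x).ne)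
  · by_cases hq : S q.2 q.1 ≤ x
    · rw [indicator_of_mem (show q ∈ {q : Ω × ℝ | S q.2 q.1 ≤ x} from hq)]
      exact hC q
    · rw [h0 q (not_le.1 hq), indicator_of_notMem (show q ∉ {q : Ω × ℝ | S q.2 q.1 ≤ x} from hq),
        norm_zero]

theorem integrable_prod_clockMeasure {X : Type*} [NormedAddCommGroup X]
    (hS : IsRegularSubordinator S Prob)
    (hν : IsDriftlessLevyMeasure S Prob ν) (hν_inf : ν (Ioi 0) = ∞) {θ : Measure ℝ} [SFinite θ]
    {T : ℝ} (hθ : θ (Iio T) < ∞) {F : ℝ × Ω × ℝ → X} {C : ℝ}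
    (hF : AEStronglyMeasurable F (θ.prod (clockMeasure Prob))) (hC : ∀ q, ‖F q‖ ≤ C)
    (h0 : ∀ᵐ q ∂θ.prod (clockMeasure Prob), T ≤ q.1 ∨ T < S q.2.2 q.2.1 → F q = 0) :
    Integrable F (θ.prod (clockMeasure Prob)) := by
  have hm : MeasurableSet {q : Ω × ℝ | S q.2 q.1 ≤ T} :=
    measurableSet_le hS.measurable_swap measurable_const
  have hm' : MeasurableSet (Iio T ×ˢ {q : Ω × ℝ | S q.2 q.1 ≤ T}) := measurableSet_Iio.prod hm
  refine Integrable.mono' (g := (Iio T ×ˢ {q : Ω × ℝ | S q.2 q.1 ≤ T}).indicator fun _ => C) ?_ hF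
    ?_
  · refine (integrable_indicator_iff hm').2 (integrableOn_const ?_)
    rw [Measure.prod_prod]
    exact (ENNReal.mul_lt_top hθ (hS.clockMeasure_le_lt_top hν hν_inf T)).ne
  · filter_upwards [h0] with q hq0
    by_cases hq : q ∈ Iio T ×ˢ {q : Ω × ℝ | S q.2 q.1 ≤ T}
    · rw [indicator_of_mem hq]
      exact hC q
    · have : F q = 0 := by
        refine hq0 ?_
        by_contra h
        push Not at h
        exact hq ⟨h.1, h.2⟩
      rw [this, indicator_of_notMem hq, norm_zero]

/-- Fubini's theorem for the clock measure and a measure on `(0, ∞)`. -/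
theorem integral_integral_swap (hS : IsRegularSubordinator S Prob)
    (hν : IsDriftlessLevyMeasure S Prob ν) (hν_inf : ν (Ioi 0) = ∞) {θ : Measure ℝ} [SFinite θ]
    {T : ℝ} (hθ0 : θ (Iic 0) = 0) (hθ : θ (Iio T) < ∞) {h : ℝ × ℝ → ℝ} (hh : Measurable h) {C : ℝ}
    (hC : ∀ q, |h q| ≤ C) (h0 : ∀ s r, s ≤ 0 → h (s, r) = 0) :
    ∫ y, (∫ q, h (T - y - S q.2 q.1, q.2) ∂clockMeasure Prob) ∂θ
      = ∫ q, (∫ y, h (T - S q.2 q.1 - y, q.2) ∂θ) ∂clockMeasure Prob := by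
  have hm : Measurable fun q : ℝ × Ω × ℝ => h (T - q.1 - S q.2.2 q.2.1, q.2.2) :=
    hh.comp (((measurable_const.sub measurable_fst).sub
      (hS.measurable_swap.comp measurable_snd)).prodMk (measurable_snd.comp measurable_snd))
  have hi : Integrable (fun q : ℝ × Ω × ℝ => h (T - q.1 - S q.2.2 q.2.1, q.2.2))
      (θ.prod (clockMeasure Prob)) := by
    refine hS.integrable_prod_clockMeasure hν hν_inf hθ hm.aestronglyMeasurable
      (fun q => hC _) ?_
    have h1 : ∀ᵐ y ∂θ, 0 < y := by
      rw [ae_iff]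
      simpa [Iic, not_lt] using hθ0
    filter_upwards [Measure.quasiMeasurePreserving_fst.ae h1] with q hq hq'
    refine h0 _ _ ?_
    have := hS.nonneg q.2.2 q.2.1
    rcases hq' with hq' | hq' <;> linarith
  rw [MeasureTheory.integral_integral_swap hi]
  refine integral_congr_ae (ae_of_all _ fun q => ?_)
  refine integral_congr_ae (ae_of_all _ fun y => ?_)
  simp only
  congr 2
  ring

/-- The integrated form of the equality of laws `map_add_eq_map_inverseSubordinator`. -/
theorem integral_tailMeasure_eq (hS : IsRegularSubordinator S Prob)
    (hν : IsDriftlessLevyMeasure S Prob ν) (hν_inf : ν (Ioi 0) = ∞) (T : ℝ)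
    {h : ℝ × ℝ → ℝ} (hh : Measurable h) {C : ℝ}
    (hC : ∀ q, |h q| ≤ C) (h0 : ∀ s r, s ≤ 0 → h (s, r) = 0) :
    ∫ y, (∫ q, h (T - y - S q.2 q.1, q.2) ∂clockMeasure Prob) ∂tailMeasure ν
      = ∫ x in Ioi (0 : ℝ), ∫ ω, h (T - x, inverseSubordinator S x ω) ∂Prob := by
  have hmap := hS.map_add_eq_map_inverseSubordinator hν hν_inf
  have hk : Measurable fun q : ℝ × ℝ => h (T - q.1, q.2) :=
    hh.comp ((measurable_const.sub measurable_fst).prodMk measurable_snd)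
  have hm1 : Measurable fun q : ℝ × Ω × ℝ => (q.1 + S q.2.2 q.2.1, q.2.2) :=
    hS.measurable_add.prodMk (measurable_snd.comp measurable_snd)
  have hm2 : Measurable fun q : ℝ × Ω => (q.1, inverseSubordinator S q.1 q.2) :=
    measurable_fst.prodMk hS.measurable_inverseSubordinator
  have e1 := integral_map (μ := (tailMeasure ν).prod (clockMeasure Prob)) hm1.aemeasurable
    hk.aestronglyMeasurable
  have e2 := integral_map (μ := (volume.restrict (Ioi (0 : ℝ))).prod Prob) hm2.aemeasurable
    hk.aestronglyMeasurable
  rw [hmap, e2] at e1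
  have i2 : Integrable (fun q : ℝ × Ω => h (T - q.1, inverseSubordinator S q.1 q.2))
      ((volume.restrict (Ioi (0 : ℝ))).prod Prob) := by
    refine Integrable.mono' (g := (Iio T ×ˢ univ).indicator fun _ => C) ?_
      (hk.comp hm2).aestronglyMeasurable (ae_of_all _ fun q => ?_)
    · refine (integrable_indicator_iff (measurableSet_Iio.prod .univ)).2 (integrableOn_const ?_)
      rw [Measure.prod_prod, Measure.restrict_apply measurableSet_Iio, measure_univ, mul_one,
        inter_comm, Ioi_inter_Iio, Real.volume_Ioo]
      exact ENNReal.ofReal_ne_top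
    · by_cases hq : q.1 < T
      · rw [indicator_of_mem (show q ∈ Iio T ×ˢ univ from ⟨hq, mem_univ _⟩)]
        exact hC _
      · rw [indicator_of_notMem (fun h' : q ∈ Iio T ×ˢ univ => hq h'.1), h0 _ _ (by linarith),
          norm_zero]
  have i1 : Integrable (fun q : ℝ × Ω × ℝ => h (T - (q.1 + S q.2.2 q.2.1), q.2.2))
      ((tailMeasure ν).prod (clockMeasure Prob)) := by
    have := (integrable_map_measure (μ := (volume.restrict (Ioi (0 : ℝ))).prod Prob)
      hk.aestronglyMeasurable hm2.aemeasurable).2 i2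
    rw [← hmap] at this
    exact (integrable_map_measure hk.aestronglyMeasurable hm1.aemeasurable).1 this
  rw [integral_prod _ i1, integral_prod _ i2] at e1
  rw [e1]
  simp only [sub_sub]

theorem setOf_lt_ae_eq (hS : IsRegularSubordinator S Prob) (x : ℝ) :
    {q : Ω × ℝ | S q.2 q.1 < x} =ᵐ[clockMeasure Prob]
      {q : Ω × ℝ | q.2 < inverseSubordinator S x q.1} := by
  have h1 : ∀ᵐ q ∂clockMeasure Prob, S q.2 q.1 ≠ x := by
    have hm : MeasurableSet {q : Ω × ℝ | S q.2 q.1 = x} :=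
      hS.measurable_swap (measurableSet_singleton x)
    rw [ae_iff]
    simp only [not_not]
    rw [clockMeasure, Measure.prod_apply_symm hm, lintegral_eq_zero_iff
      (measurable_measure_prodMk_right hm)]
    filter_upwards [ae_restrict_mem measurableSet_Ioi] with r hr
    have := hS.ae_ne hr x
    rw [ae_iff] at this
    simpa using this
  have h2 : ∀ᵐ q ∂clockMeasure Prob, q.2 ≠ inverseSubordinator S x q.1 := by
    have hm : MeasurableSet {q : Ω × ℝ | q.2 = inverseSubordinator S x q.1} :=
      measurableSet_eq_fun measurable_snd
        ((hS.measurable_inverseSubordinator_apply x).comp measurable_fst)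
    rw [ae_iff]
    simp only [not_not]
    rw [clockMeasure, Measure.prod_apply hm, lintegral_eq_zero_iff
      (measurable_measure_prodMk_left hm)]
    refine ae_of_all _ fun ω => ?_
    have : Prod.mk ω ⁻¹' {q : Ω × ℝ | q.2 = inverseSubordinator S x q.1}
        = {inverseSubordinator S x ω} := by ext r; simp
    simp [this]
  filter_upwards [h1, h2, ae_clockMeasure_pos] with q hq1 hq2 hq3
  refine propext ⟨fun h => ?_, fun h => ?_⟩
  · refine lt_of_le_of_ne (not_lt.1 fun h' => ?_) hq2
    exact absurd (hS.lt_of_inverseSubordinator_lt h') (not_lt.2 (le_of_lt h))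
  · exact lt_of_le_of_ne (le_of_lt_inverseSubordinator hq3 h) hq1

theorem integrable_indicator_lt (hS : IsRegularSubordinator S Prob)
    (hν : IsDriftlessLevyMeasure S Prob ν) (hν_inf : ν (Ioi 0) = ∞) (x : ℝ) {k : ℝ → ℝ}
    (hk : Measurable k) {C : ℝ} (hC : ∀ r, |k r| ≤ C) :
    Integrable ({q : Ω × ℝ | S q.2 q.1 < x}.indicator fun q => k q.2) (clockMeasure Prob) := by
  have hm : MeasurableSet {q : Ω × ℝ | S q.2 q.1 < x} :=
    measurableSet_lt hS.measurable_swap measurable_const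
  refine hS.integrable_clockMeasure hν hν_inf (C := C) (x := x)
    ((hk.comp measurable_snd).indicator hm).aestronglyMeasurable (fun q => ?_) fun q hq => ?_
  · exact (norm_indicator_le_norm_self _ _).trans (hC _)
  · rw [indicator_of_notMem]
    exact fun h' => absurd hq (not_lt.2 (le_of_lt h'))

/-- The expected integral up to the inverse subordinator, as an occupation time integral. -/
theorem integral_inverseSubordinator (hS : IsRegularSubordinator S Prob)
    (hν : IsDriftlessLevyMeasure S Prob ν) (hν_inf : ν (Ioi 0) = ∞) (x : ℝ) {k : ℝ → ℝ}
    (hk : Measurable k) {C : ℝ} (hC : ∀ r, |k r| ≤ C) :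
    Integrable (fun ω => ∫ r in (0 : ℝ)..inverseSubordinator S x ω, k r) Prob ∧
    ∫ ω, (∫ r in (0 : ℝ)..inverseSubordinator S x ω, k r) ∂Prob
      = ∫ q, {q : Ω × ℝ | S q.2 q.1 < x}.indicator (fun q => k q.2) q ∂clockMeasure Prob := by
  have hi := hS.integrable_indicator_lt hν hν_inf x hk hC
  have hae : ({q : Ω × ℝ | S q.2 q.1 < x}.indicator fun q => k q.2) =ᵐ[clockMeasure Prob]
      {q : Ω × ℝ | q.2 < inverseSubordinator S x q.1}.indicator fun q => k q.2 :=
    indicator_ae_eq_of_ae_eq_set (hS.setOf_lt_ae_eq x)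
  have hi' := hi.congr hae
  have hinner : ∀ ω, ∫ r in (0 : ℝ)..inverseSubordinator S x ω, k r
      = ∫ r in Ioi (0 : ℝ),
        {q : Ω × ℝ | q.2 < inverseSubordinator S x q.1}.indicator (fun q => k q.2) (ω, r) := by
    intro ω
    have : (fun r => {q : Ω × ℝ | q.2 < inverseSubordinator S x q.1}.indicator
        (fun q => k q.2) (ω, r)) = (Iio (inverseSubordinator S x ω)).indicator k := by
      ext r; simp [indicator]
    rw [this, setIntegral_indicator measurableSet_Iio, Ioi_inter_Iio,
      intervalIntegral.integral_of_le (inverseSubordinator_nonneg S x ω),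
      integral_Ioc_eq_integral_Ioo]
  simp only [hinner]
  refine ⟨hi'.integral_prod_left, ?_⟩
  rw [integral_congr_ae hae]
  exact (integral_prod _ hi').symm

end IsRegularSubordinator

end Clock

end TimeFractional

/-! ### The potential of a source and the weak equation -/

namespace TimeFractional

section WeakEquation

variable {Ω : Type*} [MeasurableSpace Ω] {Prob : Measure Ω} {S : ℝ → Ω → ℝ} {ν : Measure ℝ}
  {H : Type*} [NormedAddCommGroup H] [InnerProductSpace ℝ H]
  {P : ℝ → H →L[ℝ] H} {A : H →ₗ.[ℝ] H}

/-- A bounded strongly measurable function on the line that vanishes off `(0, T₀]`. -/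
structure IsSource (T₀ : ℝ) (d : ℝ → H) : Prop where
  stronglyMeasurable : StronglyMeasurable d
  bounded : ∃ C, ∀ t, ‖d t‖ ≤ C
  zero : ∀ t, t ∉ Ioc 0 T₀ → d t = 0

/-- The potential `t ↦ 𝔼 ∫_0^∞ P_r d(t - S_r) dr` of `d`. The time `max r 0`, which is `r` almost
everywhere for the clock measure, keeps the integrand measurable. -/
noncomputable def potential (P : ℝ → H →L[ℝ] H) (S : ℝ → Ω → ℝ) (Prob : Measure Ω) (d : ℝ → H)
    (t : ℝ) : H :=
  ∫ q, P (max q.2 0) (d (t - S q.2 q.1)) ∂clockMeasure Prob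

/-- The mean `t ↦ 𝔼 P_{E_t} g` of an orbit at the inverse subordinator. -/
noncomputable def stoppedMean (P : ℝ → H →L[ℝ] H) (S : ℝ → Ω → ℝ) (Prob : Measure Ω) (g : H)
    (t : ℝ) : H :=
  ∫ ω, P (inverseSubordinator S t ω) g ∂Prob

namespace IsSource

variable {T₀ : ℝ} {d : ℝ → H}

omit [InnerProductSpace ℝ H] in
theorem zero_of_nonpos (hd : IsSource T₀ d) {t : ℝ} (ht : t ≤ 0) : d t = 0 :=
  hd.zero t fun h => absurd h.1 (not_lt.2 ht)

theorem measurable_pairing (hd : IsSource T₀ d) (hP : IsContractionSemigroup P) (φ : H) :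
    Measurable fun q : ℝ × ℝ => (inner ℝ (d q.1) (P (max q.2 0) φ) : ℝ) := by
  have h1 : StronglyMeasurable fun q : ℝ × ℝ => d q.1 :=
    hd.stronglyMeasurable.comp_measurable measurable_fst
  have h2 : StronglyMeasurable fun q : ℝ × ℝ => P (max q.2 0) φ :=
    (hP.continuous_orbit φ).stronglyMeasurable.comp_measurable measurable_snd
  exact (h1.inner h2).measurable

theorem exists_abs_pairing_le (hd : IsSource T₀ d) (hP : IsContractionSemigroup P) (φ : H) :
    ∃ C, ∀ q : ℝ × ℝ, |inner ℝ (d q.1) (P (max q.2 0) φ)| ≤ C := by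
  obtain ⟨C, hC⟩ := hd.bounded
  refine ⟨C * ‖φ‖, fun q => (abs_real_inner_le_norm _ _).trans ?_⟩
  exact mul_le_mul (hC _) (hP.norm_apply_le (le_max_right _ _) φ) (norm_nonneg _)
    ((norm_nonneg _).trans (hC 0))

end IsSource

namespace IsRegularSubordinator

variable {T₀ : ℝ} {d : ℝ → H}

theorem stronglyMeasurable_integrand (hS : IsRegularSubordinator S Prob)
    (hP : IsContractionSemigroup P) (hd : StronglyMeasurable d) :
    StronglyMeasurable fun q : ℝ × Ω × ℝ => P (max q.2.2 0) (d (q.1 - S q.2.2 q.2.1)) := by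
  have h1 : Measurable fun q : ℝ × Ω × ℝ => q.1 - S q.2.2 q.2.1 :=
    measurable_fst.sub (hS.measurable_swap.comp measurable_snd)
  have h2 : StronglyMeasurable fun q : ℝ × Ω × ℝ => (q.2.2, d (q.1 - S q.2.2 q.2.1)) :=
    (measurable_snd.comp measurable_snd).stronglyMeasurable.prodMk (hd.comp_measurable h1)
  exact hP.continuous_uncurry.comp_stronglyMeasurable h2

theorem stronglyMeasurable_integrand_apply (hS : IsRegularSubordinator S Prob)
    (hP : IsContractionSemigroup P) (hd : StronglyMeasurable d) (t : ℝ) :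
    StronglyMeasurable fun q : Ω × ℝ => P (max q.2 0) (d (t - S q.2 q.1)) :=
  (hS.stronglyMeasurable_integrand hP hd).comp_measurable
    (measurable_const.prodMk measurable_id)

theorem potential_of_nonpos (hS : IsRegularSubordinator S Prob) (hd : IsSource T₀ d) {t : ℝ}
    (ht : t ≤ 0) : potential P S Prob d t = 0 := by
  refine integral_eq_zero_of_ae (ae_of_all _ fun q => ?_)
  have := hS.nonneg q.2 q.1
  simp only [Pi.zero_apply]
  rw [hd.zero_of_nonpos (by linarith), map_zero]

variable [IsProbabilityMeasure Prob]

theorem integrable_potential (hS : IsRegularSubordinator S Prob)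
    (hν : IsDriftlessLevyMeasure S Prob ν) (hν_inf : ν (Ioi 0) = ∞)
    (hP : IsContractionSemigroup P) (hd : IsSource T₀ d) (t : ℝ) :
    Integrable (fun q : Ω × ℝ => P (max q.2 0) (d (t - S q.2 q.1))) (clockMeasure Prob) := by
  obtain ⟨C, hC⟩ := hd.bounded
  refine hS.integrable_clockMeasure hν hν_inf (C := C) (x := t)
    (hS.stronglyMeasurable_integrand_apply hP hd.stronglyMeasurable t).aestronglyMeasurable
    (fun q => (hP.norm_apply_le (le_max_right _ _) _).trans (hC _)) fun q hq => ?_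
  rw [hd.zero_of_nonpos (by linarith), map_zero]

theorem integrable_stoppedMean (hS : IsRegularSubordinator S Prob)
    (hP : IsContractionSemigroup P) (g : H) (t : ℝ) :
    Integrable (fun ω => P (inverseSubordinator S t ω) g) Prob := by
  have h1 : (fun ω => P (inverseSubordinator S t ω) g)
      = fun ω => P (max (inverseSubordinator S t ω) 0) g := by
    ext1 ω
    rw [max_eq_left (inverseSubordinator_nonneg S t ω)]
  refine Integrable.of_bound (C := ‖g‖) ?_ (ae_of_all _ fun ω =>
    hP.norm_apply_le (inverseSubordinator_nonneg S t ω) g)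
  rw [h1]
  exact ((hP.continuous_orbit g).stronglyMeasurable.comp_measurable
    (hS.measurable_inverseSubordinator_apply t)).aestronglyMeasurable

theorem norm_stoppedMean_le (hP : IsContractionSemigroup P) (g : H) (t : ℝ) :
    ‖stoppedMean P S Prob g t‖ ≤ ‖g‖ := by
  have := norm_integral_le_of_norm_le_const (μ := Prob) (ae_of_all _ fun ω =>
    hP.norm_apply_le (inverseSubordinator_nonneg S t ω) g)
  simpa [stoppedMean] using this

variable [CompleteSpace H]

theorem inner_potential (hS : IsRegularSubordinator S Prob)
    (hν : IsDriftlessLevyMeasure S Prob ν) (hν_inf : ν (Ioi 0) = ∞)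
    (hP : IsContractionSemigroup P) (hA : IsInfinitesimalGenerator A P)
    (hsym : IsSymmetricGenerator A) (hd : IsSource T₀ d) (φ : H) (t : ℝ) :
    inner ℝ (potential P S Prob d t) φ
      = ∫ q, inner ℝ (d (t - S q.2 q.1)) (P (max q.2 0) φ) ∂clockMeasure Prob := by
  rw [real_inner_comm, potential, ← integral_inner (hS.integrable_potential hν hν_inf hP hd t)]
  refine integral_congr_ae (ae_of_all _ fun q => ?_)
  simp only
  rw [real_inner_comm, inner_apply_comm hP hA hsym (le_max_right _ _)]

theorem inner_stoppedMean (hS : IsRegularSubordinator S Prob)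
    (hP : IsContractionSemigroup P) (g φ : H) (t : ℝ) :
    inner ℝ (stoppedMean P S Prob g t) φ
      = ∫ ω, inner ℝ (P (inverseSubordinator S t ω) g) φ ∂Prob := by
  rw [real_inner_comm, stoppedMean, ← integral_inner (hS.integrable_stoppedMean hP g t)]
  simp only [real_inner_comm]

/-- Dynkin's formula at the inverse subordinator. -/
theorem integral_inner_inverseSubordinator (hS : IsRegularSubordinator S Prob)
    (hν : IsDriftlessLevyMeasure S Prob ν) (hν_inf : ν (Ioi 0) = ∞)
    (hP : IsContractionSemigroup P) (hA : IsInfinitesimalGenerator A P) {φ ψ : H}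
    (hφψ : (φ, ψ) ∈ A.graph) (y : H) (x : ℝ) :
    ∫ ω, inner ℝ y (P (inverseSubordinator S x ω) φ) ∂Prob
      = inner ℝ y φ + ∫ q, {q : Ω × ℝ | S q.2 q.1 < x}.indicator
          (fun q => inner ℝ y (P (max q.2 0) ψ)) q ∂clockMeasure Prob := by
  have hk : Measurable fun r : ℝ => (inner ℝ y (P (max r 0) ψ) : ℝ) :=
    (continuous_const.inner (hP.continuous_orbit ψ)).measurable
  have hC : ∀ r : ℝ, |inner ℝ y (P (max r 0) ψ)| ≤ ‖y‖ * ‖ψ‖ := fun r =>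
    (abs_real_inner_le_norm _ _).trans
      (mul_le_mul_of_nonneg_left (hP.norm_apply_le (le_max_right _ _) ψ) (norm_nonneg _))
  obtain ⟨hi, he⟩ := hS.integral_inverseSubordinator hν hν_inf x hk hC
  rw [← he]
  have h1 : ∀ ω, inner ℝ y (P (inverseSubordinator S x ω) φ)
      = inner ℝ y φ + ∫ r in (0 : ℝ)..inverseSubordinator S x ω, inner ℝ y (P (max r 0) ψ) := by
    intro ω
    have hE := inverseSubordinator_nonneg S x ω
    have h2 := apply_sub_eq_integral hP hA hφψ le_rfl hE
    have h3 : P (inverseSubordinator S x ω) φ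
        = φ + ∫ r in (0 : ℝ)..inverseSubordinator S x ω, P r ψ := by
      rw [h2, hP.zero_apply]; abel
    rw [h3, inner_add_right]
    congr 1
    have h4 := (innerSL ℝ y).intervalIntegral_comp_comm (hP.intervalIntegrable_orbit ψ le_rfl hE)
    rw [← innerSL_apply_apply ℝ, ← h4]
    refine intervalIntegral.integral_congr fun r hr => ?_
    rw [uIcc_of_le hE] at hr
    simp only [innerSL_apply_apply, max_eq_left hr.1]
  simp only [h1]
  rw [integral_add (integrable_const _) hi]
  simp

/-- The weak equation for the potential, with the convolutions written as integrals over
`(0, ∞)`. -/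
theorem potential_weak_equation (hS : IsRegularSubordinator S Prob)
    (hν : IsDriftlessLevyMeasure S Prob ν) (hν_inf : ν (Ioi 0) = ∞)
    (hP : IsContractionSemigroup P) (hA : IsInfinitesimalGenerator A P)
    (hsym : IsSymmetricGenerator A) (hd : IsSource T₀ d) {φ ψ : H}
    (hφψ : (φ, ψ) ∈ A.graph) (T : ℝ) :
    ∫ y, inner ℝ (potential P S Prob d (T - y)) φ ∂tailMeasure ν
      = (∫ x in Ioi (0 : ℝ), inner ℝ (d (T - x)) φ)
        + ∫ y in Ioi (0 : ℝ), inner ℝ (potential P S Prob d (T - y)) ψ := by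
  obtain ⟨C, hC⟩ := hd.exists_abs_pairing_le hP φ
  obtain ⟨C', hC'⟩ := hd.exists_abs_pairing_le hP ψ
  have hmφ := hd.measurable_pairing hP φ
  have hmψ := hd.measurable_pairing hP ψ
  have h0 : ∀ (φ : H) (s r : ℝ), s ≤ 0 → inner ℝ (d s) (P (max r 0) φ) = 0 := by
    intro φ s r hs
    rw [hd.zero_of_nonpos hs, inner_zero_left]
  simp only [hS.inner_potential hν hν_inf hP hA hsym hd]
  rw [hS.integral_tailMeasure_eq hν hν_inf T hmφ hC (h0 φ)]
  have h1 : ∀ x, ∫ ω, inner ℝ (d (T - x)) (P (max (inverseSubordinator S x ω) 0) φ) ∂Prob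
      = inner ℝ (d (T - x)) φ + ∫ q, {q : Ω × ℝ | S q.2 q.1 < x}.indicator
          (fun q => inner ℝ (d (T - x)) (P (max q.2 0) ψ)) q ∂clockMeasure Prob := by
    intro x
    rw [← hS.integral_inner_inverseSubordinator hν hν_inf hP hA hφψ]
    simp only [max_eq_left (inverseSubordinator_nonneg S x _)]
  simp only [h1]
  have hθ : volume.restrict (Ioi (0 : ℝ)) (Iio T) < ∞ := by
    rw [Measure.restrict_apply measurableSet_Iio, inter_comm, Ioi_inter_Iio, Real.volume_Ioo]
    exact ENNReal.ofReal_lt_top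
  have hθ0 : volume.restrict (Ioi (0 : ℝ)) (Iic 0) = 0 := by
    rw [Measure.restrict_apply measurableSet_Iic, Iic_inter_Ioi, Ioc_self, measure_empty]
  set F : ℝ × Ω × ℝ → ℝ := {q : ℝ × Ω × ℝ | S q.2.2 q.2.1 < q.1}.indicator
    (fun q => inner ℝ (d (T - q.1)) (P (max q.2.2 0) ψ)) with hF
  have hFm : Measurable F := by
    refine Measurable.indicator ?_
      (measurableSet_lt (hS.measurable_swap.comp measurable_snd) measurable_fst)
    exact hmψ.comp ((measurable_const.sub measurable_fst).prodMk
      (measurable_snd.comp measurable_snd))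
  have hFi : Integrable F ((volume.restrict (Ioi (0 : ℝ))).prod (clockMeasure Prob)) := by
    refine hS.integrable_prod_clockMeasure hν hν_inf hθ (C := C') hFm.aestronglyMeasurable
      (fun q => ?_) (ae_of_all _ fun q hq => ?_)
    · exact (norm_indicator_le_norm_self _ _).trans (hC' (T - q.1, q.2.2))
    · simp only [hF, indicator_apply_eq_zero]
      intro hq'
      have hq'' : S q.2.2 q.2.1 < q.1 := hq'
      refine h0 ψ _ _ ?_
      rcases hq with hq | hq <;> linarith
  have hFeq : ∀ x, ∫ q, {q : Ω × ℝ | S q.2 q.1 < x}.indicator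
      (fun q => inner ℝ (d (T - x)) (P (max q.2 0) ψ)) q ∂clockMeasure Prob
      = ∫ q, F (x, q) ∂clockMeasure Prob := fun x => rfl
  simp only [hFeq]
  have hdi : Integrable (fun x => (inner ℝ (d (T - x)) φ : ℝ)) (volume.restrict (Ioi 0)) := by
    have hm : Measurable fun x => (inner ℝ (d (T - x)) φ : ℝ) :=
      ((hd.stronglyMeasurable.comp_measurable (measurable_const.sub measurable_id)).inner
        stronglyMeasurable_const).measurable
    obtain ⟨K, hK⟩ := hd.bounded
    refine Integrable.mono' (g := (Iio T).indicator fun _ => K * ‖φ‖) ?_ hm.aestronglyMeasurable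
      (ae_of_all _ fun x => ?_)
    · exact (integrable_indicator_iff measurableSet_Iio).2 (integrableOn_const hθ.ne)
    · by_cases hx : x < T
      · rw [indicator_of_mem (mem_Iio.2 hx)]
        exact (abs_real_inner_le_norm _ _).trans
          (mul_le_mul_of_nonneg_right (hK _) (norm_nonneg _))
      · rw [indicator_of_notMem (fun h => hx (mem_Iio.1 h)),
          hd.zero_of_nonpos (by linarith), inner_zero_left, norm_zero]
  rw [integral_add hdi hFi.integral_prod_left]
  congr 1
  rw [hS.integral_integral_swap hν hν_inf hθ0 hθ hmψ hC' (h0 ψ),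
    MeasureTheory.integral_integral_swap (f := fun x q => F (x, q)) hFi]
  refine integral_congr_ae (ae_of_all _ fun q => ?_)
  simp only
  -- The substitution `x = y + S_r`.
  have h2 : ∀ x, F (x, q) = (Ioi (S q.2 q.1)).indicator
      (fun x => inner ℝ (d (T - x)) (P (max q.2 0) ψ)) x := fun x => rfl
  simp only [h2]
  rw [setIntegral_indicator measurableSet_Ioi, Ioi_inter_Ioi, max_eq_right (hS.nonneg _ _),
    ← integral_indicator measurableSet_Ioi, ← integral_indicator measurableSet_Ioi,
    ← integral_add_right_eq_self _ (S q.2 q.1)]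
  refine integral_congr_ae (ae_of_all _ fun y => ?_)
  simp only [indicator, mem_Ioi]
  by_cases hy : 0 < y
  · rw [if_pos hy, if_pos (by linarith), sub_sub, add_comm y]
  · rw [if_neg hy, if_neg (by linarith)]

/-- The weak equation for `t ↦ 𝔼 P_{E_t} g`. -/
theorem stoppedMean_weak_equation (hS : IsRegularSubordinator S Prob)
    (hν : IsDriftlessLevyMeasure S Prob ν) (hν_inf : ν (Ioi 0) = ∞)
    (hP : IsContractionSemigroup P) (hA : IsInfinitesimalGenerator A P)
    (hsym : IsSymmetricGenerator A) (g : H) {φ ψ : H}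
    (hφψ : (φ, ψ) ∈ A.graph) {T : ℝ} (hT : 0 ≤ T) :
    ∫ y, (Ioi (0 : ℝ)).indicator
        (fun t => (inner ℝ (stoppedMean P S Prob g t - g) φ : ℝ)) (T - y) ∂tailMeasure ν
      = ∫ s in (0 : ℝ)..T, inner ℝ (stoppedMean P S Prob g s) ψ := by
  set h : ℝ × ℝ → ℝ := (Ioi (0 : ℝ) ×ˢ univ).indicator
    (fun q => inner ℝ g (P (max q.2 0) ψ)) with hh
  have hm : Measurable h := by
    refine Measurable.indicator ?_ (measurableSet_Ioi.prod .univ)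
    exact ((continuous_const.inner (hP.continuous_orbit ψ)).measurable).comp measurable_snd
  have hC : ∀ q, |h q| ≤ ‖g‖ * ‖ψ‖ := fun q => show ‖h q‖ ≤ _ from
    (norm_indicator_le_norm_self _ _).trans ((abs_real_inner_le_norm _ _).trans
      (mul_le_mul_of_nonneg_left (hP.norm_apply_le (le_max_right _ _) ψ) (norm_nonneg _)))
  have h0 : ∀ s r, s ≤ 0 → h (s, r) = 0 := by
    intro s r hs
    refine indicator_of_notMem (fun h' => ?_) _
    exact absurd h'.1 (not_lt.2 hs)
  have hmain := hS.integral_tailMeasure_eq hν hν_inf T hm hC h0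
  have hcomm : ∀ (x : ℝ) (ω : Ω) (χ : H), inner ℝ g (P (inverseSubordinator S x ω) χ)
      = inner ℝ (P (inverseSubordinator S x ω) g) χ := fun x ω χ =>
    (inner_apply_comm hP hA hsym (inverseSubordinator_nonneg S x ω) g χ).symm
  have hl : ∀ y, (Ioi (0 : ℝ)).indicator
        (fun t => (inner ℝ (stoppedMean P S Prob g t - g) φ : ℝ)) (T - y)
      = ∫ q, h (T - y - S q.2 q.1, q.2) ∂clockMeasure Prob := by
    intro y
    by_cases hy : 0 < T - y
    · rw [indicator_of_mem (mem_Ioi.2 hy), inner_sub_left, hS.inner_stoppedMean hP]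
      simp only [← hcomm]
      rw [hS.integral_inner_inverseSubordinator hν hν_inf hP hA hφψ, add_sub_cancel_left]
      refine integral_congr_ae (ae_of_all _ fun q => ?_)
      simp only [hh, indicator, mem_prod, mem_Ioi, mem_univ, and_true, mem_ofPred_eq, sub_pos]
    · rw [indicator_of_notMem (fun h' => hy (mem_Ioi.1 h'))]
      symm
      refine integral_eq_zero_of_ae (ae_of_all _ fun q => ?_)
      have := hS.nonneg q.2 q.1
      exact h0 _ _ (by linarith)
  simp only [hl]
  rw [hmain, intervalIntegral.integral_of_le hT, integral_Ioc_eq_integral_Ioo]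
  have hr : ∀ x, ∫ ω, h (T - x, inverseSubordinator S x ω) ∂Prob
      = (Iio T).indicator (fun x => (inner ℝ (stoppedMean P S Prob g x) ψ : ℝ)) x := by
    intro x
    by_cases hx : x < T
    · rw [indicator_of_mem (mem_Iio.2 hx), hS.inner_stoppedMean hP]
      refine integral_congr_ae (ae_of_all _ fun ω => ?_)
      simp only [hh]
      rw [indicator_of_mem (mk_mem_prod (mem_Ioi.2 (sub_pos.2 hx)) (mem_univ _)), ← hcomm,
        max_eq_left (inverseSubordinator_nonneg S x ω)]
    · rw [indicator_of_notMem (fun h' => hx (mem_Iio.1 h'))]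
      refine integral_eq_zero_of_ae (ae_of_all _ fun ω => ?_)
      exact h0 _ _ (by linarith)
  simp only [hr]
  rw [setIntegral_indicator measurableSet_Iio, Ioi_inter_Iio]

/-- A source that solves the homogeneous equation has vanishing integrals. The equation tested with
`P_r φ` and integrated over the clock measure says that the last two convolutions in the weak
equation of its potential agree. -/
theorem integral_eq_zero_of_homogeneous (hS : IsRegularSubordinator S Prob)
    (hν : IsDriftlessLevyMeasure S Prob ν) (hν_inf : ν (Ioi 0) = ∞)
    (hP : IsContractionSemigroup P) (hA : IsInfinitesimalGenerator A P)
    (hsym : IsSymmetricGenerator A) (hd : IsSource T₀ d)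
    (hom : ∀ T ≤ T₀, ∀ φ ψ, (φ, ψ) ∈ A.graph →
      ∫ y, inner ℝ (d (T - y)) φ ∂tailMeasure ν = ∫ y in Ioi (0 : ℝ), inner ℝ (d (T - y)) ψ)
    {φ ψ : H} (hφψ : (φ, ψ) ∈ A.graph) {T : ℝ} (hT : T ≤ T₀) :
    ∫ x in Ioi (0 : ℝ), inner ℝ (d (T - x)) φ = 0 := by
  have h := hS.potential_weak_equation hν hν_inf hP hA hsym hd hφψ T
  obtain ⟨C, hC⟩ := hd.exists_abs_pairing_le hP φ
  obtain ⟨C', hC'⟩ := hd.exists_abs_pairing_le hP ψ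
  have hmφ := hd.measurable_pairing hP φ
  have hmψ := hd.measurable_pairing hP ψ
  have h0 : ∀ (φ : H) (s r : ℝ), s ≤ 0 → inner ℝ (d s) (P (max r 0) φ) = 0 := by
    intro φ s r hs
    rw [hd.zero_of_nonpos hs, inner_zero_left]
  have hθ : volume.restrict (Ioi (0 : ℝ)) (Iio T) < ∞ := by
    rw [Measure.restrict_apply measurableSet_Iio, inter_comm, Ioi_inter_Iio, Real.volume_Ioo]
    exact ENNReal.ofReal_lt_top
  have hθ0 : volume.restrict (Ioi (0 : ℝ)) (Iic 0) = 0 := by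
    rw [Measure.restrict_apply measurableSet_Iic, Iic_inter_Ioi, Ioc_self, measure_empty]
  simp only [hS.inner_potential hν hν_inf hP hA hsym hd] at h
  rw [hS.integral_integral_swap hν hν_inf (tailMeasure_Iic ν) (tailMeasure_Iio_lt_top hν T) hmφ hC
    (h0 φ), hS.integral_integral_swap hν hν_inf hθ0 hθ hmψ hC' (h0 ψ)] at h
  have h1 : ∀ q : Ω × ℝ, ∫ y, inner ℝ (d (T - S q.2 q.1 - y)) (P (max q.2 0) φ) ∂tailMeasure ν
      = ∫ y in Ioi (0 : ℝ), inner ℝ (d (T - S q.2 q.1 - y)) (P (max q.2 0) ψ) := by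
    intro q
    have := hS.nonneg q.2 q.1
    exact hom _ (by linarith) _ _ (apply_mem_graph hP hA hφψ (le_max_right _ _))
  simp only [h1] at h
  linarith

end IsRegularSubordinator

end WeakEquation

end TimeFractional

/-! ### Continuity in time -/

namespace TimeFractional

/-- The mean of an integrable function along the translates of a random variable with bounded
density is continuous: a uniform limit of the same means of continuous functions with compact
support. -/
theorem continuous_integral_sub {Ω X : Type*} [MeasurableSpace Ω] {Prob : Measure Ω}
    [IsProbabilityMeasure Prob] [NormedAddCommGroup X] [NormedSpace ℝ X] {Y : Ω → ℝ}
    (hY : Measurable Y) {C : ℝ≥0} (hYC : Prob.map Y ≤ C • (volume : Measure ℝ)) {d : ℝ → X}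
    (hd : StronglyMeasurable d) (hdi : Integrable d) {K : ℝ} (hK : ∀ t, ‖d t‖ ≤ K) :
    Continuous fun t => ∫ ω, d (t - Y ω) ∂Prob := by
  refine continuous_of_uniform_approx_of_continuous fun u hu => ?_
  obtain ⟨ε, hε, hεu⟩ := Metric.mem_uniformity_dist.1 hu
  obtain ⟨c, hc1, hc2, hc3, hc4⟩ := hdi.exists_hasCompactSupport_integral_sub_le
    (show 0 < ε / (2 * (C + 1)) by positivity)
  obtain ⟨M, hM⟩ := hc1.exists_bound_of_continuous hc3
  have hcm : ∀ t, AEStronglyMeasurable (fun ω => c (t - Y ω)) Prob := fun t =>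
    (hc3.stronglyMeasurable.comp_measurable (hY.const_sub t)).aestronglyMeasurable
  refine ⟨fun t => ∫ ω, c (t - Y ω) ∂Prob, ?_, fun t => hεu ?_⟩
  · refine continuous_of_dominated hcm (bound := fun _ => M)
      (fun t => ae_of_all _ fun ω => hM _) (integrable_const _) (ae_of_all _ fun ω => ?_)
    fun_prop
  · have hdm : StronglyMeasurable fun ω => d (t - Y ω) := hd.comp_measurable (hY.const_sub t)
    rw [dist_eq_norm, ← integral_sub (Integrable.of_bound hdm.aestronglyMeasurable K
      (ae_of_all _ fun ω => hK _)) (Integrable.of_bound (hcm t) M (ae_of_all _ fun ω => hM _))]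
    have hdc : Integrable (fun x => ‖d x - c x‖) := (hdi.sub hc4).norm
    have hdct : Integrable (fun x => ‖d (t - x) - c (t - x)‖) := hdc.comp_sub_left t
    have hsm : AEStronglyMeasurable (fun x => ‖d (t - x) - c (t - x)‖) (Prob.map Y) := by
      refine StronglyMeasurable.aestronglyMeasurable ?_
      exact ((hd.comp_measurable (measurable_id.const_sub t)).sub
        (hc3.stronglyMeasurable.comp_measurable (measurable_id.const_sub t))).norm
    calc ‖∫ ω, (d (t - Y ω) - c (t - Y ω)) ∂Prob‖
        ≤ ∫ ω, ‖d (t - Y ω) - c (t - Y ω)‖ ∂Prob := norm_integral_le_integral_norm _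
      _ = ∫ x, ‖d (t - x) - c (t - x)‖ ∂Prob.map Y :=
          (integral_map hY.aemeasurable hsm).symm
      _ ≤ ∫ x, ‖d (t - x) - c (t - x)‖ ∂(C • (volume : Measure ℝ)) :=
          integral_mono_measure hYC (ae_of_all _ fun x => norm_nonneg _)
            (hdct.smul_measure_nnreal)
      _ = C * ∫ x, ‖d x - c x‖ := by
          rw [integral_smul_nnreal_measure, integral_sub_left_eq_self (fun x => ‖d x - c x‖)]
          rfl
      _ ≤ C * (ε / (2 * (C + 1))) := mul_le_mul_of_nonneg_left hc2 C.2
      _ < ε := by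
          rw [mul_div_assoc', div_lt_iff₀ (by positivity)]
          nlinarith [C.2]

section

variable {Ω : Type*} [MeasurableSpace Ω] {Prob : Measure Ω} {S : ℝ → Ω → ℝ} {ν : Measure ℝ}
  {H : Type*} [NormedAddCommGroup H] [InnerProductSpace ℝ H]
  {P : ℝ → H →L[ℝ] H} {A : H →ₗ.[ℝ] H} {T₀ : ℝ} {d : ℝ → H}

omit [InnerProductSpace ℝ H] in
theorem IsSource.integrable (hd : IsSource T₀ d) : Integrable d := by
  obtain ⟨C, hC⟩ := hd.bounded
  have h : IntegrableOn d (Ioc 0 T₀) :=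
    Measure.integrableOn_of_bounded (M := C) measure_Ioc_lt_top.ne
      hd.stronglyMeasurable.aestronglyMeasurable (ae_of_all _ hC)
  exact integrableOn_iff_integrable_of_support_subset
    (fun t ht => by_contra fun h' => ht (hd.zero t h')) |>.1 h

namespace IsRegularSubordinator

variable [IsProbabilityMeasure Prob]

theorem continuous_stoppedMean (hS : IsRegularSubordinator S Prob)
    (hP : IsContractionSemigroup P) (g : H) : Continuous (stoppedMean P S Prob g) := by
  rw [continuous_iff_continuousAt]
  intro t
  refine tendsto_integral_filter_of_dominated_convergence (fun _ => ‖g‖)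
    (Eventually.of_forall fun s => (hS.integrable_stoppedMean hP g s).aestronglyMeasurable)
    (Eventually.of_forall fun s => ae_of_all _ fun ω =>
      hP.norm_apply_le (inverseSubordinator_nonneg S s ω) g) (integrable_const _) ?_
  filter_upwards [hS.ae_continuousAt_inverseSubordinator t] with ω hω
  have h := ((hP.continuous_orbit g).tendsto _).comp hω
  simpa only [Function.comp_def, max_eq_left (inverseSubordinator_nonneg S _ ω)] using h

theorem stoppedMean_zero (hS : IsRegularSubordinator S Prob) [CompleteSpace H]
    (hP : IsContractionSemigroup P) (g : H) : stoppedMean P S Prob g 0 = g := by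
  have h : (fun ω => P (inverseSubordinator S 0 ω) g) =ᵐ[Prob] fun _ => g := by
    filter_upwards [hS.ae_inverseSubordinator_zero] with ω hω
    rw [hω, hP.zero_apply]
  rw [stoppedMean, integral_congr_ae h]
  simp

theorem continuous_potential (hS : IsRegularSubordinator S Prob) [CompleteSpace H]
    (hν : IsDriftlessLevyMeasure S Prob ν) (hν_inf : ν (Ioi 0) = ∞)
    (hP : IsContractionSemigroup P) (hd : IsSource T₀ d) :
    Continuous (potential P S Prob d) := by
  obtain ⟨C, hC⟩ := hd.bounded
  have h1 : ∀ t, potential P S Prob d t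
      = ∫ r in Ioi (0 : ℝ), ∫ ω, P (max r 0) (d (t - S r ω)) ∂Prob := fun t =>
    integral_prod_symm _ (hS.integrable_potential hν hν_inf hP hd t)
  have hC0 : 0 ≤ C := (norm_nonneg _).trans (hC 0)
  rw [continuous_iff_continuousAt]
  intro t₀
  rw [show potential P S Prob d = _ from funext h1]
  have hm : MeasurableSet {q : Ω × ℝ | S q.2 q.1 ≤ t₀ + 1} :=
    measurableSet_le hS.measurable_swap measurable_const
  set b : Ω × ℝ → ℝ := {q : Ω × ℝ | S q.2 q.1 ≤ t₀ + 1}.indicator fun _ => C with hb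
  have hbi : Integrable b (clockMeasure Prob) :=
    (integrable_indicator_iff hm).2
      (integrableOn_const (hS.clockMeasure_le_lt_top hν hν_inf (t₀ + 1)).ne)
  have hbr : ∀ r, Integrable (fun ω => b (ω, r)) Prob := fun r => by
    refine Integrable.of_bound (C := C) ?_ (ae_of_all _ fun ω => ?_)
    · exact ((measurable_const.indicator hm).comp
        (measurable_id.prodMk measurable_const)).aestronglyMeasurable
    · refine (norm_indicator_le_norm_self _ _).trans ?_
      rw [Real.norm_of_nonneg hC0]
  refine continuousAt_of_dominated (bound := fun r => ∫ ω, b (ω, r) ∂Prob)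
    (Eventually.of_forall fun t => ?_) ?_ hbi.integral_prod_right ?_
  · exact (hS.integrable_potential hν hν_inf hP hd t).integral_prod_right.aestronglyMeasurable
  · filter_upwards [Iio_mem_nhds (lt_add_one t₀)] with t ht
    refine ae_of_all _ fun r => norm_integral_le_of_norm_le (hbr r) (ae_of_all _ fun ω => ?_)
    simp only [hb]
    by_cases hq : S r ω ≤ t₀ + 1
    · rw [indicator_of_mem (show (ω, r) ∈ {q : Ω × ℝ | S q.2 q.1 ≤ t₀ + 1} from hq)]
      exact (hP.norm_apply_le (le_max_right _ _) _).trans (hC _)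
    · have ht' : t < t₀ + 1 := ht
      rw [hd.zero_of_nonpos (by linarith), map_zero, norm_zero]
      exact indicator_nonneg (fun _ _ => hC0) _
  · filter_upwards [ae_restrict_mem measurableSet_Ioi] with r hr
    obtain ⟨M, hM⟩ := hS.map_le r hr
    have h2 : ∀ t, ∫ ω, P (max r 0) (d (t - S r ω)) ∂Prob
        = P (max r 0) (∫ ω, d (t - S r ω) ∂Prob) := fun t => by
      refine (P (max r 0)).integral_comp_comm ?_
      exact Integrable.of_bound (hd.stronglyMeasurable.comp_measurable
        ((hS.measurable_apply r).const_sub t)).aestronglyMeasurable C (ae_of_all _ fun ω => hC _)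
    simp only [h2]
    exact ((P (max r 0)).continuous.comp (continuous_integral_sub (hS.measurable_apply r) hM
      hd.stronglyMeasurable hd.integrable hC)).continuousAt

/-! ### Regularity in space -/

variable [CompleteSpace H]

theorem stoppedMean_mem_graph_of_mem_graph (hS : IsRegularSubordinator S Prob)
    (hP : IsContractionSemigroup P) (hA : IsInfinitesimalGenerator A P)
    (hsym : IsSymmetricGenerator A) {g h : H} (hgh : (g, h) ∈ A.graph) (t : ℝ) :
    (stoppedMean P S Prob g t, stoppedMean P S Prob h t) ∈ A.graph := by
  refine mem_graph_of_forall_inner hP hA hsym fun φ ψ hφψ => ?_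
  rw [hS.inner_stoppedMean hP, hS.inner_stoppedMean hP]
  refine integral_congr_ae (ae_of_all _ fun ω => ?_)
  exact (hsym (apply_mem_graph hP hA hgh (inverseSubordinator_nonneg S t ω)) hφψ).symm

theorem potential_mem_graph (hS : IsRegularSubordinator S Prob)
    (hν : IsDriftlessLevyMeasure S Prob ν) (hν_inf : ν (Ioi 0) = ∞)
    (hP : IsContractionSemigroup P) (hA : IsInfinitesimalGenerator A P)
    (hsym : IsSymmetricGenerator A) {e : ℝ → H} (hd : IsSource T₀ d) (he : IsSource T₀ e)
    (hde : ∀ t, (d t, e t) ∈ A.graph) (t : ℝ) :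
    (potential P S Prob d t, potential P S Prob e t) ∈ A.graph := by
  refine mem_graph_of_forall_inner hP hA hsym fun φ ψ hφψ => ?_
  rw [hS.inner_potential hν hν_inf hP hA hsym hd, hS.inner_potential hν hν_inf hP hA hsym he]
  refine integral_congr_ae (ae_of_all _ fun q => ?_)
  exact (hsym (hde _) (apply_mem_graph hP hA hφψ (le_max_right _ _))).symm

omit [CompleteSpace H] [IsProbabilityMeasure Prob] in
theorem laplaceExponent_div_nonneg (hν : IsDriftlessLevyMeasure S Prob ν) {t : ℝ} (ht : 0 < t) :
    0 ≤ laplaceExponent ν 1 / (1 - Real.exp (-t)) := by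
  have h3 : 0 ≤ laplaceExponent ν 1 := by
    refine integral_nonneg_of_ae ?_
    filter_upwards [hν.ae_pos] with x hx
    have : Real.exp (-(1 * x)) ≤ 1 := Real.exp_le_one_iff.2 (by linarith)
    simp only [Pi.zero_apply]
    linarith
  have h4 : 0 ≤ 1 - Real.exp (-t) := by
    have : Real.exp (-t) ≤ 1 := Real.exp_le_one_iff.2 (by linarith)
    linarith
  exact div_nonneg h3 h4

/-- An orbit of `h = A g`, paired with `φ`, is bounded in terms of `g` up to an integral of the
derivative `⟨P_s h, A φ⟩` between `r` and `1`, since `‖P_1 h‖ ≤ ‖g‖`. -/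
theorem abs_inner_apply_le (hP : IsContractionSemigroup P) (hA : IsInfinitesimalGenerator A P)
    (hsym : IsSymmetricGenerator A) {g h φ ψ : H} (hgh : (g, h) ∈ A.graph)
    (hφψ : (φ, ψ) ∈ A.graph) {r : ℝ} (hr : 0 ≤ r) :
    |inner ℝ (P r h) φ| ≤ ‖g‖ * ‖φ‖
      + ∫ s in (0 : ℝ)..1, (Ioi r).indicator (fun s => |inner ℝ (P (max s 0) h) ψ|) s := by
  have hc : Continuous fun s => |(inner ℝ (P (max s 0) h) ψ : ℝ)| :=
    ((hP.continuous_orbit h).inner continuous_const).abs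
  have hnn : 0 ≤ ∫ s in (0 : ℝ)..1, (Ioi r).indicator
      (fun s => |inner ℝ (P (max s 0) h) ψ|) s :=
    intervalIntegral.integral_nonneg zero_le_one fun s _ =>
      indicator_nonneg (fun _ _ => abs_nonneg _) _
  rcases le_total 1 r with h1 | h1
  · have h2 := mul_norm_apply_le hP hA hsym hgh hr
    have h3 : ‖P r h‖ ≤ ‖g‖ := by nlinarith [norm_nonneg (P r h)]
    have h4 := (abs_real_inner_le_norm (P r h) φ).trans
      (mul_le_mul_of_nonneg_right h3 (norm_nonneg φ))
    linarith
  · have h2 := mul_norm_apply_le hP hA hsym hgh zero_le_one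
    rw [one_mul] at h2
    have h4 := (abs_real_inner_le_norm (P 1 h) φ).trans
      (mul_le_mul_of_nonneg_right h2 (norm_nonneg φ))
    have h5 : inner ℝ (P 1 h) φ - inner ℝ (P r h) φ = ∫ s in r..1, inner ℝ (P (max s 0) h) ψ := by
      rw [hsym (apply_mem_graph hP hA hgh zero_le_one) hφψ,
        hsym (apply_mem_graph hP hA hgh hr) hφψ, ← inner_sub_left,
        ← apply_sub_eq_integral hP hA hgh hr zero_le_one, real_inner_comm]
      rw [← innerSL_apply_apply ℝ, ← (innerSL ℝ ψ).intervalIntegral_comp_comm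
        (hP.intervalIntegrable_orbit h hr zero_le_one)]
      refine intervalIntegral.integral_congr fun s hs => ?_
      rw [uIcc_of_le h1] at hs
      simp only [innerSL_apply_apply, max_eq_left (hr.trans hs.1)]
      exact real_inner_comm _ _
    have h6 : |inner ℝ (P 1 h) φ - inner ℝ (P r h) φ|
        ≤ ∫ s in (0 : ℝ)..1, (Ioi r).indicator (fun s => |inner ℝ (P (max s 0) h) ψ|) s := by
      rw [h5]
      refine (intervalIntegral.abs_integral_le_integral_abs h1).trans ?_
      have hset : Ioc 0 1 ∩ Ioi r = Ioc r 1 := by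
        ext s
        simp only [mem_Ioc, mem_inter_iff, mem_Ioi]
        constructor
        · exact fun hs => ⟨hs.2, hs.1.2⟩
        · exact fun hs => ⟨⟨hr.trans_lt hs.1, hs.2⟩, hs.1⟩
      rw [intervalIntegral.integral_of_le h1, intervalIntegral.integral_of_le zero_le_one,
        setIntegral_indicator measurableSet_Ioi, hset]
    have h7 := abs_sub_abs_le_abs_sub (inner ℝ (P r h) φ) (inner ℝ (P 1 h) φ)
    rw [abs_sub_comm] at h7
    linarith

/-- The quadratic form of the estimate `‖A 𝔼 P_{E_t} g‖ ≤ C ‖g‖`. Since `P(E_t < s) ≤ C_t s`, it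
follows from the square function estimate. -/
theorem abs_inner_stoppedMean_le_sq (hS : IsRegularSubordinator S Prob)
    (hν : IsDriftlessLevyMeasure S Prob ν)
    (hP : IsContractionSemigroup P) (hA : IsInfinitesimalGenerator A P)
    (hsym : IsSymmetricGenerator A) {g h φ ψ : H} (hgh : (g, h) ∈ A.graph)
    (hφψ : (φ, ψ) ∈ A.graph) {t : ℝ} (ht : 0 < t) :
    |inner ℝ (stoppedMean P S Prob h t) φ| ≤ ‖g‖ * ‖φ‖
      + laplaceExponent ν 1 / (1 - Real.exp (-t)) * ((‖g‖ ^ 2 + ‖φ‖ ^ 2) / 2) := by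
  set c := laplaceExponent ν 1 / (1 - Real.exp (-t)) with hc
  have hc1 : 0 ≤ c := laplaceExponent_div_nonneg hν ht
  set κ : ℝ → ℝ := fun s => |(inner ℝ (P (max s 0) h) ψ : ℝ)| with hκ
  have hκc : Continuous κ := ((hP.continuous_orbit h).inner continuous_const).abs
  set F : Ω × ℝ → ℝ := {q : Ω × ℝ | inverseSubordinator S t q.1 < q.2}.indicator
    fun q => κ q.2 with hF
  have hms : MeasurableSet {q : Ω × ℝ | inverseSubordinator S t q.1 < q.2} :=
    measurableSet_lt ((hS.measurable_inverseSubordinator_apply t).comp measurable_fst)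
      measurable_snd
  have hFm : Measurable F := (hκc.measurable.comp measurable_snd).indicator hms
  have hFi : Integrable F (Prob.prod (volume.restrict (Ioc 0 1))) := by
    refine Integrable.of_bound (C := ‖h‖ * ‖ψ‖) hFm.aestronglyMeasurable (ae_of_all _ fun q => ?_)
    refine (norm_indicator_le_norm_self _ _).trans ?_
    simp only [hκ, Real.norm_eq_abs, abs_abs]
    exact (abs_real_inner_le_norm _ _).trans
      (mul_le_mul_of_nonneg_right (hP.norm_apply_le (le_max_right _ _) h) (norm_nonneg _))
  have h1 : |inner ℝ (stoppedMean P S Prob h t) φ|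
      ≤ ‖g‖ * ‖φ‖ + ∫ ω, (∫ s in Ioc (0 : ℝ) 1, F (ω, s)) ∂Prob := by
    rw [hS.inner_stoppedMean hP]
    have hle : ∀ ω, ‖(inner ℝ (P (inverseSubordinator S t ω) h) φ : ℝ)‖
        ≤ ‖g‖ * ‖φ‖ + ∫ s in Ioc (0 : ℝ) 1, F (ω, s) := by
      intro ω
      have := abs_inner_apply_le hP hA hsym hgh hφψ (inverseSubordinator_nonneg S t ω)
      rwa [intervalIntegral.integral_of_le zero_le_one] at this
    have hi : Integrable (fun ω => ‖g‖ * ‖φ‖ + ∫ s in Ioc (0 : ℝ) 1, F (ω, s)) Prob :=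
      (integrable_const _).add hFi.integral_prod_left
    refine (norm_integral_le_of_norm_le hi (ae_of_all _ hle)).trans (le_of_eq ?_)
    rw [integral_add (integrable_const _) hFi.integral_prod_left]
    simp
  refine h1.trans (add_le_add_right ?_ _)
  rw [← integral_prod _ hFi, integral_prod_symm _ hFi]
  set a : ℝ → ℝ := fun s => (‖P (max (s / 2) 0) h‖ ^ 2 + ‖P (max (s / 2) 0) ψ‖ ^ 2) / 2 with ha
  have hac : Continuous a := by
    have e1 := ((hP.continuous_orbit h).comp (continuous_id.div_const 2)).norm.pow 2
    have e2 := ((hP.continuous_orbit ψ).comp (continuous_id.div_const 2)).norm.pow 2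
    exact (e1.add e2).div_const 2
  have hκa : ∀ s, 0 ≤ s → κ s ≤ a s := by
    intro s hs
    have hs2 : 0 ≤ s / 2 := by linarith
    simp only [hκ, ha, max_eq_left hs, max_eq_left hs2]
    have e1 : inner ℝ (P s h) ψ = inner ℝ (P (s / 2) h) (P (s / 2) ψ) := by
      rw [← inner_apply_comm hP hA hsym hs2, ← hP.add_apply hs2 hs2, add_halves]
    rw [e1]
    refine (abs_real_inner_le_norm _ _).trans ?_
    nlinarith [sq_nonneg (‖P (s / 2) h‖ - ‖P (s / 2) ψ‖)]
  have hbound : ∀ s ∈ Ioc (0 : ℝ) 1, ∫ ω, F (ω, s) ∂Prob ≤ c * (s * a s) := by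
    intro s hs
    have e1 : ∫ ω, F (ω, s) ∂Prob = Prob.real {ω | inverseSubordinator S t ω < s} * κ s := by
      have : (fun ω => F (ω, s)) = {ω | inverseSubordinator S t ω < s}.indicator fun _ => κ s := by
        ext ω
        simp only [hF, indicator, mem_ofPred_eq]
      rw [this, integral_indicator_const _ (measurableSet_lt
        (hS.measurable_inverseSubordinator_apply t) measurable_const), smul_eq_mul]
    have hc0 : 0 ≤ c * s := mul_nonneg hc1 hs.1.le
    have e2 : Prob.real {ω | inverseSubordinator S t ω < s} ≤ c * s := by
      refine ENNReal.toReal_le_of_le_ofReal hc0 ?_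
      exact (measure_mono fun ω hω => hS.lt_of_inverseSubordinator_lt hω).trans
        (hS.measure_lt_le hν hs.1.le ht)
    rw [e1, ← mul_assoc]
    exact mul_le_mul e2 (hκa s hs.1.le) (abs_nonneg _) hc0
  have hint : IntegrableOn (fun s => c * (s * a s)) (Ioc 0 1) :=
    (Continuous.integrableOn_Icc (by fun_prop)).mono_set Ioc_subset_Icc_self
  refine (setIntegral_mono_on hFi.integral_prod_right hint measurableSet_Ioc hbound).trans ?_
  rw [integral_const_mul, ← intervalIntegral.integral_of_le zero_le_one]
  refine mul_le_mul_of_nonneg_left ?_ hc1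
  -- The substitution `s = 2 σ`.
  have e3 : ∫ s in (0 : ℝ)..1, s * a s = 2 * ∫ σ in (0 : ℝ)..1 / 2, (2 * σ) * a (2 * σ) := by
    have := intervalIntegral.smul_integral_comp_mul_left (a := 0) (b := 1 / 2)
      (fun s => s * a s) 2
    rw [smul_eq_mul] at this
    rw [this]
    norm_num
  have e4 : ∫ σ in (0 : ℝ)..1 / 2, (2 * σ) * a (2 * σ)
      = ((∫ σ in (0 : ℝ)..1 / 2, 4 * σ * ‖P σ h‖ ^ 2)
        + ∫ σ in (0 : ℝ)..1 / 2, 4 * σ * ‖P σ ψ‖ ^ 2) / 4 := by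
    have hi : ∀ v : H, IntervalIntegrable (fun σ => 4 * σ * ‖P σ v‖ ^ 2) volume 0 (1 / 2) := by
      intro v
      refine ContinuousOn.intervalIntegrable ?_
      have h1 : ContinuousOn (fun s : ℝ => P s v) (uIcc 0 (1 / 2)) :=
        (hP.continuousOn_orbit v).mono fun x hx => by
          rw [uIcc_of_le (by norm_num)] at hx; exact hx.1
      fun_prop
    rw [← intervalIntegral.integral_add (hi h) (hi ψ), ← intervalIntegral.integral_div]
    refine intervalIntegral.integral_congr fun σ hσ => ?_
    rw [uIcc_of_le (by norm_num)] at hσ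
    simp only [ha, mul_div_cancel_left₀ σ (two_ne_zero (α := ℝ)), max_eq_left hσ.1]
    ring
  have e5 := integral_mul_norm_sq_le hP hA hsym hgh (show (0 : ℝ) ≤ 1 / 2 by norm_num)
  have e6 := integral_mul_norm_sq_le hP hA hsym hφψ (show (0 : ℝ) ≤ 1 / 2 by norm_num)
  rw [e3, e4]
  linarith

theorem norm_stoppedMean_le_of_mem_graph (hS : IsRegularSubordinator S Prob)
    (hν : IsDriftlessLevyMeasure S Prob ν)
    (hP : IsContractionSemigroup P) (hA : IsInfinitesimalGenerator A P)
    (hsym : IsSymmetricGenerator A) {g h : H} (hgh : (g, h) ∈ A.graph) {t : ℝ} (ht : 0 < t) :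
    ‖stoppedMean P S Prob h t‖
      ≤ (1 + laplaceExponent ν 1 / (1 - Real.exp (-t))) * ‖g‖ := by
  set c := laplaceExponent ν 1 / (1 - Real.exp (-t)) with hc
  have hc0 : 0 ≤ c := laplaceExponent_div_nonneg hν ht
  set u := stoppedMean P S Prob h t with hu
  rcases eq_or_ne g 0 with rfl | hg
  · have h0 : h = 0 := A.graph_fst_eq_zero_snd hgh rfl
    have : u = 0 := by simp [hu, stoppedMean, h0]
    simp [this]
  have hg' : 0 < ‖g‖ := norm_pos_iff.2 hg
  have key : ∀ φ ∈ A.domain, inner ℝ u φ ≤ (1 + c) * ‖g‖ * ‖φ‖ := by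
    intro φ hφ
    obtain ⟨ψ, hφψ⟩ := LinearPMap.mem_domain_iff.1 hφ
    rcases eq_or_ne φ 0 with rfl | hφ0
    · simp
    have hφ' : 0 < ‖φ‖ := norm_pos_iff.2 hφ0
    -- The quadratic estimate is applied to `φ` rescaled to the norm of `g`.
    set k := ‖g‖ / ‖φ‖ with hk
    have hk0 : 0 < k := by positivity
    have h1 := hS.abs_inner_stoppedMean_le_sq hν hP hA hsym hgh (A.graph.smul_mem k hφψ) ht
    simp only at h1
    have h2 : ‖k • φ‖ = ‖g‖ := by
      rw [norm_smul, Real.norm_of_nonneg hk0.le, hk, div_mul_cancel₀ _ hφ'.ne']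
    rw [h2, real_inner_smul_right] at h1
    have h3 := (le_abs_self _).trans h1
    have h4 : k * inner ℝ u φ ≤ k * ((1 + c) * ‖g‖ * ‖φ‖) := by
      have : k * ((1 + c) * ‖g‖ * ‖φ‖) = ‖g‖ * ‖g‖ + c * ((‖g‖ ^ 2 + ‖g‖ ^ 2) / 2) := by
        rw [hk]; field_simp; ring
      rw [this]
      exact h3
    exact le_of_mul_le_mul_left h4 hk0
  have hcl : IsClosed {φ | inner ℝ u φ ≤ (1 + c) * ‖g‖ * ‖φ‖} :=
    isClosed_le (by fun_prop) (by fun_prop)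
  have hfin : inner ℝ u u ≤ (1 + c) * ‖g‖ * ‖u‖ :=
    (hcl.closure_subset_iff.2 fun φ hφ => key φ hφ) (dense_domain hP hA u)
  rw [real_inner_self_eq_norm_sq, sq] at hfin
  rcases eq_or_ne u 0 with h0 | h0
  · rw [h0, norm_zero]; positivity
  · exact le_of_mul_le_mul_right hfin (norm_pos_iff.2 h0)

/-- For `t > 0` the mean `𝔼 P_{E_t} g` lies in the domain of the generator for every `g`, by
approximation of `g` in the domain. -/
theorem exists_stoppedMean_mem_graph (hS : IsRegularSubordinator S Prob)
    (hν : IsDriftlessLevyMeasure S Prob ν)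
    (hP : IsContractionSemigroup P) (hA : IsInfinitesimalGenerator A P)
    (hsym : IsSymmetricGenerator A) (g : H) :
    ∃ v : ℝ → H, (∀ t, 0 < t → (stoppedMean P S Prob g t, v t) ∈ A.graph) ∧
      ContinuousOn v (Ioi 0) := by
  obtain ⟨γ, hγ, hγlim⟩ := mem_closure_iff_seq_limit.1 (dense_domain hP hA g)
  choose η hη using fun n => LinearPMap.mem_domain_iff.1 (hγ n)
  set M : ℝ → ℝ := fun t => 1 + laplaceExponent ν 1 / (1 - Real.exp (-t)) with hM
  have hMnn : ∀ t, 0 < t → 0 ≤ M t := fun t ht =>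
    add_nonneg zero_le_one (laplaceExponent_div_nonneg hν ht)
  have hdiff : ∀ t, 0 < t → ∀ m n, dist (stoppedMean P S Prob (η m) t)
      (stoppedMean P S Prob (η n) t) ≤ M t * dist (γ m) (γ n) := by
    intro t ht m n
    have h1 : stoppedMean P S Prob (η m) t - stoppedMean P S Prob (η n) t
        = stoppedMean P S Prob (η m - η n) t := by
      simp only [stoppedMean, map_sub]
      rw [integral_sub (hS.integrable_stoppedMean hP _ t) (hS.integrable_stoppedMean hP _ t)]
    rw [dist_eq_norm, dist_eq_norm, h1]
    exact hS.norm_stoppedMean_le_of_mem_graph hν hP hA hsym (A.graph.sub_mem (hη m) (hη n)) ht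
  have hlim : ∀ t, ∃ l, 0 < t → Tendsto (fun n => stoppedMean P S Prob (η n) t) atTop (𝓝 l) := by
    intro t
    by_cases ht : 0 < t
    · have hcau : CauchySeq fun n => stoppedMean P S Prob (η n) t := by
        have h2 := hγlim.cauchySeq
        rw [Metric.cauchySeq_iff] at h2 ⊢
        intro ε hε
        have hM1 : 0 < M t + 1 := by linarith [hMnn t ht]
        obtain ⟨N, hN⟩ := h2 (ε / (M t + 1)) (by positivity)
        refine ⟨N, fun m hm n hn => (hdiff t ht m n).trans_lt ?_⟩
        have h3 := hN m hm n hn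
        rw [lt_div_iff₀ hM1] at h3
        nlinarith [dist_nonneg (x := γ m) (y := γ n)]
      obtain ⟨l, hl⟩ := cauchySeq_tendsto_of_complete hcau
      exact ⟨l, fun _ => hl⟩
    · exact ⟨0, fun h => absurd h ht⟩
  choose v hv using hlim
  have hdist : ∀ t, 0 < t → ∀ n,
      dist (stoppedMean P S Prob (η n) t) (v t) ≤ M t * dist (γ n) g := by
    intro t ht n
    exact le_of_tendsto_of_tendsto' (tendsto_const_nhds.dist (hv t ht))
      ((tendsto_const_nhds.dist hγlim).const_mul _) fun m => hdiff t ht n m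
  refine ⟨v, fun t ht => ?_, ?_⟩
  · refine mem_graph_of_forall_inner hP hA hsym fun φ ψ hφψ => ?_
    have h1 : Tendsto (fun n => stoppedMean P S Prob (γ n) t) atTop
        (𝓝 (stoppedMean P S Prob g t)) := by
      rw [tendsto_iff_norm_sub_tendsto_zero] at hγlim ⊢
      refine squeeze_zero (fun _ => norm_nonneg _) (fun n => ?_) hγlim
      have h2 : stoppedMean P S Prob (γ n) t - stoppedMean P S Prob g t
          = stoppedMean P S Prob (γ n - g) t := by
        simp only [stoppedMean, map_sub]
        rw [integral_sub (hS.integrable_stoppedMean hP _ t) (hS.integrable_stoppedMean hP _ t)]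
      rw [h2]
      exact norm_stoppedMean_le hP _ t
    refine tendsto_nhds_unique (h1.inner tendsto_const_nhds (𝕜 := ℝ)) ?_
    refine ((hv t ht).inner tendsto_const_nhds (𝕜 := ℝ)).congr fun n => ?_
    exact hsym (hS.stoppedMean_mem_graph_of_mem_graph hP hA hsym (hη n) t) hφψ
  · intro t ht
    have ht2 : 0 < t / 2 := half_pos ht
    -- The constant decreases in time, so the approximation is uniform on `(t / 2, ∞)`.
    have hunif : TendstoUniformlyOn (fun n => stoppedMean P S Prob (η n)) v atTop
        (Ioi (t / 2)) := by
      rw [Metric.tendstoUniformlyOn_iff]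
      intro ε hε
      have hM1 : 0 < M (t / 2) + 1 := by linarith [hMnn (t / 2) ht2]
      filter_upwards [Metric.tendsto_nhds.1 hγlim (ε / (M (t / 2) + 1)) (by positivity)]
        with n hn s hs
      have hs0 : t / 2 < s := hs
      have hMs : M s ≤ M (t / 2) := by
        have e0 : Real.exp (-(t / 2)) < 1 := Real.exp_lt_one_iff.2 (by linarith)
        have e1 : Real.exp (-s) ≤ Real.exp (-(t / 2)) := Real.exp_le_exp.2 (by linarith)
        have e2 := laplaceExponent_div_nonneg hν ht2
        have e3 : 0 ≤ laplaceExponent ν 1 := by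
          have : 0 < 1 - Real.exp (-(t / 2)) := by linarith
          rcases div_nonneg_iff.1 e2 with h | h <;> linarith [h.1, h.2]
        simp only [hM]
        gcongr
      rw [dist_comm]
      refine (hdist s (ht2.trans hs0) n).trans_lt ?_
      rw [lt_div_iff₀ hM1] at hn
      nlinarith [dist_nonneg (x := γ n) (y := g)]
    have hcont := hunif.continuousOn
      (Frequently.of_forall fun n => (hS.continuous_stoppedMean hP (η n)).continuousOn)
    exact (hcont.continuousAt (Ioi_mem_nhds (half_lt_self ht))).continuousWithinAt

end IsRegularSubordinator

end

end TimeFractional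

/-! ### Regularization of the paths -/

namespace TimeFractional

section Regularization

variable {Ω : Type*} [MeasurableSpace Ω] {Prob : Measure Ω} {S : ℝ → Ω → ℝ} {ν : Measure ℝ}

/-- A process whose sections are measurable and whose paths are right-continuous is jointly
measurable, as the limit of its values at the next points of finer and finer grids. -/
theorem measurable_uncurry_of_rightContinuous {R : ℝ → Ω → ℝ} (hm : ∀ t, Measurable (R t))
    (hc : ∀ ω t, ContinuousWithinAt (fun s => R s ω) (Ici t) t) :
    Measurable fun q : ℝ × Ω => R q.1 q.2 := by
  set p : ℕ → ℝ → ℝ := fun n t => ((⌊t * (n + 1)⌋ : ℝ) + 1) / (n + 1) with hp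
  have hpt : ∀ n t, t ≤ p n t ∧ p n t ≤ t + 1 / ((n : ℝ) + 1) := by
    intro n t
    have hn : (0 : ℝ) < n + 1 := by positivity
    simp only [hp]
    rw [le_div_iff₀ hn, div_le_iff₀ hn, add_mul, one_div, inv_mul_cancel₀ hn.ne']
    exact ⟨(Int.lt_floor_add_one _).le, add_le_add_left (Int.floor_le _) 1⟩
  refine measurable_of_tendsto_metrizable (f := fun n (q : ℝ × Ω) => R (p n q.1) q.2)
    (fun n => ?_) (tendsto_pi_nhds.2 fun q => ?_)
  · have h1 : Measurable fun q : ℤ × Ω => R (((q.1 : ℝ) + 1) / (n + 1)) q.2 :=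
      measurable_from_prod_countable_right fun k => hm (((k : ℝ) + 1) / (n + 1))
    have h2 : Measurable fun q : ℝ × Ω => (⌊q.1 * (n + 1)⌋, q.2) :=
      ((measurable_fst.mul_const _).floor).prodMk measurable_snd
    exact h1.comp h2
  · refine (hc q.2 q.1).tendsto.comp (tendsto_nhdsWithin_iff.2 ⟨?_, ?_⟩)
    · refine tendsto_of_tendsto_of_tendsto_of_le_of_le tendsto_const_nhds (h := fun n : ℕ =>
        q.1 + 1 / ((n : ℝ) + 1)) ?_ (fun n => (hpt n q.1).1) fun n => (hpt n q.1).2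
      simpa using (tendsto_one_div_add_atTop_nhds_zero_nat (𝕜 := ℝ)).const_add q.1
    · exact Eventually.of_forall fun n => (hpt n q.1).1

/-- A subordinator with nonzero Lévy measure tends to infinity, since
`𝔼 exp (-S_n) = exp (-n φ(1))` tends to `0`. -/
theorem IsSubordinator.ae_unbounded [IsProbabilityMeasure Prob] (hS : IsSubordinator S Prob)
    (hν : IsDriftlessLevyMeasure S Prob ν) (hν_inf : ν (Ioi 0) = ∞) :
    ∀ᵐ ω ∂Prob, ∀ x, ∃ n : ℕ, x < S n ω := by
  have hφ := hν.laplaceExponent_pos hν_inf one_pos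
  set Z : Ω → ℝ≥0∞ := fun ω => ⨅ n : ℕ, ENNReal.ofReal (Real.exp (-(1 * S n ω))) with hZ
  have hm : ∀ n : ℕ, Measurable fun ω => ENNReal.ofReal (Real.exp (-(1 * S n ω))) := fun n =>
    (((hS.measurable n n.cast_nonneg).const_mul 1).neg.exp).ennreal_ofReal
  have hZm : Measurable Z := Measurable.iInf hm
  have hI : ∀ n : ℕ, ∫⁻ ω, ENNReal.ofReal (Real.exp (-(1 * S n ω))) ∂Prob
      = ENNReal.ofReal (Real.exp (-((n : ℝ) * laplaceExponent ν 1))) := by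
    intro n
    rw [laplaceExponent, ← hν.laplace 1 n one_pos n.cast_nonneg,
      ofReal_integral_eq_lintegral_ofReal]
    · refine Integrable.of_bound (C := 1)
        ((hS.measurable n n.cast_nonneg).const_mul 1).neg.exp.aestronglyMeasurable ?_
      filter_upwards [hS.start_zero, hS.monotone_paths] with ω h0 hmon
      have : S 0 ω ≤ S n ω := hmon (mem_Ici.2 le_rfl) (mem_Ici.2 n.cast_nonneg) n.cast_nonneg
      rw [Real.norm_of_nonneg (Real.exp_pos _).le]
      exact Real.exp_le_one_iff.2 (by linarith)
    · exact ae_of_all _ fun ω => (Real.exp_pos _).le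
  have hlim : Tendsto (fun n : ℕ => ENNReal.ofReal (Real.exp (-((n : ℝ) * laplaceExponent ν 1))))
      atTop (𝓝 0) := by
    have h1 : Tendsto (fun n : ℕ => Real.exp (-((n : ℝ) * laplaceExponent ν 1))) atTop (𝓝 0) :=
      Real.tendsto_exp_neg_atTop_nhds_zero.comp
        (tendsto_natCast_atTop_atTop.atTop_mul_const hφ)
    simpa [Function.comp_def] using (ENNReal.continuous_ofReal.tendsto 0).comp h1
  have hZ0 : ∫⁻ ω, Z ω ∂Prob = 0 := by
    refine le_antisymm (ge_of_tendsto' hlim fun n => ?_) zero_le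
    rw [← hI n]
    exact lintegral_mono fun ω => iInf_le _ n
  rw [lintegral_eq_zero_iff hZm] at hZ0
  filter_upwards [hZ0] with ω hω x
  by_contra! h
  have h1 : ENNReal.ofReal (Real.exp (-x)) ≤ Z ω := by
    refine le_iInf fun n => ENNReal.ofReal_le_ofReal (Real.exp_le_exp.2 ?_)
    linarith [h n]
  rw [hω] at h1
  simp only [Pi.zero_apply, nonpos_iff_eq_zero, ENNReal.ofReal_eq_zero] at h1
  exact absurd (Real.exp_pos (-x)) (not_lt.2 h1)

theorem HasBoundedDensity.map_le {X : Ω → ℝ} (h : HasBoundedDensity X Prob) :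
    ∃ C : ℝ≥0, Prob.map X ≤ C • (volume : Measure ℝ) := by
  obtain ⟨p, -, ⟨C, hC⟩, hmap⟩ := h
  refine ⟨C.toNNReal, ?_⟩
  rw [hmap]
  refine Measure.le_iff.2 fun s hs => ?_
  rw [withDensity_apply _ hs, Measure.smul_apply]
  refine (setLIntegral_mono measurable_const fun x _ =>
    ENNReal.ofReal_le_ofReal (hC x).2).trans (le_of_eq ?_)
  rw [setLIntegral_const]
  rfl

/-- A subordinator with bounded densities and infinite Lévy measure agrees, off a null set, with a
regular one. On the null set its
paths are replaced by `r ↦ max r 0`. -/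
theorem IsSubordinator.exists_regular [IsProbabilityMeasure Prob] (hS : IsSubordinator S Prob)
    (hν : IsDriftlessLevyMeasure S Prob ν) (hν_inf : ν (Ioi 0) = ∞)
    (hdens : ∀ t, 0 < t → HasBoundedDensity (S t) Prob) :
    ∃ R : ℝ → Ω → ℝ, IsRegularSubordinator R Prob ∧ IsDriftlessLevyMeasure R Prob ν ∧
      ∀ᵐ ω ∂Prob, ∀ r, 0 ≤ r → R r ω = S r ω := by
  classical
  obtain ⟨G, hG, hGm, hGp⟩ := (hS.start_zero.and (hS.monotone_paths.and (hS.rightCont_paths.and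
    (hS.ae_unbounded hν hν_inf)))).exists_measurable_mem
  set R : ℝ → Ω → ℝ := fun r => G.piecewise (S (max r 0)) (fun _ => max r 0) with hR
  have hRG : ∀ ω ∈ G, ∀ r, R r ω = S (max r 0) ω := fun ω hω r => piecewise_eq_of_mem _ _ _ hω
  have hRG' : ∀ ω ∉ G, ∀ r, R r ω = max r 0 := fun ω hω r => piecewise_eq_of_notMem _ _ _ hω
  have hae : ∀ᵐ ω ∂Prob, ∀ r, 0 ≤ r → R r ω = S r ω := by
    filter_upwards [hG] with ω hω r hr
    rw [hRG ω hω, max_eq_left hr]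
  refine ⟨R, ⟨?_, ?_, ?_, ?_, ?_⟩, ⟨hν.carried, hν.integrable_min, ?_⟩, hae⟩
  · refine measurable_uncurry_of_rightContinuous (fun t => ?_) fun ω t => ?_
    · exact (hS.measurable _ (le_max_right _ _)).piecewise hGm measurable_const
    · by_cases hω : ω ∈ G
      · simp only [hRG ω hω]
        have h1 := (hGp ω hω).2.2.1 (max t 0) (le_max_right _ _)
        have h2 : ContinuousWithinAt (fun s : ℝ => max s 0) (Ici t) t :=
          (by fun_prop : Continuous fun s : ℝ => max s 0).continuousWithinAt
        exact ContinuousWithinAt.comp (t := Ici (max t 0)) (f := fun s : ℝ => max s 0)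
          (g := fun s => S s ω) h1 h2 fun s hs => mem_Ici.2 (max_le_max_right _ hs)
      · simp only [hRG' ω hω]
        exact (by fun_prop : Continuous fun s : ℝ => max s 0).continuousWithinAt
  · intro ω s t hst
    by_cases hω : ω ∈ G
    · simp only [hRG ω hω]
      exact (hGp ω hω).2.1 (mem_Ici.2 (le_max_right _ _)) (mem_Ici.2 (le_max_right _ _))
        (max_le_max_right _ hst)
    · simp only [hRG' ω hω]
      exact max_le_max_right _ hst
  · intro t ω
    by_cases hω : ω ∈ G
    · have h1 : S 0 ω ≤ S (max t 0) ω :=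
        (hGp ω hω).2.1 (mem_Ici.2 le_rfl) (mem_Ici.2 (le_max_right _ _)) (le_max_right _ _)
      rw [(hGp ω hω).1] at h1
      rwa [hRG ω hω]
    · rw [hRG' ω hω]
      exact le_max_right _ _
  · intro ω x
    by_cases hω : ω ∈ G
    · obtain ⟨n, hn⟩ := (hGp ω hω).2.2.2 x
      refine ⟨n + 1, by positivity, hn.trans_le ?_⟩
      rw [hRG ω hω, max_eq_left (by positivity)]
      exact (hGp ω hω).2.1 (mem_Ici.2 n.cast_nonneg)
        (mem_Ici.2 (by positivity)) (by linarith)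
    · refine ⟨max x 0 + 1, by positivity, ?_⟩
      rw [hRG' ω hω, max_eq_left (by positivity)]
      linarith [le_max_left x 0]
  · intro t ht
    have h1 : Prob.map (R t) = Prob.map (S t) :=
      Measure.map_congr (hae.mono fun ω hω => hω t ht.le)
    rw [h1]
    exact (hdens t ht).map_le
  · intro l t hl ht
    rw [← hν.laplace l t hl ht]
    refine integral_congr_ae (hae.mono fun ω hω => ?_)
    simp only [hω t ht]

end Regularization

/-! ### Transition densities -/

section Density

variable {Ω : Type*} [MeasurableSpace Ω] {Prob : Measure Ω} {S : ℝ → Ω → ℝ}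

namespace IsRegularSubordinator

variable [IsProbabilityMeasure Prob]

/-- Jointly measurable densities exist, as Radon-Nikodym derivatives of the kernel `r ↦ law of S_r`.
These are taken with respect to a finite measure equivalent to Lebesgue measure. -/
theorem exists_isTransitionDensity (hS : IsRegularSubordinator S Prob) :
    ∃ p, IsTransitionDensity p S Prob := by
  set κ : Kernel ℝ ℝ := ⟨fun r => Prob.map (S r), by
    refine Measure.measurable_of_measurable_coe _ fun s hs => ?_
    have : (fun r => Prob.map (S r) s) = fun r => Prob (Prod.mk r ⁻¹'
        ((fun q : ℝ × Ω => S q.1 q.2) ⁻¹' s)) := by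
      ext r
      rw [Measure.map_apply (hS.measurable_apply r) hs]
      rfl
    rw [this]
    exact measurable_measure_prodMk_left (hS.measurable hs)⟩ with hκ
  have hκr : ∀ r, κ r = Prob.map (S r) := fun r => rfl
  have : IsMarkovKernel κ :=
    ⟨fun r => by
      rw [hκr]
      exact Measure.isProbabilityMeasure_map (hS.measurable_apply r).aemeasurable⟩
  set vf : Measure ℝ := (volume : Measure ℝ).toFinite with hvf
  set η : Kernel ℝ ℝ := Kernel.const ℝ vf with hη
  set k : ℝ → ℝ → ℝ≥0∞ := fun r x => κ.rnDeriv η r x * vf.rnDeriv volume x with hk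
  have hkm : Measurable (Function.uncurry k) :=
    (κ.measurable_rnDeriv η).mul ((Measure.measurable_rnDeriv _ _).comp measurable_snd)
  refine ⟨fun r x => (k r x).toReal, hkm.ennreal_toReal, fun _ _ => ENNReal.toReal_nonneg,
    fun r hr => ?_⟩
  have hac : κ r ≪ η r := by
    rw [hκr, hη, Kernel.const_apply]
    exact (hS.map_absolutelyContinuous hr).trans (absolutelyContinuous_toFinite _)
  have h1 : (volume : Measure ℝ).withDensity (k r) = κ r := by
    have h2 := Kernel.withDensity_rnDeriv_eq hac
    rw [Kernel.withDensity_apply _ (κ.measurable_rnDeriv η), hη, Kernel.const_apply] at h2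
    have h3 : (volume : Measure ℝ).withDensity (vf.rnDeriv volume) = vf :=
      Measure.withDensity_rnDeriv_eq _ _ (toFinite_absolutelyContinuous _)
    rw [← h2]
    have h5 : vf.withDensity (κ.rnDeriv (Kernel.const ℝ vf) r)
        = ((volume : Measure ℝ).withDensity (vf.rnDeriv volume)).withDensity
          (κ.rnDeriv (Kernel.const ℝ vf) r) := by rw [h3]
    rw [h5, ← withDensity_mul _ (Measure.measurable_rnDeriv _ _) (κ.measurable_rnDeriv_right η r)]
    refine congrArg _ (funext fun x => ?_)
    exact mul_comm _ _
  rw [← hκr, ← h1]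
  refine withDensity_congr_ae ?_
  have h4 : ∀ᵐ x ∂(volume : Measure ℝ), κ.rnDeriv η r x ≠ ∞ :=
    (absolutelyContinuous_toFinite _).ae_le (κ.rnDeriv_ne_top η (a := r))
  filter_upwards [h4, Measure.rnDeriv_ne_top vf volume] with x hx1 hx2
  exact (ENNReal.ofReal_toReal (ENNReal.mul_ne_top hx1 hx2)).symm

/-- The image of the clock measure under `(ω, r) ↦ (t - S_r, r)` has the density
`(s, r) ↦ p r (t - s)`. -/
theorem map_clockMeasure (hS : IsRegularSubordinator S Prob) {p : ℝ → ℝ → ℝ}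
    (hp : IsTransitionDensity p S Prob) (t : ℝ) :
    (clockMeasure Prob).map (fun q : Ω × ℝ => (t - S q.2 q.1, q.2))
      = ((volume : Measure ℝ).prod (volume.restrict (Ioi (0 : ℝ)))).withDensity
        fun q => ENNReal.ofReal (p q.2 (t - q.1)) := by
  have hm : Measurable fun q : Ω × ℝ => (t - S q.2 q.1, q.2) :=
    (hS.measurable_swap.const_sub t).prodMk measurable_snd
  have hpm : Measurable fun q : ℝ × ℝ => ENNReal.ofReal (p q.2 (t - q.1)) :=
    (hp.measurable.comp (measurable_snd.prodMk (measurable_fst.const_sub t))).ennreal_ofReal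
  refine Measure.ext_of_lintegral _ fun F hF => ?_
  rw [lintegral_map hF hm, lintegral_withDensity_eq_lintegral_mul _ hpm hF, clockMeasure,
    lintegral_prod_symm (fun q : Ω × ℝ => F (t - S q.2 q.1, q.2)) (hF.comp hm).aemeasurable,
    lintegral_prod_symm _ (hpm.mul hF).aemeasurable]
  refine setLIntegral_congr_fun measurableSet_Ioi fun r hr => ?_
  simp only [Pi.mul_apply]
  have hFr : Measurable fun x => F (t - x, r) :=
    hF.comp ((measurable_id.const_sub t).prodMk measurable_const)
  have hpr : Measurable fun x => ENNReal.ofReal (p r x) :=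
    (hp.measurable.comp (measurable_const.prodMk measurable_id)).ennreal_ofReal
  have h1 := lintegral_map (μ := Prob) hFr (hS.measurable_apply r)
  rw [← h1, hp.map_eq r hr, lintegral_withDensity_eq_lintegral_mul _ hpr hFr,
    ← lintegral_sub_left_eq_self _ t]
  simp

/-- A property of almost every time holds at `t - S_r` for almost every `(ω, r)`. -/
theorem ae_clockMeasure_of_ae (hS : IsRegularSubordinator S Prob) {a : ℝ → Prop}
    (ha : ∀ᵐ s ∂(volume : Measure ℝ), a s) (t : ℝ) :
    ∀ᵐ q ∂clockMeasure Prob, a (t - S q.2 q.1) := by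
  obtain ⟨p, hp⟩ := hS.exists_isTransitionDensity
  have hm : Measurable fun q : Ω × ℝ => (t - S q.2 q.1, q.2) :=
    (hS.measurable_swap.const_sub t).prodMk measurable_snd
  have h1 : ∀ᵐ q ∂(clockMeasure Prob).map (fun q : Ω × ℝ => (t - S q.2 q.1, q.2)), a q.1 := by
    rw [hS.map_clockMeasure hp t]
    exact (withDensity_absolutelyContinuous _ _).ae_le (Measure.quasiMeasurePreserving_fst.ae ha)
  exact ae_of_ae_map hm.aemeasurable h1

end IsRegularSubordinator

end Density

end TimeFractional

/-! ### The representation formula -/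

namespace TimeFractional

theorem DirichletForm.isSymmetricGenerator {E : Type*} [MeasurableSpace E] {μ : Measure E}
    (D : DirichletForm μ) : IsSymmetricGenerator D.generator := by
  intro u h v k huh hvk
  rw [D.generator_graph] at huh hvk
  obtain ⟨hu, h1⟩ := huh
  obtain ⟨hv, h2⟩ := hvk
  have e1 := h1 ⟨v, hv⟩
  have e2 := h2 ⟨u, hu⟩
  rw [D.symm] at e1
  simp only at e1 e2
  rw [e2] at e1
  rw [real_inner_comm k u]
  linarith

section Sources

variable {H : Type*} [NormedAddCommGroup H] {f : ℝ → H} {T₀ K : ℝ}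

/-- A bounded measurable function on `(0, T₀]` agrees almost everywhere with a source. -/
theorem exists_isSource (hf : AEStronglyMeasurable f (volume.restrict (Ioc 0 T₀)))
    (hfK : ∀ᵐ t ∂(volume.restrict (Ioc 0 T₀)), ‖f t‖ ≤ K) :
    ∃ d, IsSource T₀ d ∧ f =ᵐ[volume.restrict (Ioc 0 T₀)] d := by
  have hm := hf.stronglyMeasurable_mk
  set G : Set ℝ := Ioc 0 T₀ ∩ {t | ‖hf.mk f t‖ ≤ |K|} with hG
  have hGm : MeasurableSet G :=
    measurableSet_Ioc.inter (measurableSet_le hm.norm.measurable measurable_const)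
  refine ⟨G.indicator (hf.mk f), ⟨hm.indicator hGm, ⟨|K|, fun t => ?_⟩, fun t ht => ?_⟩, ?_⟩
  · by_cases ht : t ∈ G
    · rw [indicator_of_mem ht]
      exact ht.2
    · rw [indicator_of_notMem ht, norm_zero]
      exact abs_nonneg K
  · exact indicator_of_notMem (fun h => ht h.1) _
  · filter_upwards [hf.ae_eq_mk, hfK, ae_restrict_mem measurableSet_Ioc] with t h1 h2 h3
    have hmem : t ∈ G := by
      refine ⟨h3, ?_⟩
      rw [mem_ofPred_eq, ← h1]
      exact h2.trans (le_abs_self K)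
    rw [indicator_of_mem hmem, h1]

theorem IsSource.indicator {d : ℝ → H} (hd : IsSource T₀ d) (t : ℝ) :
    IsSource t ((Ioc 0 t).indicator d) := by
  obtain ⟨C, hC⟩ := hd.bounded
  exact ⟨hd.stronglyMeasurable.indicator measurableSet_Ioc,
    ⟨C, fun s => (norm_indicator_le_norm_self _ _).trans (hC s)⟩,
    fun s hs => indicator_of_notMem hs _⟩

end Sources

section Representation

variable {Ω : Type*} [MeasurableSpace Ω] {Prob : Measure Ω} {S R : ℝ → Ω → ℝ} {ν : Measure ℝ}
  {E : Type*} [MeasurableSpace E] {μ : Measure E}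
  {P : ℝ → Lp ℝ 2 μ →L[ℝ] Lp ℝ 2 μ} {f d : ℝ → Lp ℝ 2 μ} {T₀ : ℝ}

omit [MeasurableSpace Ω] in
theorem inverseSubordinator_congr {ω : Ω} (h : ∀ r, 0 ≤ r → R r ω = S r ω) (t : ℝ) :
    inverseSubordinator R t ω = inverseSubordinator S t ω := by
  unfold inverseSubordinator
  congr 1
  ext s
  simp only [mem_ofPred_eq]
  exact and_congr_right fun hs => by rw [h s hs.le]

variable [IsProbabilityMeasure Prob]

theorem sourceIntegrand_ae_eq (hR : IsRegularSubordinator R Prob)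
    (hRS : ∀ᵐ ω ∂Prob, ∀ r, 0 ≤ r → R r ω = S r ω) (hd : IsSource T₀ d)
    (hfd : f =ᵐ[volume.restrict (Ioc 0 T₀)] d) {t : ℝ} (ht : t ≤ T₀) :
    (fun q : Ω × ℝ => sourceIntegrand P S f t q.1 q.2) =ᵐ[clockMeasure Prob]
      fun q => P (max q.2 0) (d (t - R q.2 q.1)) := by
  have h1 : ∀ᵐ s ∂(volume : Measure ℝ), s ∈ Ioc 0 T₀ → f s = d s :=
    (ae_restrict_iff' measurableSet_Ioc).1 hfd
  have h2 := hR.ae_clockMeasure_of_ae h1 t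
  have h3 : ∀ᵐ q ∂clockMeasure Prob, ∀ r, 0 ≤ r → R r q.1 = S r q.1 :=
    Measure.quasiMeasurePreserving_fst.ae hRS
  filter_upwards [h2, h3, ae_clockMeasure_pos] with q hq2 hq3 hq4
  have hSR := hq3 q.2 hq4.le
  have hnn := hR.nonneg q.2 q.1
  simp only [sourceIntegrand]
  by_cases hlt : R q.2 q.1 < t
  · rw [indicator_of_mem (show q.2 ∈ {r' : ℝ | S r' q.1 < t} by
      rw [mem_ofPred_eq, ← hSR]; exact hlt), ← hSR, max_eq_left hq4.le,
      hq2 ⟨by linarith, by linarith⟩]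
  · rw [indicator_of_notMem (show q.2 ∉ {r' : ℝ | S r' q.1 < t} by
      rw [mem_ofPred_eq, ← hSR]; exact hlt), hd.zero_of_nonpos (by linarith), map_zero]

theorem integrable_sourceIntegrand (hR : IsRegularSubordinator R Prob)
    (hν : IsDriftlessLevyMeasure R Prob ν) (hν_inf : ν (Ioi 0) = ∞)
    (hRS : ∀ᵐ ω ∂Prob, ∀ r, 0 ≤ r → R r ω = S r ω) (hP : IsContractionSemigroup P)
    (hd : IsSource T₀ d)
    (hfd : f =ᵐ[volume.restrict (Ioc 0 T₀)] d) {t : ℝ} (ht : t ≤ T₀) :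
    Integrable (fun q : Ω × ℝ => sourceIntegrand P S f t q.1 q.2) (clockMeasure Prob) :=
  (hR.integrable_potential hν hν_inf hP hd t).congr (sourceIntegrand_ae_eq hR hRS hd hfd ht).symm

theorem integral_sourceIntegrand (hR : IsRegularSubordinator R Prob)
    (hν : IsDriftlessLevyMeasure R Prob ν) (hν_inf : ν (Ioi 0) = ∞)
    (hRS : ∀ᵐ ω ∂Prob, ∀ r, 0 ≤ r → R r ω = S r ω) (hP : IsContractionSemigroup P)
    (hd : IsSource T₀ d)
    (hfd : f =ᵐ[volume.restrict (Ioc 0 T₀)] d) {t : ℝ} (ht : t ≤ T₀) :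
    ∫ ω, (∫ r in Ioi (0 : ℝ), sourceIntegrand P S f t ω r) ∂Prob = potential P R Prob d t := by
  rw [potential, ← integral_congr_ae (sourceIntegrand_ae_eq (P := P) hR hRS hd hfd ht)]
  exact (integral_prod _ (integrable_sourceIntegrand hR hν hν_inf hRS hP hd hfd ht)).symm

omit [IsProbabilityMeasure Prob] in
theorem stopped_ae_eq (hRS : ∀ᵐ ω ∂Prob, ∀ r, 0 ≤ r → R r ω = S r ω) (g : Lp ℝ 2 μ) (t : ℝ) :
    (fun ω => P (inverseSubordinator R t ω) g) =ᵐ[Prob]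
      fun ω => P (inverseSubordinator S t ω) g := by
  filter_upwards [hRS] with ω hω
  rw [inverseSubordinator_congr hω]

theorem representation_eq (hR : IsRegularSubordinator R Prob)
    (hν : IsDriftlessLevyMeasure R Prob ν) (hν_inf : ν (Ioi 0) = ∞)
    (hRS : ∀ᵐ ω ∂Prob, ∀ r, 0 ≤ r → R r ω = S r ω) (hP : IsContractionSemigroup P)
    (hd : IsSource T₀ d)
    (hfd : f =ᵐ[volume.restrict (Ioc 0 T₀)] d) (g : Lp ℝ 2 μ) {t : ℝ} (ht : t ≤ T₀) :
    representation P S Prob g f t = stoppedMean P R Prob g t + potential P R Prob d t := by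
  rw [representation, integral_sourceIntegrand hR hν hν_inf hRS hP hd hfd ht, stoppedMean,
    integral_congr_ae (stopped_ae_eq hRS g t)]

/-- The source term in terms of the transition densities. The source may be taken to vanish after
time `t`, so that the integrals over `(0, t]` and over the whole line agree. -/
theorem potential_eq_integral_density (hR : IsRegularSubordinator R Prob)
    (hν : IsDriftlessLevyMeasure R Prob ν) (hν_inf : ν (Ioi 0) = ∞)
    (hP : IsContractionSemigroup P) {p : ℝ → ℝ → ℝ} (hp : IsTransitionDensity p R Prob) {t : ℝ}
    (hd : IsSource t d) (hfd : f =ᵐ[volume.restrict (Ioc 0 t)] d) :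
    Integrable (fun q : ℝ × ℝ => p q.2 (t - q.1) • P q.2 (f q.1))
        ((volume.restrict (Ioc 0 t)).prod (volume.restrict (Ioi (0 : ℝ)))) ∧
      potential P R Prob d t
        = ∫ s in Ioc 0 t, ∫ r in Ioi (0 : ℝ), p r (t - s) • P r (f s) := by
  set G : ℝ × ℝ → Lp ℝ 2 μ := fun q => P (max q.2 0) (d q.1) with hG
  have hGm : StronglyMeasurable G := by
    have h2 : StronglyMeasurable fun q : ℝ × ℝ => (q.2, d q.1) :=
      measurable_snd.stronglyMeasurable.prodMk
        (hd.stronglyMeasurable.comp_measurable measurable_fst)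
    exact hP.continuous_uncurry.comp_stronglyMeasurable h2
  have hm : Measurable fun q : Ω × ℝ => (t - R q.2 q.1, q.2) :=
    (hR.measurable_swap.const_sub t).prodMk measurable_snd
  have hpm : Measurable fun q : ℝ × ℝ => ENNReal.ofReal (p q.2 (t - q.1)) :=
    (hp.measurable.comp (measurable_snd.prodMk (measurable_fst.const_sub t))).ennreal_ofReal
  have hi : Integrable G ((clockMeasure Prob).map fun q : Ω × ℝ => (t - R q.2 q.1, q.2)) :=
    (integrable_map_measure hGm.aestronglyMeasurable hm.aemeasurable).2
      (hR.integrable_potential hν hν_inf hP hd t)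
  have he : potential P R Prob d t
      = ∫ q, G q ∂(clockMeasure Prob).map fun q : Ω × ℝ => (t - R q.2 q.1, q.2) :=
    (integral_map hm.aemeasurable hGm.aestronglyMeasurable).symm
  rw [hR.map_clockMeasure hp t] at hi he
  rw [integrable_withDensity_iff_integrable_smul' hpm
    (ae_of_all _ fun _ => ENNReal.ofReal_lt_top)] at hi
  rw [integral_withDensity_eq_integral_toReal_smul hpm
    (ae_of_all _ fun _ => ENNReal.ofReal_lt_top)] at he
  simp only [ENNReal.toReal_ofReal (hp.nonneg _ _)] at hi he
  have hres : (volume.restrict (Ioc 0 t)).prod (volume.restrict (Ioi (0 : ℝ)))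
      = ((volume : Measure ℝ).prod (volume.restrict (Ioi (0 : ℝ)))).restrict
        (Ioc 0 t ×ˢ univ) := by
    rw [← Measure.prod_restrict, Measure.restrict_univ]
  have hae : (fun q : ℝ × ℝ => p q.2 (t - q.1) • P q.2 (f q.1))
      =ᵐ[(volume.restrict (Ioc 0 t)).prod (volume.restrict (Ioi (0 : ℝ)))]
      fun q => p q.2 (t - q.1) • G q := by
    have h1 : ∀ᵐ r ∂volume.restrict (Ioi (0 : ℝ)), 0 < r := ae_restrict_mem measurableSet_Ioi
    filter_upwards [Measure.quasiMeasurePreserving_fst.ae hfd,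
      Measure.quasiMeasurePreserving_snd.ae h1] with q hq1 hq2
    simp only [hG, hq1, max_eq_left hq2.le]
  have hi' : Integrable (fun q : ℝ × ℝ => p q.2 (t - q.1) • P q.2 (f q.1))
      ((volume.restrict (Ioc 0 t)).prod (volume.restrict (Ioi (0 : ℝ)))) := by
    refine Integrable.congr ?_ hae.symm
    rw [hres]
    exact hi.integrableOn
  refine ⟨hi', ?_⟩
  rw [← integral_prod (fun q : ℝ × ℝ => p q.2 (t - q.1) • P q.2 (f q.1)) hi',
    integral_congr_ae hae, hres, he]
  refine (setIntegral_eq_integral_of_forall_compl_eq_zero fun q hq => ?_).symm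
  have : q.1 ∉ Ioc 0 t := fun h => hq ⟨h, mem_univ _⟩
  simp only [hG]
  rw [hd.zero _ this, map_zero, smul_zero]

end Representation

/-! ### Existence and uniqueness of the weak solution -/

section WeakSolution

variable {Ω : Type*} [MeasurableSpace Ω] {Prob : Measure Ω} [IsProbabilityMeasure Prob]
  {R : ℝ → Ω → ℝ} {ν : Measure ℝ}
  {E : Type*} [MeasurableSpace E] {μ : Measure E}
  {P : ℝ → Lp ℝ 2 μ →L[ℝ] Lp ℝ 2 μ} {A : Lp ℝ 2 μ →ₗ.[ℝ] Lp ℝ 2 μ}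
  {f d : ℝ → Lp ℝ 2 μ} {T₀ : ℝ}

omit [IsProbabilityMeasure Prob] in
/-- Convolution of the weight with a bounded measurable function converges absolutely. -/
theorem intervalIntegrable_weight_smul {X : Type*} [NormedAddCommGroup X] [NormedSpace ℝ X]
    (hν : IsDriftlessLevyMeasure R Prob ν) {T : ℝ} (hT : 0 ≤ T) {F : ℝ → X} {C : ℝ}
    (hF : AEStronglyMeasurable F (volume.restrict (Ioc 0 T))) (hC : ∀ t ∈ Ioc 0 T, ‖F t‖ ≤ C) :
    IntervalIntegrable (fun s => weight ν (T - s) • F s) volume 0 T := by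
  have h1 : IntervalIntegrable (weight ν) volume 0 T := by
    rw [intervalIntegrable_iff_integrableOn_Ioc_of_le hT, integrableOn_Ioc_iff_integrableOn_Ioo]
    exact hν.integrableOn_weight T
  have h2 : IntervalIntegrable (fun s => weight ν (T - s)) volume 0 T := by
    have := (h1.comp_sub_left T).symm
    simpa using this
  rw [intervalIntegrable_iff_integrableOn_Ioc_of_le hT] at h2 ⊢
  refine Integrable.mono' (h2.mul_const C)
    (((measurable_weight ν).comp (measurable_id.const_sub T)).aestronglyMeasurable.smul hF) ?_
  filter_upwards [ae_restrict_mem measurableSet_Ioc] with s hs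
  rw [norm_smul, Real.norm_of_nonneg (weight_nonneg ν _)]
  exact mul_le_mul_of_nonneg_left (hC s hs) (weight_nonneg ν _)

theorem isWeakSolution_of_eq (hR : IsRegularSubordinator R Prob)
    (hν : IsDriftlessLevyMeasure R Prob ν) (hν_inf : ν (Ioi 0) = ∞)
    (hP : IsContractionSemigroup P) (hA : IsInfinitesimalGenerator A P)
    (hsym : IsSymmetricGenerator A) (hT₀ : 0 < T₀) (hd : IsSource T₀ d)
    (hfd : f =ᵐ[volume.restrict (Ioc 0 T₀)] d) (g : Lp ℝ 2 μ) {u : ℝ → Lp ℝ 2 μ}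
    (hu : ∀ t ∈ Ioc 0 T₀, u t = stoppedMean P R Prob g t + potential P R Prob d t) :
    IsWeakSolution (weight ν) A T₀ g f u := by
  set U : ℝ → Lp ℝ 2 μ := fun t => stoppedMean P R Prob g t + potential P R Prob d t with hU
  have hU1 : Continuous (stoppedMean P R Prob g) := hR.continuous_stoppedMean hP g
  have hU2 : Continuous (potential P R Prob d) := hR.continuous_potential hν hν_inf hP hd
  have hUc : Continuous U := hU1.add hU2
  have hU0 : U 0 = g := by
    simp only [hU, hR.stoppedMean_zero hP, hR.potential_of_nonpos hd le_rfl, add_zero]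
  obtain ⟨C, hC⟩ := isCompact_Icc.exists_bound_of_continuousOn (s := Icc 0 T₀) hUc.continuousOn
  obtain ⟨C₂, hC₂⟩ := isCompact_Icc.exists_bound_of_continuousOn (s := Icc 0 T₀) hU2.continuousOn
  refine ⟨hUc.continuousOn.congr hu, ⟨C, fun t ht => ?_⟩, ?_, fun T hT => ?_, fun T hT φ => ?_⟩
  · rw [hu t ht]
    exact hC t (Ioc_subset_Icc_self ht)
  · have h1 : Tendsto U (𝓝[>] 0) (𝓝 g) := by
      rw [← hU0]
      exact (hUc.tendsto 0).mono_left nhdsWithin_le_nhds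
    refine h1.congr' ?_
    filter_upwards [Ioc_mem_nhdsGT hT₀] with t ht
    exact (hu t ht).symm
  · have h1 := intervalIntegrable_weight_smul hν hT.1.le (F := fun s => U s - g) (C := C + ‖g‖)
      (hUc.sub continuous_const).aestronglyMeasurable fun t ht =>
        (norm_sub_le _ _).trans (add_le_add_left (hC t ⟨ht.1.le, ht.2.trans hT.2⟩) _)
    refine h1.congr ?_
    intro s hs
    rw [uIoc_of_le hT.1.le] at hs
    simp only
    rw [hu s ⟨hs.1, hs.2.trans hT.2⟩]
  · obtain ⟨φ, hφ⟩ := φ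
    have hgraph : (φ, A ⟨φ, hφ⟩) ∈ A.graph := A.mem_graph ⟨φ, hφ⟩
    set ψ := A ⟨φ, hφ⟩ with hψ
    have hTle : (0 : ℝ) ≤ T := hT.1.le
    have hsub : Ioc 0 T ⊆ Ioc 0 T₀ := Ioc_subset_Ioc_right hT.2
    have hmem : ∀ s ∈ uIoc 0 T, s ∈ Ioc 0 T₀ := fun s hs => by
      rw [uIoc_of_le hTle] at hs
      exact hsub hs
    have hw1 := intervalIntegrable_weight_smul hν hTle
      (F := fun s => (inner ℝ (stoppedMean P R Prob g s - g) φ : ℝ)) (C := (‖g‖ + ‖g‖) * ‖φ‖)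
      ((hU1.sub continuous_const).inner continuous_const).aestronglyMeasurable fun t ht =>
        (abs_real_inner_le_norm _ _).trans (mul_le_mul_of_nonneg_right
          ((norm_sub_le _ _).trans (add_le_add_left
            (IsRegularSubordinator.norm_stoppedMean_le hP g t) _)) (norm_nonneg _))
    have hw2 := intervalIntegrable_weight_smul hν hTle
      (F := fun s => (inner ℝ (potential P R Prob d s) φ : ℝ)) (C := C₂ * ‖φ‖)
      (hU2.inner continuous_const).aestronglyMeasurable fun t ht =>
        (abs_real_inner_le_norm _ _).trans (mul_le_mul_of_nonneg_right
          (hC₂ t ⟨ht.1.le, ht.2.trans hT.2⟩) (norm_nonneg _))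
    have hw : IntervalIntegrable (fun s => weight ν (T - s) • (U s - g)) volume 0 T :=
      intervalIntegrable_weight_smul hν hTle (F := fun s => U s - g) (C := C + ‖g‖)
        (hUc.sub continuous_const).aestronglyMeasurable fun t ht =>
          (norm_sub_le _ _).trans (add_le_add_left (hC t ⟨ht.1.le, ht.2.trans hT.2⟩) _)
    have hlhs : inner ℝ (∫ s in (0 : ℝ)..T, weight ν (T - s) • (u s - g)) φ
        = (∫ s in (0 : ℝ)..T, weight ν (T - s) • (inner ℝ (stoppedMean P R Prob g s - g) φ : ℝ))
          + ∫ s in (0 : ℝ)..T, weight ν (T - s) • (inner ℝ (potential P R Prob d s) φ : ℝ) := by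
      have e1 : ∫ s in (0 : ℝ)..T, weight ν (T - s) • (u s - g)
          = ∫ s in (0 : ℝ)..T, weight ν (T - s) • (U s - g) := by
        refine intervalIntegral.integral_congr_ae (ae_of_all _ fun s hs => ?_)
        rw [hu s (hmem s hs)]
      rw [e1, real_inner_comm, ← innerSL_apply_apply ℝ,
        ← (innerSL ℝ φ).intervalIntegral_comp_comm hw, ← intervalIntegral.integral_add hw1 hw2]
      refine intervalIntegral.integral_congr fun s _ => ?_
      simp only [hU, innerSL_apply_apply, smul_eq_mul, real_inner_smul_right]
      rw [← mul_add, ← inner_add_left, real_inner_comm]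
      congr 2
      abel
    have e2 := hR.stoppedMean_weak_equation hν hν_inf hP hA hsym g hgraph hTle
    rw [integral_tailMeasure hν hTle (fun t ht => indicator_of_notMem
      (fun h => absurd (mem_Ioi.1 h) (not_lt.2 ht)) _)] at e2
    have e3 := hR.potential_weak_equation hν hν_inf hP hA hsym hd hgraph T
    rw [integral_tailMeasure hν hTle (F := fun t => (inner ℝ (potential P R Prob d t) φ : ℝ))
      (fun t ht => by rw [hR.potential_of_nonpos hd ht, inner_zero_left]),
      integral_Ioi_sub hTle (F := fun t => (inner ℝ (d t) φ : ℝ))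
      (fun t ht => by rw [hd.zero_of_nonpos ht, inner_zero_left]),
      integral_Ioi_sub hTle (F := fun t => (inner ℝ (potential P R Prob d t) ψ : ℝ))
      (fun t ht => by rw [hR.potential_of_nonpos hd ht, inner_zero_left])] at e3
    have e4 : ∫ s in (0 : ℝ)..T, weight ν (T - s) • (inner ℝ (stoppedMean P R Prob g s - g) φ : ℝ)
        = ∫ s in (0 : ℝ)..T, inner ℝ (stoppedMean P R Prob g s) ψ := by
      rw [← e2]
      refine intervalIntegral.integral_congr_ae (ae_of_all _ fun s hs => ?_)
      rw [indicator_of_mem (mem_Ioi.2 (hmem s hs).1)]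
    have e5 : ∫ s in (0 : ℝ)..T, inner ℝ (f s) φ = ∫ s in (0 : ℝ)..T, inner ℝ (d s) φ := by
      have h1 : ∀ᵐ s ∂(volume : Measure ℝ), s ∈ Ioc 0 T₀ → f s = d s :=
        (ae_restrict_iff' measurableSet_Ioc).1 hfd
      refine intervalIntegral.integral_congr_ae (h1.mono fun s hs hs' => ?_)
      rw [hs (hmem s hs')]
    have e6 : ∫ s in (0 : ℝ)..T, inner ℝ (u s) ψ
        = (∫ s in (0 : ℝ)..T, inner ℝ (stoppedMean P R Prob g s) ψ)
          + ∫ s in (0 : ℝ)..T, inner ℝ (potential P R Prob d s) ψ := by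
      rw [← intervalIntegral.integral_add
        ((hU1.inner continuous_const).intervalIntegrable _ _)
        ((hU2.inner continuous_const).intervalIntegrable _ _)]
      refine intervalIntegral.integral_congr_ae (ae_of_all _ fun s hs => ?_)
      rw [hu s (hmem s hs), inner_add_left]
    rw [hlhs, e4, e3, e5, e6]
    ring

/-- Two weak solutions agree: the integrals of their difference vanish, hence so does the
difference, by continuity. -/
theorem IsWeakSolution.eq_of_isWeakSolution (hR : IsRegularSubordinator R Prob)
    (hν : IsDriftlessLevyMeasure R Prob ν) (hν_inf : ν (Ioi 0) = ∞)
    (hP : IsContractionSemigroup P) (hA : IsInfinitesimalGenerator A P)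
    (hsym : IsSymmetricGenerator A) {g : Lp ℝ 2 μ} {u v : ℝ → Lp ℝ 2 μ}
    (hu : IsWeakSolution (weight ν) A T₀ g f u) (hv : IsWeakSolution (weight ν) A T₀ g f v) :
    ∀ t ∈ Ioc 0 T₀, v t = u t := by
  obtain ⟨Cu, hCu⟩ := hu.bounded
  obtain ⟨Cv, hCv⟩ := hv.bounded
  have hcont : ContinuousOn (fun t => v t - u t) (Ioc 0 T₀) := hv.continuousOn.sub hu.continuousOn
  set e : ℝ → Lp ℝ 2 μ := (Ioc 0 T₀).indicator fun t => v t - u t with he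
  have hemem : ∀ t ∈ Ioc 0 T₀, e t = v t - u t := fun t ht => indicator_of_mem ht _
  have hd : IsSource T₀ e := by
    refine ⟨?_, ⟨max (Cv + Cu) 0, fun t => ?_⟩, fun t ht => indicator_of_notMem ht _⟩
    · obtain ⟨k, hk, hkeq⟩ := (MeasurableEmbedding.subtype_coe
        (measurableSet_Ioc (a := (0 : ℝ)) (b := T₀))).exists_stronglyMeasurable_extend
        hcont.domRestrict.stronglyMeasurable fun _ => ⟨0⟩
      have : e = (Ioc 0 T₀).indicator k := by
        refine indicator_congr fun t ht => ?_
        exact (congrFun hkeq ⟨t, ht⟩).symm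
      rw [this]
      exact hk.indicator measurableSet_Ioc
    · by_cases ht : t ∈ Ioc 0 T₀
      · rw [hemem t ht]
        exact ((norm_sub_le _ _).trans (add_le_add (hCv t ht) (hCu t ht))).trans (le_max_left _ _)
      · rw [he, indicator_of_notMem ht, norm_zero]
        exact le_max_right _ _
  have hz : ∀ χ : Lp ℝ 2 μ, ∀ t ≤ 0, (inner ℝ (e t) χ : ℝ) = 0 := fun χ t ht => by
    rw [hd.zero_of_nonpos ht, inner_zero_left]
  have hom : ∀ T ≤ T₀, ∀ φ ψ, (φ, ψ) ∈ A.graph →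
      ∫ y, inner ℝ (e (T - y)) φ ∂tailMeasure ν
        = ∫ y in Ioi (0 : ℝ), inner ℝ (e (T - y)) ψ := by
    intro T hT φ ψ hφψ
    rcases le_or_gt T 0 with hT0 | hT0
    · have h1 : ∀ᵐ y ∂tailMeasure ν, 0 < y := by
        rw [ae_iff]
        simpa [Iic, not_lt] using tailMeasure_Iic ν
      rw [integral_eq_zero_of_ae, integral_eq_zero_of_ae]
      · filter_upwards [ae_restrict_mem measurableSet_Ioi] with y hy
        have := mem_Ioi.1 hy
        exact hz ψ _ (by linarith)
      · filter_upwards [h1] with y hy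
        exact hz φ _ (by linarith)
    · rw [integral_tailMeasure hν hT0.le (hz φ), integral_Ioi_sub hT0.le (hz ψ)]
      have hTmem : T ∈ Ioc 0 T₀ := ⟨hT0, hT⟩
      have hsub : Ioc 0 T ⊆ Ioc 0 T₀ := Ioc_subset_Ioc_right hT
      have hmem : ∀ s ∈ uIoc 0 T, s ∈ Ioc 0 T₀ := fun s hs => by
        rw [uIoc_of_le hT0.le] at hs
        exact hsub hs
      obtain ⟨φ', rfl, rfl⟩ := LinearPMap.mem_graph_iff A |>.1 hφψ
      have hpull : ∀ y : ℝ → Lp ℝ 2 μ,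
          IntervalIntegrable (fun s => weight ν (T - s) • (y s - g)) volume 0 T →
          IntervalIntegrable (fun s => weight ν (T - s) • (inner ℝ (y s - g) (φ' : Lp ℝ 2 μ) : ℝ))
              volume 0 T ∧
            inner ℝ (∫ s in (0 : ℝ)..T, weight ν (T - s) • (y s - g)) (φ' : Lp ℝ 2 μ)
              = ∫ s in (0 : ℝ)..T,
                weight ν (T - s) • (inner ℝ (y s - g) (φ' : Lp ℝ 2 μ) : ℝ) := by
        intro y hy
        have hfun : (fun s => weight ν (T - s) • (inner ℝ (y s - g) (φ' : Lp ℝ 2 μ) : ℝ))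
            = fun s => innerSL ℝ (φ' : Lp ℝ 2 μ) (weight ν (T - s) • (y s - g)) := by
          ext1 s
          rw [innerSL_apply_apply, real_inner_smul_right, real_inner_comm, smul_eq_mul]
        rw [hfun]
        refine ⟨⟨(innerSL ℝ (φ' : Lp ℝ 2 μ)).integrable_comp hy.1,
          (innerSL ℝ (φ' : Lp ℝ 2 μ)).integrable_comp hy.2⟩, ?_⟩
        rw [(innerSL ℝ (φ' : Lp ℝ 2 μ)).intervalIntegral_comp_comm hy, innerSL_apply_apply,
          real_inner_comm]
      have hint : ∀ (y : ℝ → Lp ℝ 2 μ) (C : ℝ), ContinuousOn y (Ioc 0 T₀) →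
          (∀ t ∈ Ioc 0 T₀, ‖y t‖ ≤ C) →
          IntervalIntegrable (fun s => (inner ℝ (y s) (A φ') : ℝ)) volume 0 T := by
        intro y C hy hC
        rw [intervalIntegrable_iff_integrableOn_Ioc_of_le hT0.le]
        refine Integrable.of_bound (C := C * ‖A φ'‖)
          (((hy.mono hsub).inner continuousOn_const).aestronglyMeasurable measurableSet_Ioc) ?_
        filter_upwards [ae_restrict_mem measurableSet_Ioc] with s hs
        exact (norm_inner_le_norm _ _).trans
          (mul_le_mul_of_nonneg_right (hC s (hsub hs)) (norm_nonneg _))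
      obtain ⟨hv1, hv2⟩ := hpull v (hv.integrable T hTmem)
      obtain ⟨hu1, hu2⟩ := hpull u (hu.integrable T hTmem)
      have h1 := hv.equation T hTmem φ'
      have h2 := hu.equation T hTmem φ'
      rw [hv2] at h1
      rw [hu2] at h2
      have h3 : ∫ s in (0 : ℝ)..T, weight ν (T - s) • (inner ℝ (e s) (φ' : Lp ℝ 2 μ) : ℝ)
          = (∫ s in (0 : ℝ)..T, weight ν (T - s) • (inner ℝ (v s - g) (φ' : Lp ℝ 2 μ) : ℝ))
            - ∫ s in (0 : ℝ)..T, weight ν (T - s) • (inner ℝ (u s - g) (φ' : Lp ℝ 2 μ) : ℝ) := by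
        rw [← intervalIntegral.integral_sub hv1 hu1]
        refine intervalIntegral.integral_congr_ae (ae_of_all _ fun s hs => ?_)
        rw [hemem s (hmem s hs), ← smul_sub, ← inner_sub_left, sub_sub_sub_cancel_right]
      have h4 : ∫ s in (0 : ℝ)..T, (inner ℝ (e s) (A φ') : ℝ)
          = (∫ s in (0 : ℝ)..T, inner ℝ (v s) (A φ'))
            - ∫ s in (0 : ℝ)..T, inner ℝ (u s) (A φ') := by
        rw [← intervalIntegral.integral_sub (hint v Cv hv.continuousOn hCv)
          (hint u Cu hu.continuousOn hCu)]
        refine intervalIntegral.integral_congr_ae (ae_of_all _ fun s hs => ?_)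
        rw [hemem s (hmem s hs), inner_sub_left]
      rw [h3, h4, h1, h2, add_sub_add_left_eq_sub]
  have hzero : ∀ φ ∈ A.domain, ∀ T ∈ Icc 0 T₀, ∫ s in (0 : ℝ)..T, inner ℝ (e s) φ = 0 := by
    intro φ hφ T hT
    obtain ⟨ψ, hφψ⟩ := LinearPMap.mem_domain_iff.1 hφ
    rw [← integral_Ioi_sub hT.1 (hz φ)]
    exact hR.integral_eq_zero_of_homogeneous hν hν_inf hP hA hsym hd hom hφψ hT.2
  have hIoo : ∀ t ∈ Ioo 0 T₀, v t - u t = 0 := by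
    intro t ht
    refine (dense_domain hP hA).eq_zero_of_inner_left ℝ fun φ hφ => ?_
    have hee : ContinuousAt (fun s => (inner ℝ (e s) φ : ℝ)) t := by
      have h1 : ContinuousAt (fun s => v s - u s) t := hcont.continuousAt (Ioc_mem_nhds ht.1 ht.2)
      have h2 : ContinuousAt (fun s => (inner ℝ (v s - u s) φ : ℝ)) t :=
        h1.inner continuousAt_const
      refine h2.congr ?_
      filter_upwards [Ioo_mem_nhds ht.1 ht.2] with s hs
      rw [hemem s (Ioo_subset_Ioc_self hs)]
    have hem : StronglyMeasurable fun s => (inner ℝ (e s) φ : ℝ) :=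
      hd.stronglyMeasurable.inner stronglyMeasurable_const
    have hei : IntervalIntegrable (fun s => (inner ℝ (e s) φ : ℝ)) volume 0 t := by
      have h1 : Integrable fun s => (inner ℝ (e s) φ : ℝ) := by
        have := (innerSL ℝ φ).integrable_comp hd.integrable
        simpa only [innerSL_apply_apply, real_inner_comm] using this
      exact h1.intervalIntegrable
    have h3 := intervalIntegral.integral_hasDerivAt_right hei
      hem.stronglyMeasurableAtFilter hee
    have h4 : (fun T => ∫ s in (0 : ℝ)..T, (inner ℝ (e s) φ : ℝ)) =ᶠ[𝓝 t] fun _ => 0 := by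
      filter_upwards [Ioo_mem_nhds ht.1 ht.2] with T hT
      exact hzero φ hφ T (Ioo_subset_Icc_self hT)
    have h5 := (h3.congr_of_eventuallyEq h4.symm).unique (hasDerivAt_const t 0)
    rw [← hemem t (Ioo_subset_Ioc_self ht)]
    exact h5
  intro t ht
  rcases eq_or_lt_of_le ht.2 with rfl | hlt
  · have h1 : Tendsto (fun s => v s - u s) (𝓝[<] t) (𝓝 (v t - u t)) :=
      (hcont t ht).mono_left (nhdsWithin_le_iff.2 (Ioc_mem_nhdsLT ht.1))
    have h2 : Tendsto (fun s => v s - u s) (𝓝[<] t) (𝓝 0) := by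
      refine tendsto_const_nhds.congr' ?_
      filter_upwards [Ioo_mem_nhdsLT ht.1] with s hs
      exact (hIoo s hs).symm
    exact sub_eq_zero.1 (tendsto_nhds_unique h1 h2)
  · exact sub_eq_zero.1 (hIoo t ⟨ht.1, hlt⟩)

end WeakSolution

end TimeFractional

/-! ### Sources in the domain of the generator -/

namespace TimeFractional

section SourceRegularity

variable {B : Type*} [NormedAddCommGroup B] [NormedSpace ℝ B]
  {P : ℝ → B →L[ℝ] B} {A : B →ₗ.[ℝ] B} {f d : ℝ → B} {T₀ K : ℝ}

/-- If `f` takes values in the domain of the generator, where the image under the generator stays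
bounded, then `f` agrees almost everywhere with a source `d` for which `t ↦ A (d t)` is again a
source. Measurability of this image holds because it is the limit of `n • (P_{1/n} f - f)`. -/
theorem exists_isSource_mem_graph (hA : IsInfinitesimalGenerator A P) (hd : IsSource T₀ d)
    (hfd : f =ᵐ[volume.restrict (Ioc 0 T₀)] d)
    (hK : ∀ᵐ t ∂(volume.restrict (Ioc 0 T₀)), ∃ h : f t ∈ A.domain, ‖A ⟨f t, h⟩‖ ≤ K) :
    ∃ d' e, IsSource T₀ d' ∧ IsSource T₀ e ∧ f =ᵐ[volume.restrict (Ioc 0 T₀)] d' ∧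
      ∀ t, (d' t, e t) ∈ A.graph := by
  classical
  set k : ℝ → B := fun t => if h : f t ∈ A.domain then A ⟨f t, h⟩ else 0 with hk
  have hkf : ∀ᵐ t ∂(volume.restrict (Ioc 0 T₀)), (f t, k t) ∈ A.graph ∧ ‖k t‖ ≤ K := by
    filter_upwards [hK] with t ht
    obtain ⟨h, hle⟩ := ht
    have hkt : k t = A ⟨f t, h⟩ := dif_pos h
    rw [hkt]
    exact ⟨A.mem_graph ⟨f t, h⟩, hle⟩
  have hfm : AEStronglyMeasurable f (volume.restrict (Ioc 0 T₀)) :=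
    hd.stronglyMeasurable.aestronglyMeasurable.congr hfd.symm
  have hseq : Tendsto (fun n : ℕ => 1 / ((n : ℝ) + 1)) atTop (𝓝[>] 0) :=
    tendsto_nhdsWithin_iff.2 ⟨tendsto_one_div_add_atTop_nhds_zero_nat,
      Eventually.of_forall fun n => mem_Ioi.2 (by positivity)⟩
  have hkm : AEStronglyMeasurable k (volume.restrict (Ioc 0 T₀)) := by
    refine aestronglyMeasurable_of_tendsto_ae atTop
      (f := fun (n : ℕ) t => (1 / ((n : ℝ) + 1))⁻¹ • (P (1 / ((n : ℝ) + 1)) (f t) - f t))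
      (fun n => ?_) ?_
    · exact (((P _).continuous.comp_aestronglyMeasurable hfm).sub hfm).const_smul _
    · filter_upwards [hkf] with t ht
      exact ((hA _ _).1 ht.1).comp hseq
  have hall : ∀ᵐ t ∂(volume.restrict (Ioc 0 T₀)),
      f t = d t ∧ (d t, hkm.mk k t) ∈ A.graph ∧ ‖hkm.mk k t‖ ≤ K ∧ t ∈ Ioc 0 T₀ := by
    filter_upwards [hfd, hkf, hkm.ae_eq_mk, ae_restrict_mem measurableSet_Ioc] with t h1 h2 h3 h4
    rw [← h1, ← h3]
    exact ⟨rfl, h2.1, h2.2, h4⟩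
  obtain ⟨G, hG, hGm, hGp⟩ := hall.exists_measurable_mem
  obtain ⟨C, hC⟩ := hd.bounded
  refine ⟨G.indicator d, G.indicator (hkm.mk k),
    ⟨hd.stronglyMeasurable.indicator hGm, ⟨C, fun s => (norm_indicator_le_norm_self _ _).trans
      (hC s)⟩, fun t ht => indicator_of_notMem (fun h => ht (hGp t h).2.2.2) _⟩,
    ⟨hkm.stronglyMeasurable_mk.indicator hGm, ⟨|K|, fun t => ?_⟩,
      fun t ht => indicator_of_notMem (fun h => ht (hGp t h).2.2.2) _⟩, ?_, fun t => ?_⟩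
  · by_cases ht : t ∈ G
    · rw [indicator_of_mem ht]
      exact (hGp t ht).2.2.1.trans (le_abs_self K)
    · rw [indicator_of_notMem ht, norm_zero]
      exact abs_nonneg K
  · filter_upwards [hG] with t ht
    rw [indicator_of_mem ht, (hGp t ht).1]
  · by_cases ht : t ∈ G
    · rw [indicator_of_mem ht, indicator_of_mem ht]
      exact (hGp t ht).2.1
    · rw [indicator_of_notMem ht, indicator_of_notMem ht]
      exact A.graph.zero_mem

end SourceRegularity

theorem IsTransitionDensity.congr {Ω : Type*} [MeasurableSpace Ω] {Prob : Measure Ω}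
    {S R : ℝ → Ω → ℝ} {p : ℝ → ℝ → ℝ} (hp : IsTransitionDensity p S Prob)
    (hRS : ∀ᵐ ω ∂Prob, ∀ r, 0 ≤ r → R r ω = S r ω) : IsTransitionDensity p R Prob :=
  ⟨hp.measurable, hp.nonneg, fun r hr => by
    rw [Measure.map_congr (hRS.mono fun ω hω => hω r hr.le), hp.map_eq r hr]⟩

end TimeFractional

theorem theorem1p3
    -- the subordinator, with bounded densities and infinite Lévy measure
    {Ω : Type*} [MeasurableSpace Ω] (Prob : Measure Ω) [IsProbabilityMeasure Prob]
    (S : ℝ → Ω → ℝ) (hS : TimeFractional.IsSubordinator S Prob)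
    (ν : Measure ℝ) (hν : TimeFractional.IsDriftlessLevyMeasure S Prob ν)
    (hdens : ∀ t, 0 < t → TimeFractional.HasBoundedDensity (S t) Prob)
    (hν_inf : ν (Ioi 0) = ∞)
    -- the state space, the Dirichlet form and its semigroup
    {E : Type*} [MetricSpace E] [LocallyCompactSpace E] [TopologicalSpace.SeparableSpace E]
    [MeasurableSpace E] [BorelSpace E]
    (μ : Measure E) [SigmaFinite μ] [μ.Regular] [μ.IsOpenPosMeasure]
    (D : TimeFractional.DirichletForm μ)
    (P : ℝ → Lp ℝ 2 μ →L[ℝ] Lp ℝ 2 μ)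
    (hP : TimeFractional.IsContractionSemigroup P)
    (hPD : TimeFractional.IsInfinitesimalGenerator D.generator P)
    -- the data
    (T₀ : ℝ) (hT₀ : 0 < T₀) (g : Lp ℝ 2 μ) (f : ℝ → Lp ℝ 2 μ)
    (hf : AEStronglyMeasurable f (volume.restrict (Ioc 0 T₀)))
    (K : ℝ) (hfK : ∀ᵐ t ∂(volume.restrict (Ioc 0 T₀)), ‖f t‖ ≤ K) :
    -- the representation is well defined at every time
    (∀ t ∈ Ioc 0 T₀,
      Integrable (fun ω => P (TimeFractional.inverseSubordinator S t ω) g) Prob ∧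
      Integrable (fun q : Ω × ℝ => TimeFractional.sourceIntegrand P S f t q.1 q.2)
        (Prob.prod (volume.restrict (Ioi (0 : ℝ))))) ∧
    -- and it agrees with the formula in terms of the transition densities
    (∃ p, TimeFractional.IsTransitionDensity p S Prob) ∧
    (∀ p, TimeFractional.IsTransitionDensity p S Prob → ∀ t ∈ Ioc 0 T₀,
      Integrable (fun q : ℝ × ℝ => p q.2 (t - q.1) • P q.2 (f q.1))
        ((volume.restrict (Ioc 0 t)).prod (volume.restrict (Ioi (0 : ℝ)))) ∧
      TimeFractional.representation P S Prob g f t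
        = (∫ ω, P (TimeFractional.inverseSubordinator S t ω) g ∂Prob)
          + ∫ s in Ioc 0 t, ∫ r in Ioi (0 : ℝ), p r (t - s) • P r (f s)) ∧
    -- it is a weak solution
    TimeFractional.IsWeakSolution (TimeFractional.weight ν) D.generator T₀ g f
      (TimeFractional.representation P S Prob g f) ∧
    -- the only one
    (∀ v : ℝ → Lp ℝ 2 μ,
      TimeFractional.IsWeakSolution (TimeFractional.weight ν) D.generator T₀ g f v →
      ∀ t ∈ Ioc 0 T₀, v t = TimeFractional.representation P S Prob g f t) ∧
    -- and `𝓛 u` is continuous if `𝓛 f` is bounded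
    ((∃ K' : ℝ, ∀ᵐ t ∂(volume.restrict (Ioc 0 T₀)),
        ∃ h : f t ∈ D.generator.domain, ‖D.generator ⟨f t, h⟩‖ ≤ K') →
      ∃ hu : ∀ t : Ioc (0 : ℝ) T₀,
          TimeFractional.representation P S Prob g f t ∈ D.generator.domain,
        Continuous fun t : Ioc (0 : ℝ) T₀ =>
          D.generator ⟨TimeFractional.representation P S Prob g f t, hu t⟩) := by
  obtain ⟨R, hR, hνR, hRS⟩ := hS.exists_regular hν hν_inf hdens
  have hSR : ∀ᵐ ω ∂Prob, ∀ r, 0 ≤ r → S r ω = R r ω :=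
    hRS.mono fun ω hω r hr => (hω r hr).symm
  have hsym := D.isSymmetricGenerator
  obtain ⟨d, hd, hfd⟩ := TimeFractional.exists_isSource hf hfK
  have hrep : ∀ t ∈ Ioc 0 T₀, TimeFractional.representation P S Prob g f t
      = TimeFractional.stoppedMean P R Prob g t + TimeFractional.potential P R Prob d t :=
    fun t ht => TimeFractional.representation_eq hR hνR hν_inf hRS hP hd hfd g ht.2
  have hweak := TimeFractional.isWeakSolution_of_eq hR hνR hν_inf hP hPD hsym hT₀ hd hfd g hrep
  refine ⟨fun t ht => ⟨?_, ?_⟩, ?_, fun p hp t ht => ?_, hweak, fun v hv => ?_, ?_⟩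
  · exact (hR.integrable_stoppedMean hP g t).congr (TimeFractional.stopped_ae_eq hRS g t)
  · exact TimeFractional.integrable_sourceIntegrand hR hνR hν_inf hRS hP hd hfd ht.2
  · obtain ⟨p, hp⟩ := hR.exists_isTransitionDensity
    exact ⟨p, hp.congr hSR⟩
  · -- only the values of `f` on `(0, t]` matter at time `t`
    have hfdt : f =ᵐ[volume.restrict (Ioc 0 t)] (Ioc 0 t).indicator d := by
      filter_upwards [ae_restrict_of_ae_restrict_of_subset (Ioc_subset_Ioc_right ht.2) hfd,
        ae_restrict_mem measurableSet_Ioc] with s h1 h2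
      rw [indicator_of_mem h2, h1]
    have hdt := hd.indicator t
    obtain ⟨hi, he⟩ := TimeFractional.potential_eq_integral_density hR hνR hν_inf hP
      (hp.congr hRS) hdt hfdt
    refine ⟨hi, ?_⟩
    rw [TimeFractional.representation,
      TimeFractional.integral_sourceIntegrand hR hνR hν_inf hRS hP hdt hfdt le_rfl, he]
  · exact TimeFractional.IsWeakSolution.eq_of_isWeakSolution hR hνR hν_inf hP hPD hsym hweak hv
  · rintro ⟨K', hK'⟩
    obtain ⟨d', e, hd', he, hfd', hde⟩ :=
      TimeFractional.exists_isSource_mem_graph hPD hd hfd hK'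
    obtain ⟨v, hv, hvc⟩ := hR.exists_stoppedMean_mem_graph hνR hP hPD hsym g
    have hgraph : ∀ t ∈ Ioc 0 T₀, (TimeFractional.representation P S Prob g f t,
        v t + TimeFractional.potential P R Prob e t) ∈ D.generator.graph := by
      intro t ht
      rw [TimeFractional.representation_eq hR hνR hν_inf hRS hP hd' hfd' g ht.2]
      exact D.generator.graph.add_mem (hv t ht.1)
        (hR.potential_mem_graph hνR hν_inf hP hPD hsym hd' he hde t)
    refine ⟨fun t => LinearPMap.mem_domain_of_mem_graph (hgraph t t.2), ?_⟩
    have hval : ∀ t : Ioc (0 : ℝ) T₀, D.generator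
        ⟨TimeFractional.representation P S Prob g f t,
          LinearPMap.mem_domain_of_mem_graph (hgraph t t.2)⟩
        = v t + TimeFractional.potential P R Prob e t := by
      intro t
      obtain ⟨y, hy1, hy2⟩ := (LinearPMap.mem_graph_iff _).1 (hgraph t t.2)
      exact (congrArg D.generator (Subtype.ext hy1.symm)).trans hy2
    simp only [hval]
    exact (hvc.comp_continuous continuous_subtype_val fun t => mem_Ioi.2 t.2.1).add
      ((hR.continuous_potential hνR hν_inf hP he).comp continuous_subtype_val)
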